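/- **Theorem 1 (regret of UCRL-MNL).** *Setting.* Let $\mathcal S$ and $\mathcal A\neq\emptyset$ be countable. Consider an episodic MDP with states $\mathcal S$, actions $\mathcal A$, horizon $H\ge 1$, known reward $r:\mathcal S\times\mathcal A\to[0,1]$ and transition probabilities $P(\cdot\mid s,a)$ whose sets of reachable states $\mathcal S_{s,a}=\{s':P(s'\mid s,a)\neq 0\}$ are finite, and let $\mathcal U=\max_{s,a}|\mathcal S_{s,a}|$. For a policy $\pi:\mathcal S\times[H]\to\mathcal A$ let $V_h^\pi(s)$ be the expected sum of the rewards from step $h$ to step $H$ when $\pi$ is followed from $s_h=s$, and let $V_h^*(s)=\sup_\pi V_h^\pi(s)$. Let $\varphi:\mathcal S\times\mathcal A\times\mathcal S\to\mathbb R^d$ ($d\ge1$) be known features and, for $\theta\in\mathbb R^d$ and $s'\in\mathcal S_{s,a}$, put $$p_\theta(s'\mid s,a)=\frac{\exp(\varphi(s,a,s')^\top\theta)}{\sum_{\tilde s\in\mathcal S_{s,a}}\exp(\varphi(s,a,\tilde s)^\top\theta)} .$$ *Assumptions.* (1) There is an unknown $\theta^*\in\mathbb R^d$ with $P(s'\mid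 s,a)=p_{\theta^*}(s'\mid s,a)$ for all $s,a$ and $s'\in\mathcal S_{s,a}$; the features are normalized so that each $\mathcal S_{s,a}$ contains a state $s'$ with $\varphi(s,a,s')=0$. (2) There are $L_\varphi,L_\theta>0$ with $\|\varphi(s,a,s')\|_2\le L_\varphi$ for all $s,a$ and $s'\in\mathcal S_{s,a}$, and $\|\theta^*\|_2\le L_\theta$. (3) $\Theta\subseteq\mathbb R^d$ is a convex parameter set containing $0$ and $\theta^*$ (for instance $\Theta=\mathbb R^d$ or a large ball), and there is $0<\kappa<1$ with $p_\theta(s'\mid s,a)\,p_\theta(s''\mid s,a)\ge\kappa$ for all $s,a$, all $s',s''\in\mathcal S_{s,a}$ and all $\theta\in\Theta$. *Algorithm.* Let $s_{k,h},a_{k,h}$ be the state and action at step $h$ of episode $k$, $1\le k\le K$. Given the past up to the choice of $a_{k,h}$, the next state $s_{k,h+1}$ has law $P(\cdot\mid s_{k,h},a_{k,h})$; the initial states $s_{k,1}$ are arbitrary and may depend on the past. Write $\mathcal S_{k,h}=\mathcal S_{s_{k,h},a_{k,h}}$, $\varphi_{k,h,s'}=\varphi(s_{k,h},a_{k,h},s')$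 and $\|x\|_B=\sqrt{x^\top Bx}$. For $\lambda>0$ and radii $\beta_k$, UCRL-MNL uses in episode $k$ the Gram matrix $$A_k=\lambda I_d+\sum_{k'<k,\,h\le H}\ \sum_{s'\in\mathcal S_{k',h}}\varphi_{k',h,s'}\varphi_{k',h,s'}^\top ,$$ the regularized maximum likelihood estimate $$\hat\theta_k\in\operatorname*{argmax}_{\theta\in\Theta}\Big[\sum_{k'<k,\,h\le H}\log p_\theta(s_{k',h+1}\mid s_{k',h},a_{k',h})-\tfrac\lambda2\|\theta\|_2^2\Big]$$ (so $\hat\theta_1=0$), and the optimistic values $\hat V_{k,H+1}=0$, $\hat V_{k,h}(s)=\min\{\sup_a\hat Q_{k,h}(s,a),H\}$, where for $h\le H$ either $$\hat Q_{k,h}(s,a)=r(s,a)+\sum_{s'\in\mathcal S_{s,a}}p_{\hat\theta_k}(s'\mid s,a)\hat V_{k,h+1}(s')+2H\beta_k\max_{s'\in\mathcal S_{s,a}}\|\varphi(s,a,s')\|_{A_k^{-1}}$$ or $$\hat Q_{k,h}(s,a)=r(s,a)+\max_{\theta:\|\theta-\hat\theta_k\|_{A_k}\le\beta_k}\ \sum_{s'\in\mathcal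 S_{s,a}}p_\theta(s'\mid s,a)\hat V_{k,h+1}(s').$$ It plays $a_{k,h}=\pi_k(s_{k,h},h)$, where $\pi_k$ is determined by the past and $\pi_k(s,h)$ maximizes $\hat Q_{k,h}(s,\cdot)$ for all $s$ and $h$. The regret is $\mathrm{Regret}(K)=\sum_{k=1}^K(V_1^*-V_1^{\pi_k})(s_{k,1})$, and $T=KH$. *Claim.* There is a universal constant $C>0$ such that, in this setting, for either choice of $\hat Q$, every $K\ge1$, every $\delta\in(0,1)$ and every $\lambda\ge L_\varphi^2$, if $$\beta_k=\frac1\kappa\sqrt{d\log\Big(1+\frac{kH\,\mathcal U\max\{1,L_\varphi^2\}}{d\lambda}\Big)+2\log\frac1\delta}+\frac1\kappa\sqrt\lambda\,L_\theta ,$$ then with probability at least $1-\delta$ $$\mathrm{Regret}(K)\le C\,(1+\sqrt\lambda L_\theta)\;\kappa^{-1}d\sqrt{H^3T}\;\Big(1+\log\Big(1+\frac{KH\,\mathcal U\max\{1,L_\varphi^2\}}{d\lambda}\Big)+\log\frac1\delta\Big),$$ that is, for constant $L_\varphi,L_\theta,\lambda$, $\mathrm{Regret}(K)=\tilde O(\kappa^{-1}d\sqrt{H^3T})$.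 -/

import Mathlib

open MeasureTheory Matrix

noncomputable section

namespace MNLRL

/-- The feature and parameter space `ℝ^d` with its Euclidean norm. -/
abbrev Vec (d : ℕ) := EuclideanSpace ℝ (Fin d)

/-- A time-homogeneous Markov decision process with a discrete state space, rewards in `[0,1]`
and finite sets of reachable states. -/
structure MDP (S A : Type*) where
  /-- the transition distribution `P(· | s, a)` -/
  P : S → A → PMF S
  /-- the set of reachable states of `(s, a)` -/
  reach : S → A → Finset S
  mem_reach : ∀ s a s', s' ∈ reach s a ↔ P s a s' ≠ 0
  /-- the (known) reward function -/
  r : S → A → ℝ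
  r_nonneg : ∀ s a, 0 ≤ r s a
  r_le_one : ∀ s a, r s a ≤ 1

/-- A (deterministic, nonstationary) policy: the action taken at step `h` in state `s`.
Steps are numbered `0, …, H - 1`. -/
abbrev Policy (S A : Type*) := ℕ → S → A

section Values

variable {S A : Type*} (M : MDP S A)

/-- The law of the next `n` state-action pairs when `π` is followed from state `s` at step `h`. -/
def rollout (π : Policy S A) : ℕ → ℕ → S → PMF (List (S × A))
  | 0, _, _ => PMF.pure []
  | n + 1, h, s =>
      (M.P s (π h s)).bind fun s' =>
        (rollout π n (h + 1) s').map fun τ => (s, π h s) :: τ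

/-- The value `V^π_h(s)`: the expected sum of rewards from step `h` to the end of an episode of
length `H`, under `π`, starting from `s` at step `h`. -/
def value (H : ℕ) (π : Policy S A) (h : ℕ) (s : S) : ℝ :=
  ∑' τ : List (S × A),
    (rollout M π (H - h) h s τ).toReal * (τ.map fun x => M.r x.1 x.2).sum

/-- The optimal value `V^*_h(s)`: the highest value over all policies. -/
def optValue (H : ℕ) (h : ℕ) (s : S) : ℝ :=
  ⨆ π : Policy S A, value M H π h s

end Values

section Model

variable {S A : Type*} {d : ℕ} (M : MDP S A) (φ : S → A → S → Vec d)

/-- The multinomial logistic probability of `s'` under the parameter `θ`. -/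
def mnlProb (θ : Vec d) (s : S) (a : A) (s' : S) : ℝ :=
  Real.exp (inner ℝ (φ s a s') θ) /
    ∑ s'' ∈ M.reach s a, Real.exp (inner ℝ (φ s a s'') θ)

/-- The transition kernel is the multinomial logistic model with core `θ`. -/
def IsMNL (θ : Vec d) : Prop :=
  ∀ s a, ∀ s' ∈ M.reach s a, (M.P s a s').toReal = mnlProb M φ θ s a s'

/-- The weighted norm `‖x‖_B = √(xᵀ B x)`. -/
def weightedNorm (B : Matrix (Fin d) (Fin d) ℝ) (x : Vec d) : ℝ :=
  Real.sqrt (x.ofLp ⬝ᵥ (B *ᵥ x.ofLp))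

/-- The Gram matrix before episode `k` (episodes are numbered `0, 1, …`) for the observed
states `x k h` and actions `u k h`. -/
def gram (H : ℕ) (lam : ℝ) (x : ℕ → ℕ → S) (u : ℕ → ℕ → A) (k : ℕ) :
    Matrix (Fin d) (Fin d) ℝ :=
  lam • (1 : Matrix (Fin d) (Fin d) ℝ) +
    ∑ k' ∈ Finset.range k, ∑ h ∈ Finset.range H, ∑ s' ∈ M.reach (x k' h) (u k' h),
      vecMulVec (φ (x k' h) (u k' h) s').ofLp (φ (x k' h) (u k' h) s').ofLp

open Classical in
/-- The log-likelihood of `θ` for the transitions observed before episode `k`. -/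
def logLik (H : ℕ) (x : ℕ → ℕ → S) (u : ℕ → ℕ → A) (k : ℕ) (θ : Vec d) : ℝ :=
  ∑ k' ∈ Finset.range k, ∑ h ∈ Finset.range H, ∑ s' ∈ M.reach (x k' h) (u k' h),
    (if x k' (h + 1) = s' then 1 else 0) * Real.log (mnlProb M φ θ (x k' h) (u k' h) s')

/-- `θ'` is a ridge-penalized maximum likelihood estimate over the parameter set `Θ`. -/
def IsRidgeMLE (Θ : Set (Vec d)) (H : ℕ) (lam : ℝ) (x : ℕ → ℕ → S) (u : ℕ → ℕ → A) (k : ℕ)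
    (θ' : Vec d) : Prop :=
  θ' ∈ Θ ∧ ∀ θ ∈ Θ,
    logLik M φ H x u k θ - lam / 2 * ‖θ‖ ^ 2 ≤ logLik M φ H x u k θ' - lam / 2 * ‖θ'‖ ^ 2

/-- The expectation of `V` at the next state under the model with parameter `θ`. -/
def mnlMean (θ : Vec d) (V : S → ℝ) (s : S) (a : A) : ℝ :=
  ∑ s' ∈ M.reach s a, mnlProb M φ θ s a s' * V s'

/-- The two optimistic action-value constructions: maximization over the confidence set, and
the closed-form bonus. -/
inductive OptimismRule
  | confidenceSet
  | closedForm

/-- One step of optimistic value iteration with estimate `θ'`, Gram matrix `G`, radius `b`. -/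
def optBackup (rule : OptimismRule) (H : ℕ) (θ' : Vec d) (G : Matrix (Fin d) (Fin d) ℝ) (b : ℝ)
    (V : S → ℝ) (s : S) (a : A) : ℝ :=
  match rule with
  | .confidenceSet =>
      M.r s a + sSup ((fun θ => mnlMean M φ θ V s a) '' {θ | weightedNorm G (θ - θ') ≤ b})
  | .closedForm =>
      M.r s a + mnlMean M φ θ' V s a +
        2 * H * b * ⨆ s' : M.reach s a, weightedNorm G⁻¹ (φ s a s')

/-- The optimistic value function with `n` steps to go, truncated at `H`. -/
def optimisticV (rule : OptimismRule) (H : ℕ) (θ' : Vec d) (G : Matrix (Fin d) (Fin d) ℝ)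
    (b : ℝ) : ℕ → S → ℝ
  | 0, _ => 0
  | n + 1, s => min (⨆ a, optBackup M φ rule H θ' G b (optimisticV rule H θ' G b n) s a) H

/-- The optimistic action-value function at step `h < H`. -/
def optimisticQ (rule : OptimismRule) (H : ℕ) (θ' : Vec d) (G : Matrix (Fin d) (Fin d) ℝ)
    (b : ℝ) (h : ℕ) (s : S) (a : A) : ℝ :=
  optBackup M φ rule H θ' G b (optimisticV M φ rule H θ' G b (H - (h + 1))) s a

end Model

/-- The confidence radius of the `k`-th episode, with episodes numbered from `1`. -/
def radius (d H U : ℕ) (κ lam Lφ Lθ δ : ℝ) (k : ℕ) : ℝ :=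
  1 / κ * Real.sqrt (d * Real.log (1 + k * H * U * max 1 (Lφ ^ 2) / (d * lam))
      + 2 * Real.log (1 / δ))
    + 1 / κ * Real.sqrt lam * Lθ

/-- `K` episodes of UCRL-MNL interacting with the MDP `M` on the probability space `(Ω, μ)`.
`s k h` and `a k h` are the state and the action at step `h` of episode `k`, `est k` the estimate
and `pol k` the policy used in episode `k`; episodes and steps are numbered from `0`, and
`s k H` is the state in which episode `k` ends. The σ-algebra `ℱ (k, h)` contains all that is
known once `s k h` has been observed. The initial states `s k 0` are arbitrary and may depend on
the past. -/
structure IsRun {S A Ω : Type*} [MeasurableSpace S] [MeasurableSpace A] {mΩ : MeasurableSpace Ω}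
    {d : ℕ} (M : MDP S A) (φ : S → A → S → Vec d) (Θ : Set (Vec d)) (rule : OptimismRule)
    (H K : ℕ) (lam : ℝ) (β : ℕ → ℝ) (μ : Measure Ω) (ℱ : Filtration (ℕ ×ₗ ℕ) mΩ)
    (s : ℕ → ℕ → Ω → S) (a : ℕ → ℕ → Ω → A) (est : ℕ → Ω → Vec d)
    (pol : ℕ → Ω → Policy S A) : Prop where
  measurable_state : ∀ k < K, ∀ h ≤ H, Measurable[ℱ (toLex (k, h))] (s k h)
  measurable_est : ∀ k < K, Measurable[ℱ (toLex (k, 0))] (est k)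
  measurable_pol : ∀ k < K, ∀ h < H, ∀ x,
    Measurable[ℱ (toLex (k, 0))] fun ω => pol k ω h x
  /-- the next state is drawn from `P(· | s, a)` given the past -/
  transition : ∀ k < K, ∀ h < H, ∀ s',
    μ[({ω | s k (h + 1) ω = s'}).indicator (fun _ => (1 : ℝ)) | ℱ (toLex (k, h))]
      =ᵐ[μ] fun ω => (M.P (s k h ω) (a k h ω) s').toReal
  /-- the estimate maximizes the penalized likelihood of the past episodes -/
  est_mle : ∀ k < K, ∀ ω,
    IsRidgeMLE M φ Θ H lam (fun i j => s i j ω) (fun i j => a i j ω) k (est k ω)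
  /-- the policy is greedy for the optimistic action-value function -/
  greedy : ∀ k < K, ∀ ω, ∀ h < H, ∀ x b,
    optimisticQ M φ rule H (est k ω)
        (gram M φ H lam (fun i j => s i j ω) (fun i j => a i j ω) k) (β (k + 1)) h x b ≤
      optimisticQ M φ rule H (est k ω)
        (gram M φ H lam (fun i j => s i j ω) (fun i j => a i j ω) k) (β (k + 1)) h x
        (pol k ω h x)
  action : ∀ k < K, ∀ ω, ∀ h < H, a k h ω = pol k ω h (s k h ω)

/-- The cumulative regret over `K` episodes, for the policies `pol k` and initial states `s₀ k`. -/
def regret {S A : Type*} (M : MDP S A) (H K : ℕ) (pol : ℕ → Policy S A) (s₀ : ℕ → S) : ℝ :=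
  ∑ k ∈ Finset.range K, (optValue M H 0 (s₀ k) - value M H (pol k) 0 (s₀ k))

end MNLRL

end

/-! The proof is the optimism argument, run on an event of probability at least `1 - δ` on which the
estimates are accurate and one martingale is small.

Estimation. Let `D` be the true parameter minus the estimate. The penalized likelihood cannot
increase from the estimate towards the truth, and `Θ` contains that segment. Along it the mean of
`⟪φ, D⟫` has the softmax variance as derivative. Since some reachable feature is zero and products
of probabilities are at least `κ`, this variance dominates `κ ∑ ⟪φ, D⟫²`, summed over all reachable
next states (`mul_sum_sq_le_variance`, `featMean_add_le`). Hence `κ` times the error in the Gram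
norm is at most the dual norm of the noise plus `√λ Lθ` (`IsRidgeMLE.weightedNorm_le`).

Noise. By Hoeffding's lemma a centered feature `ξ` satisfies `E exp (v ⬝ ξ - vᵀ Q v / 4) ≤ 1`
conditionally, where `Q` is the increment of the Gram matrix. Mixing over `v` with a Gaussian weight
and applying Ville's inequality bounds the squared dual norm by `½ log (det A / λ^d) + log (1/δ')`,
for all episodes at once (`measure_exists_selfNormalized_le`, `IsRun.measure_noise_le`). This is
half of what the radius allows, up to the replacement of `δ` by `δ' = 3δ/4`, which leaves `δ/4` for
the martingale.

Optimism. The loss `log (4/3)` in the noise bound fits into the radius once `kHU max(1, Lφ²) / (dλ)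
≥ 1` (`sqrt_add_le_radius`). In earlier episodes the truth may lie outside the confidence set, but
then every feature has dual norm at most `√(d/k)` (`div_sqrt_le_of_ratio_lt_one`). The optimism gap
is then of order `H R √(d/k)` per step, with `R` the error radius, and sums over steps and episodes
to order `H² R √(dK)`, which is within the claimed rate.

Regret. Each probability ratio of two models lies within `exp (±2c)` if the logits differ by at most
`c`, so a backup is off by `O(H R)` times the feature width (`mnlMean_sub_le`, `optBackup_le`). The
regret of an episode is therefore bounded by its optimism gap plus the truncated expected sum of
widths under the played policy, that is, by realized widths plus martingale differences
(`widthValue_le_sum`). Truncation at `H` keeps the latter bounded, so Azuma–Hoeffding applies. The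
realized widths are controlled by Cauchy–Schwarz and an elliptical potential bound, where freezing
the Gram matrix during an episode costs a factor `H` (`sum_featWidth_sq_le`). -/

noncomputable section

namespace MNLRL

open scoped ENNReal

/-! ### Discrete conditional laws, Hoeffding's lemma and Ville's inequality. -/

section ConditionalLaw

variable {Ω S : Type*} {m mΩ : MeasurableSpace Ω} [MeasurableSpace S]

/-- Conditionally on `m`, the random element `X` has the discrete law `q`. -/
structure IsCondLaw (μ : Measure Ω) (m : MeasurableSpace Ω) (X : Ω → S) (q : Ω → PMF S) :
    Prop where
  le : m ≤ mΩ
  measurable : Measurable[mΩ] X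
  measurable_law : ∀ s', Measurable[m] fun ω => q ω s'
  condExp : ∀ s', μ[({ω | X ω = s'}).indicator (fun _ => (1 : ℝ)) | m]
    =ᵐ[μ] fun ω => (q ω s').toReal

/-- The restriction of `μ` to `B` and the measure with density `p` agree on `m`, by the defining
property of conditional expectation. Comparing trimmed measures gives the identity for every
nonnegative `f`, with no integrability condition. -/
theorem setLIntegral_eq_of_condExp_indicator {μ : Measure Ω} [IsFiniteMeasure μ]
    (hm : m ≤ mΩ) {B : Set Ω} (hB : MeasurableSet B) {p : Ω → ℝ}
    (hp : ∀ ω, 0 ≤ p ω)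
    (h : μ[B.indicator (fun _ => (1 : ℝ)) | m] =ᵐ[μ] p)
    {f : Ω → ℝ≥0∞} (hpm : Measurable p) (hf : Measurable[m] f) :
    ∫⁻ ω in B, f ω ∂μ = ∫⁻ ω, ENNReal.ofReal (p ω) * f ω ∂μ := by
  have hint : Integrable p μ := integrable_condExp.congr h
  have key : (μ.restrict B).trim hm = (μ.withDensity fun ω => ENNReal.ofReal (p ω)).trim hm := by
    refine @Measure.ext _ m _ _ fun G hG => ?_
    have hG' := hm G hG
    rw [trim_measurableSet_eq hm hG, trim_measurableSet_eq hm hG, Measure.restrict_apply hG',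
      withDensity_apply _ hG']
    rw [← ofReal_integral_eq_lintegral_ofReal hint.integrableOn (ae_of_all _ hp)]
    have h1 : ∫ ω in G, p ω ∂μ = ∫ ω in G, B.indicator (fun _ => (1 : ℝ)) ω ∂μ := by
      rw [← setIntegral_condExp hm ((integrable_const (1 : ℝ)).indicator hB) hG]
      exact setIntegral_congr_ae hG' (h.mono fun ω hω _ => hω.symm)
    rw [h1, setIntegral_indicator hB]
    simp [Measure.real]
  calc ∫⁻ ω in B, f ω ∂μ = ∫⁻ ω, f ω ∂((μ.restrict B).trim hm) := (lintegral_trim hm hf).symm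
    _ = ∫⁻ ω, f ω ∂(μ.withDensity fun ω => ENNReal.ofReal (p ω)) := by
        rw [key, lintegral_trim hm hf]
    _ = _ := by
        rw [lintegral_withDensity_eq_lintegral_mul _ hpm.ennreal_ofReal (hf.mono hm le_rfl)]
        rfl

theorem IsCondLaw.lintegral_eq [Countable S] [DiscreteMeasurableSpace S] {μ : Measure Ω}
    [IsFiniteMeasure μ] {X : Ω → S} {q : Ω → PMF S}
    (h : IsCondLaw μ m X q) {F : Ω → S → ℝ≥0∞} (hF : ∀ s', Measurable[m] fun ω => F ω s') :
    ∫⁻ ω, F ω (X ω) ∂μ = ∫⁻ ω, ∑' s', q ω s' * F ω s' ∂μ := by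
  have hB : ∀ s', MeasurableSet {ω | X ω = s'} := fun s' =>
    h.measurable (MeasurableSet.of_discrete (s := {s'}))
  have h1 : ∀ ω, F ω (X ω) = ∑' s', ({ω | X ω = s'}).indicator (fun ω => F ω s') ω := by
    intro ω
    rw [tsum_eq_single (X ω)]
    · simp
    · intro s' hs'
      simp [Set.indicator, hs'.symm]
  have hq : ∀ s', Measurable fun ω => q ω s' := fun s' => (h.measurable_law s').mono h.le le_rfl
  have hF' : ∀ s', Measurable fun ω => F ω s' := fun s' => (hF s').mono h.le le_rfl
  simp_rw [h1]
  rw [lintegral_tsum fun s' => ((hF' s').indicator (hB s')).aemeasurable,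
    lintegral_tsum (f := fun s' ω => q ω s' * F ω s')
      fun s' => ((hq s').mul (hF' s')).aemeasurable]
  congr 1
  ext s'
  rw [lintegral_indicator (hB s'),
    setLIntegral_eq_of_condExp_indicator h.le (hB s') (fun _ => ENNReal.toReal_nonneg)
      (h.condExp s') (hq s').ennreal_toReal (hF s')]
  simp [ENNReal.ofReal_toReal (PMF.apply_ne_top _ _)]

/-- Hoeffding's lemma for a finitely supported discrete law. -/
theorem tsum_mul_exp_sub_mean_le_one [Countable S] [DiscreteMeasurableSpace S] (q : PMF S)
    (R : Finset S) (hR : ∀ s', q s' ≠ 0 → s' ∈ R) (g : S → ℝ) {a b c : ℝ}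
    (hg : ∀ s' ∈ R, g s' ∈ Set.Icc a b) (hc : (b - a) ^ 2 / 8 ≤ c) :
    ∑' s', q s' * ENNReal.ofReal
      (Real.exp (g s' - ∑ s'' ∈ R, (q s'').toReal * g s'' - c)) ≤ 1 := by
  have hae : ∀ᵐ s' ∂q.toMeasure, s' ∈ R := by
    rw [ae_iff, PMF.toMeasure_apply_eq_zero_iff _ (MeasurableSet.of_discrete)]
    rw [Set.disjoint_left]
    intro s' h1 h2
    exact h2 (hR s' ((PMF.mem_support_iff _ _).1 h1))
  have hbd : ∀ f : S → ℝ, Integrable f q.toMeasure := by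
    intro f
    refine Integrable.mono' (g := fun _ => ∑ s' ∈ R, |f s'|) (integrable_const _)
      (measurable_of_countable f).aestronglyMeasurable ?_
    filter_upwards [hae] with s' hs'
    exact Finset.single_le_sum (f := fun s' => |f s'|) (fun _ _ => abs_nonneg _) hs'
  have hsum : ∀ f : S → ℝ, ∫ s', f s' ∂q.toMeasure = ∑ s' ∈ R, (q s').toReal * f s' := by
    intro f
    rw [PMF.integral_eq_tsum _ _ (hbd f)]
    rw [tsum_eq_sum (s := R)]
    · rfl
    · intro s' hs'
      have : q s' = 0 := by_contra fun hne => hs' (hR s' hne)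
      simp [this]
  have hsg := ProbabilityTheory.hasSubgaussianMGF_of_mem_Icc (μ := q.toMeasure) (X := g)
    (measurable_of_countable g).aemeasurable (hae.mono hg)
  -- The sub-Gaussian parameter is `((b - a) / 2) ^ 2`, so at argument 1 the exponent is `(b - a) ^
  -- 2 / 8`.
  have h1 := hsg.mgf_le 1
  set mean := ∑ s'' ∈ R, (q s'').toReal * g s'' with hmean
  rw [ProbabilityTheory.mgf, hsum g, ← hmean] at h1
  have h2 : ∑' s', q s' * ENNReal.ofReal (Real.exp (g s' - mean - c))
      = ∫⁻ s', ENNReal.ofReal (Real.exp (g s' - mean - c)) ∂q.toMeasure := by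
    rw [lintegral_countable']
    refine tsum_congr fun s' => ?_
    rw [PMF.toMeasure_apply_singleton _ _ (MeasurableSet.of_discrete), mul_comm]
  rw [h2, ← ofReal_integral_eq_lintegral_ofReal (hbd _) (ae_of_all _ fun _ => (Real.exp_pos _).le)]
  rw [← ENNReal.ofReal_one]
  apply ENNReal.ofReal_le_ofReal
  have h3 : ∀ s', Real.exp (g s' - mean - c) = Real.exp (1 * (g s' - mean)) * Real.exp (-c) := by
    intro s'; rw [← Real.exp_add]; ring_nf
  simp_rw [h3]
  rw [integral_mul_const]
  calc _ ≤ Real.exp (((‖b - a‖₊ / 2) ^ 2 : NNReal) * 1 ^ 2 / 2) * Real.exp (-c) := by gcongr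
    _ = Real.exp ((b - a) ^ 2 / 8 - c) := by
        rw [← Real.exp_add]
        congr 1
        push_cast
        rw [Real.norm_eq_abs, div_pow, sq_abs]
        ring
    _ ≤ 1 := Real.exp_le_one_iff.2 (by linarith)

/-- A conditional Hoeffding lemma, integrated against nonnegative `m`-measurable weights. -/
theorem IsCondLaw.lintegral_mul_exp_le [Countable S] [DiscreteMeasurableSpace S] {μ : Measure Ω}
    [IsFiniteMeasure μ] {X : Ω → S} {q : Ω → PMF S}
    (h : IsCondLaw μ m X q) (R : Ω → Finset S) (hR : ∀ ω s', q ω s' ≠ 0 → s' ∈ R ω)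
    {g : Ω → S → ℝ} {mean c : Ω → ℝ} (hg : ∀ s', Measurable[m] fun ω => g ω s')
    (hmean : ∀ ω, mean ω = ∑ s' ∈ R ω, (q ω s').toReal * g ω s')
    (hmeanm : Measurable[m] mean) (hcm : Measurable[m] c)
    (hc : ∀ ω, ∃ a b, (∀ s' ∈ R ω, g ω s' ∈ Set.Icc a b) ∧ (b - a) ^ 2 / 8 ≤ c ω)
    {f : Ω → ℝ≥0∞} (hf : Measurable[m] f) :
    ∫⁻ ω, f ω * ENNReal.ofReal (Real.exp (g ω (X ω) - mean ω - c ω)) ∂μ ≤ ∫⁻ ω, f ω ∂μ := by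
  rw [h.lintegral_eq (F := fun ω s' =>
    f ω * ENNReal.ofReal (Real.exp (g ω s' - mean ω - c ω)))]
  · refine lintegral_mono fun ω => ?_
    obtain ⟨a, b, hab, hcω⟩ := hc ω
    have := tsum_mul_exp_sub_mean_le_one (q ω) (R ω) (hR ω) (g ω) hab hcω
    rw [← hmean] at this
    calc ∑' s', q ω s' * (f ω * ENNReal.ofReal (Real.exp (g ω s' - mean ω - c ω)))
        = f ω * ∑' s', q ω s' * ENNReal.ofReal (Real.exp (g ω s' - mean ω - c ω)) := by
          rw [← ENNReal.tsum_mul_left]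
          exact tsum_congr fun s' => by ring
      _ ≤ f ω * 1 := by gcongr
      _ = f ω := mul_one _
  · intro s'
    exact hf.mul (((Real.measurable_exp.comp (((hg s').sub hmeanm).sub hcm))).ennreal_ofReal)

/-- The indicator of the states of conditional probability zero has conditional mean zero. -/
theorem IsCondLaw.ae_mem [Countable S] [DiscreteMeasurableSpace S] {μ : Measure Ω}
    [IsFiniteMeasure μ] {X : Ω → S} {q : Ω → PMF S}
    (h : IsCondLaw μ m X q) : ∀ᵐ ω ∂μ, q ω (X ω) ≠ 0 := by
  classical
  have hF : ∀ s', Measurable[m] fun ω => if q ω s' = 0 then (1 : ℝ≥0∞) else 0 := fun s' =>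
    Measurable.ite (h.measurable_law s' (measurableSet_singleton 0)) measurable_const
      measurable_const
  have h1 := h.lintegral_eq (F := fun ω s' => if q ω s' = 0 then 1 else 0) hF
  have h2 : ∀ ω, ∑' s', q ω s' * (if q ω s' = 0 then (1 : ℝ≥0∞) else 0) = 0 := by
    intro ω
    rw [ENNReal.tsum_eq_zero]
    intro s'
    split_ifs with h0 <;> simp [h0]
  simp_rw [h2, lintegral_zero] at h1
  have hm : Measurable fun ω => if q ω (X ω) = 0 then (1 : ℝ≥0∞) else 0 := by
    have hq : Measurable fun p : S × Ω => q p.2 p.1 :=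
      measurable_from_prod_countable_right fun s' => (h.measurable_law s').mono h.le le_rfl
    have : Measurable fun ω => q ω (X ω) := hq.comp (h.measurable.prodMk measurable_id)
    exact Measurable.ite (this (measurableSet_singleton 0)) measurable_const measurable_const
  rw [lintegral_eq_zero_iff hm] at h1
  filter_upwards [h1] with ω hω h0
  simp [h0] at hω

/-- Ville's maximal inequality over a finite horizon. -/
theorem measure_exists_le_le_of_setLIntegral_le {μ : Measure Ω} {N : ℕ}
    {𝒢 : ℕ → MeasurableSpace Ω} (hle : ∀ t, 𝒢 t ≤ mΩ) (hmono : Monotone 𝒢)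
    {W : ℕ → Ω → ℝ≥0∞} (hW : ∀ t ≤ N, Measurable[𝒢 t] (W t))
    (hstep : ∀ t < N, ∀ G, MeasurableSet[𝒢 t] G → ∫⁻ ω in G, W (t + 1) ω ∂μ ≤ ∫⁻ ω in G, W t ω ∂μ)
    (c : ℝ≥0∞) : c * μ {ω | ∃ t ≤ N, c ≤ W t ω} ≤ ∫⁻ ω, W 0 ω ∂μ := by
  set E : ℕ → Set Ω := fun n => {ω | ∃ t < n, c ≤ W t ω} with hE
  have hEm : ∀ n ≤ N, MeasurableSet[𝒢 n] (E n) := by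
    intro n hn
    have : E n = ⋃ t ∈ Finset.range n, {ω | c ≤ W t ω} := by ext; simp [hE]
    rw [this]
    refine @Finset.measurableSet_biUnion _ _ (𝒢 n) _ _ fun t ht => ?_
    have ht' : t < n := Finset.mem_range.1 ht
    exact hmono ht'.le _ (hW t (ht'.le.trans hn) measurableSet_Ici)
  have hEsucc : ∀ n, E (n + 1) = E n ∪ ((E n)ᶜ ∩ {ω | c ≤ W n ω}) := by
    intro n
    ext ω
    simp only [hE, Set.mem_ofPred_eq, Set.mem_union, Set.mem_inter_iff, Set.mem_compl_iff]
    constructor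
    · rintro ⟨t, ht, hc⟩
      by_cases h' : ∃ t < n, c ≤ W t ω
      · exact Or.inl h'
      · refine Or.inr ⟨h', ?_⟩
        rcases Nat.lt_succ_iff_lt_or_eq.1 ht with h1 | h1
        · exact absurd ⟨t, h1, hc⟩ h'
        · exact h1 ▸ hc
    · rintro (⟨t, ht, hc⟩ | ⟨-, hc⟩)
      · exact ⟨t, ht.trans n.lt_succ_self, hc⟩
      · exact ⟨n, n.lt_succ_self, hc⟩
  -- This is optional stopping without stopping times: paths that crossed before `n` are charged
  -- `c`, all others their current weight.
  have hind : ∀ n ≤ N, c * μ (E n) + ∫⁻ ω in (E n)ᶜ, W n ω ∂μ ≤ ∫⁻ ω, W 0 ω ∂μ := by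
    intro n
    induction n with
    | zero => intro _; simp [hE]
    | succ n ih =>
      intro hn
      have hn' : n < N := hn
      refine le_trans ?_ (ih hn'.le)
      set D := {ω | c ≤ W n ω}
      have hD : MeasurableSet[𝒢 n] D := hW n hn'.le measurableSet_Ici
      have hEc := (hEm n hn'.le).compl
      have h1 : c * μ (E (n + 1)) ≤ c * μ (E n) + ∫⁻ ω in (E n)ᶜ ∩ D, W n ω ∂μ := by
        rw [hEsucc]
        calc c * μ (E n ∪ ((E n)ᶜ ∩ D)) ≤ c * (μ (E n) + μ ((E n)ᶜ ∩ D)) := by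
              gcongr; exact measure_union_le _ _
          _ = c * μ (E n) + ∫⁻ ω in (E n)ᶜ ∩ D, c ∂μ := by rw [mul_add, setLIntegral_const]
          _ ≤ _ := by
              refine add_le_add le_rfl ?_
              exact setLIntegral_mono' ((hle n _ (hEc.inter hD))) fun ω hω => hω.2
      have h2 : (E (n + 1))ᶜ = (E n)ᶜ \ D := by
        rw [hEsucc]; ext ω; simp only [Set.mem_compl_iff, Set.mem_union, Set.mem_inter_iff,
          Set.mem_sdiff]; tauto
      have h3 : ∫⁻ ω in (E (n + 1))ᶜ, W (n + 1) ω ∂μ ≤ ∫⁻ ω in (E n)ᶜ \ D, W n ω ∂μ := by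
        rw [h2]; exact hstep n hn' _ (hEc.diff hD)
      calc c * μ (E (n + 1)) + ∫⁻ ω in (E (n + 1))ᶜ, W (n + 1) ω ∂μ
          ≤ c * μ (E n) + (∫⁻ ω in (E n)ᶜ ∩ D, W n ω ∂μ + ∫⁻ ω in (E n)ᶜ \ D, W n ω ∂μ) := by
            rw [← add_assoc]; exact add_le_add h1 h3
        _ = _ := by rw [lintegral_inter_add_sdiff _ _ (hle n _ hD)]
  have hsplit : {ω | ∃ t ≤ N, c ≤ W t ω} = E N ∪ ((E N)ᶜ ∩ {ω | c ≤ W N ω}) := by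
    rw [← hEsucc]; ext ω; simp [hE]
  rw [hsplit]
  refine le_trans ?_ (hind N le_rfl)
  have hD : MeasurableSet {ω | c ≤ W N ω} := hle N _ (hW N le_rfl measurableSet_Ici)
  calc c * μ (E N ∪ ((E N)ᶜ ∩ {ω | c ≤ W N ω}))
      ≤ c * (μ (E N) + μ ((E N)ᶜ ∩ {ω | c ≤ W N ω})) := by gcongr; exact measure_union_le _ _
    _ = c * μ (E N) + ∫⁻ ω in (E N)ᶜ ∩ {ω | c ≤ W N ω}, c ∂μ := by rw [mul_add, setLIntegral_const]
    _ ≤ c * μ (E N) + ∫⁻ ω in (E N)ᶜ ∩ {ω | c ≤ W N ω}, W N ω ∂μ := by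
        refine add_le_add le_rfl ?_
        exact setLIntegral_mono' ((hle N _ (hEm N le_rfl).compl).inter hD) fun ω hω => hω.2
    _ ≤ _ := by gcongr; exact Set.inter_subset_left

end ConditionalLaw

/-! ### Quadratic forms, determinants and traces of positive definite matrices. -/

section Matrices

variable {n : Type*} [Fintype n]

theorem dotProduct_mulVec_comm_of_isHermitian {A : Matrix n n ℝ} (hA : A.IsHermitian) (x y : n → ℝ) :
    x ⬝ᵥ (A *ᵥ y) = y ⬝ᵥ (A *ᵥ x) := by
  have h : Aᵀ = A := by rw [← conjTranspose_eq_transpose_of_trivial]; exact hA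
  rw [dotProduct_comm, dotProduct_mulVec, ← mulVec_transpose, h]

theorem posSemidef_dotProduct_nonneg {A : Matrix n n ℝ} (hA : A.PosSemidef) (x : n → ℝ) :
    0 ≤ x ⬝ᵥ (A *ᵥ x) := by
  simpa using hA.dotProduct_mulVec_nonneg x

variable [DecidableEq n]

theorem exists_transpose_mul_self_eq {A : Matrix n n ℝ} (hA : A.PosDef) :
    ∃ B : Matrix n n ℝ, A = Bᵀ * B ∧ B.det ≠ 0 := by
  open scoped MatrixOrder in
  obtain ⟨B, hB⟩ := CStarAlgebra.nonneg_iff_eq_star_mul_self.mp hA.posSemidef.nonneg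
  rw [star_eq_conjTranspose, conjTranspose_eq_transpose_of_trivial] at hB
  refine ⟨B, hB, fun h0 => ?_⟩
  have := hA.det_pos
  rw [hB, det_mul, h0, mul_zero] at this
  exact lt_irrefl _ this

theorem posDef_mulVec_inv {A : Matrix n n ℝ} (hA : A.PosDef) (x : n → ℝ) :
    A *ᵥ (A⁻¹ *ᵥ x) = x := by
  rw [mulVec_mulVec, mul_nonsing_inv _ ((isUnit_iff_isUnit_det _).1 hA.isUnit), one_mulVec]

/-- The Cauchy–Schwarz inequality for the dual norms of `A` and `A⁻¹`. -/
theorem sq_dotProduct_le_inv_mul {A : Matrix n n ℝ} (hA : A.PosDef) (x y : n → ℝ) :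
    (x ⬝ᵥ y) ^ 2 ≤ (x ⬝ᵥ (A⁻¹ *ᵥ x)) * (y ⬝ᵥ (A *ᵥ y)) := by
  have key : ∀ t : ℝ, 0 ≤ (x ⬝ᵥ (A⁻¹ *ᵥ x)) * (t * t) + (-2 * (x ⬝ᵥ y)) * t
      + y ⬝ᵥ (A *ᵥ y) := by
    intro t
    have h := posSemidef_dotProduct_nonneg hA.posSemidef (y - t • (A⁻¹ *ᵥ x))
    have e1 : A *ᵥ (y - t • (A⁻¹ *ᵥ x)) = A *ᵥ y - t • x := by
      rw [mulVec_sub, mulVec_smul, posDef_mulVec_inv hA]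
    have e2 : (A⁻¹ *ᵥ x) ⬝ᵥ (A *ᵥ y) = x ⬝ᵥ y := by
      rw [dotProduct_mulVec_comm_of_isHermitian hA.isHermitian, posDef_mulVec_inv hA, dotProduct_comm]
    rw [e1, sub_dotProduct, dotProduct_sub, dotProduct_sub, smul_dotProduct, smul_dotProduct,
      dotProduct_smul, dotProduct_smul, e2, dotProduct_comm y x,
      dotProduct_comm (A⁻¹ *ᵥ x) x] at h
    simp only [smul_eq_mul] at h
    linarith
  have := discrim_le_zero key
  rw [discrim] at this
  nlinarith

/-- With `y = A⁻¹ x`, positivity of `V` gives `λ |y|² ≤ x ⬝ y`; inserting this into `0 ≤ |x - λ y|²`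
gives the bound. -/
theorem dotProduct_inv_mulVec_le {V : Matrix n n ℝ} (hV : V.PosSemidef) {lam : ℝ} (hl : 0 < lam)
    (hA : (lam • (1 : Matrix n n ℝ) + V).PosDef) (x : n → ℝ) :
    x ⬝ᵥ ((lam • (1 : Matrix n n ℝ) + V)⁻¹ *ᵥ x) ≤ (x ⬝ᵥ x) / lam := by
  set A := lam • (1 : Matrix n n ℝ) + V with hAdef
  set y := A⁻¹ *ᵥ x with hy
  have h1 : lam * (y ⬝ᵥ y) ≤ x ⬝ᵥ y := by
    have h2 : y ⬝ᵥ (A *ᵥ y) = x ⬝ᵥ y := by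
      rw [hy, posDef_mulVec_inv hA, dotProduct_comm]
    rw [← h2, hAdef, add_mulVec, smul_mulVec, one_mulVec, dotProduct_add, dotProduct_smul,
      smul_eq_mul]
    linarith [posSemidef_dotProduct_nonneg hV y]
  have h3 : 0 ≤ (x - lam • y) ⬝ᵥ (x - lam • y) := by
    simpa using dotProduct_star_self_nonneg (x - lam • y)
  rw [sub_dotProduct, dotProduct_sub, dotProduct_sub, smul_dotProduct, smul_dotProduct,
      dotProduct_smul, dotProduct_smul, dotProduct_comm y x] at h3
  simp only [smul_eq_mul] at h3
  rw [le_div_iff₀ hl]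
  nlinarith

/-- AM–GM for the eigenvalues, in the form of the tangent of the logarithm at `c`. -/
theorem log_det_le_of_trace_le {A : Matrix n n ℝ} (hA : A.PosDef) [Nonempty n] {c : ℝ}
    (hc : 0 < c) (htr : A.trace ≤ Fintype.card n * c) :
    Real.log A.det ≤ Fintype.card n * Real.log c := by
  have hpos := hA.eigenvalues_pos
  have hd : A.det = ∏ i, hA.1.eigenvalues i := by
    simpa using hA.1.det_eq_prod_eigenvalues
  have ht : A.trace = ∑ i, hA.1.eigenvalues i := by
    simpa using hA.1.trace_eq_sum_eigenvalues
  rw [hd, Real.log_prod fun i _ => (hpos i).ne']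
  have h1 : ∀ i, Real.log (hA.1.eigenvalues i) ≤ hA.1.eigenvalues i / c - 1 + Real.log c := by
    intro i
    have := Real.log_le_sub_one_of_pos (div_pos (hpos i) hc)
    rw [Real.log_div (hpos i).ne' hc.ne'] at this
    linarith
  calc ∑ i, Real.log (hA.1.eigenvalues i)
      ≤ ∑ i, (hA.1.eigenvalues i / c - 1 + Real.log c) := Finset.sum_le_sum fun i _ => h1 i
    _ = A.trace / c - Fintype.card n + Fintype.card n * Real.log c := by
        rw [Finset.sum_add_distrib, Finset.sum_sub_distrib, ← Finset.sum_div, ← ht]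
        simp
    _ ≤ _ := by
        have : A.trace / c ≤ Fintype.card n := by rwa [div_le_iff₀ hc]
        linarith

theorem one_add_sum_sub_one_le_prod {ι : Type*} (s : Finset ι) (f : ι → ℝ) (hf : ∀ i, 1 ≤ f i) :
    1 + ∑ i ∈ s, (f i - 1) ≤ ∏ i ∈ s, f i := by
  classical
  induction s using Finset.induction_on with
  | empty => simp
  | insert i s hi ih =>
    rw [Finset.sum_insert hi, Finset.prod_insert hi]
    have h0 : 0 ≤ ∑ i ∈ s, (f i - 1) := Finset.sum_nonneg fun i _ => by linarith [hf i]
    nlinarith [hf i]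

theorem one_add_trace_le_det_one_add {Q : Matrix n n ℝ} (hQ : Q.PosSemidef) :
    1 + Q.trace ≤ (1 + Q).det := by
  have hH : (1 + Q).IsHermitian := isHermitian_one.add hQ.1
  have h1 : ∀ i, 1 ≤ hH.eigenvalues i := by
    intro i
    rw [hH.eigenvalues_eq, add_mulVec, one_mulVec, dotProduct_add]
    have e : star (hH.eigenvectorBasis i).ofLp ⬝ᵥ (hH.eigenvectorBasis i).ofLp = 1 := by
      have := hH.eigenvectorBasis.orthonormal.1 i
      rw [dotProduct_comm, ← EuclideanSpace.inner_eq_star_dotProduct, real_inner_self_eq_norm_sq,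
        this, one_pow]
    have := hQ.dotProduct_mulVec_nonneg (hH.eigenvectorBasis i).ofLp
    simp only [RCLike.re_to_real]
    linarith
  have hd : (1 + Q).det = ∏ i, hH.eigenvalues i := by simpa using hH.det_eq_prod_eigenvalues
  have ht : (1 + Q).trace = ∑ i, hH.eigenvalues i := by simpa using hH.trace_eq_sum_eigenvalues
  have := one_add_sum_sub_one_le_prod Finset.univ _ h1
  rw [Finset.sum_sub_distrib, ← hd, ← ht, trace_add, trace_one] at this
  simpa using this

/-- A factorization `A = Bᵀ B` reduces this to `A = 1`, where all eigenvalues of `1 + Q` are at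
least 1. Using the trace of the whole increment, and not rank-one updates, allows all steps of an
episode to be added at once. -/
theorem det_mul_one_add_trace_le_det_add {A P : Matrix n n ℝ} (hA : A.PosDef)
    (hP : P.PosSemidef) : A.det * (1 + (A⁻¹ * P).trace) ≤ (A + P).det := by
  obtain ⟨B, hB, hdet⟩ := exists_transpose_mul_self_eq hA
  have hu : IsUnit B.det := hdet.isUnit
  have hut : IsUnit Bᵀ.det := by rwa [det_transpose]
  set Q := (B⁻¹)ᵀ * P * B⁻¹ with hQdef
  have hQ : Q.PosSemidef := by
    have := hP.conjTranspose_mul_mul_same B⁻¹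
    rwa [conjTranspose_eq_transpose_of_trivial] at this
  have e1 : A + P = Bᵀ * (1 + Q) * B := by
    rw [hQdef, mul_add, add_mul, mul_one, ← hB, transpose_nonsing_inv]
    congr 1
    rw [← mul_assoc, ← mul_assoc, mul_nonsing_inv _ hut, one_mul, mul_assoc,
      nonsing_inv_mul _ hu, mul_one]
  have e2 : (A⁻¹ * P).trace = Q.trace := by
    rw [hQdef, hB, Matrix.mul_inv_rev, transpose_nonsing_inv, mul_assoc B⁻¹, trace_mul_comm]
  have e3 : A.det = B.det * B.det := by rw [hB, det_mul, det_transpose]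
  rw [e1, e2, e3, det_mul, det_mul, det_transpose]
  nlinarith [one_add_trace_le_det_one_add hQ, mul_self_nonneg B.det]

theorem trace_inv_mul_vecMulVec (A : Matrix n n ℝ) (x : n → ℝ) :
    (A⁻¹ * vecMulVec x x).trace = x ⬝ᵥ (A⁻¹ *ᵥ x) := by
  rw [mul_vecMulVec, trace_vecMulVec, dotProduct_comm]

end Matrices

/-! ### The Gaussian integral behind the method of mixtures. -/

section Gaussian

variable {d : ℕ}

/-- The normalizing integral of the isotropic Gaussian weight `exp (-‖u‖² / 4)`. -/
def gaussMass (d : ℕ) : ℝ≥0∞ :=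
  ∫⁻ u : Fin d → ℝ, ENNReal.ofReal (Real.exp (-(1 / 4) * (u ⬝ᵥ u)))

theorem gaussMass_ne_top : gaussMass d ≠ ∞ := by
  have h : Integrable (fun u : Fin d → ℝ => Real.exp (-(1 / 4) * (u ⬝ᵥ u))) := by
    have h1 : Integrable (fun u : Fin d → ℝ => ∏ i, Real.exp (-(1 / 4) * (u i) ^ 2)) :=
      Integrable.fintype_prod (f := fun _ (x : ℝ) => Real.exp (-(1 / 4) * x ^ 2))
        fun _ => integrable_exp_neg_mul_sq (by norm_num)
    refine h1.congr (ae_of_all _ fun u => ?_)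
    simp only [← Real.exp_sum, ← Finset.mul_sum, dotProduct, sq]
  have := h.lintegral_lt_top
  exact this.ne

theorem gaussMass_ne_zero : gaussMass d ≠ 0 := by
  have hm : Measurable fun u : Fin d → ℝ => ENNReal.ofReal (Real.exp (-(1 / 4) * (u ⬝ᵥ u))) := by
    unfold dotProduct
    fun_prop
  rw [gaussMass, Ne, lintegral_eq_zero_iff hm]
  intro h
  obtain ⟨u, hu⟩ := h.exists
  exact absurd hu (by simp [Real.exp_pos])

/-- Completing the square around `2 A⁻¹ x` and substituting `u = B (v - 2 A⁻¹ x)` with `A = Bᵀ B`.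
The value of `gaussMass` is never needed, because it cancels. -/
theorem lintegral_exp_dotProduct_sub_quadratic {A : Matrix (Fin d) (Fin d) ℝ} (hA : A.PosDef)
    (x : Fin d → ℝ) :
    ∫⁻ v : Fin d → ℝ, ENNReal.ofReal (Real.exp (v ⬝ᵥ x - 1 / 4 * (v ⬝ᵥ (A *ᵥ v)))) =
      ENNReal.ofReal (Real.exp (x ⬝ᵥ (A⁻¹ *ᵥ x)) / Real.sqrt A.det) * gaussMass d := by
  obtain ⟨B, hB, hdet⟩ := exists_transpose_mul_self_eq hA
  set y := A⁻¹ *ᵥ x with hy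
  have hsq : ∀ v : Fin d → ℝ, v ⬝ᵥ x - 1 / 4 * (v ⬝ᵥ (A *ᵥ v)) =
      x ⬝ᵥ y + -(1 / 4) * ((B *ᵥ (v - (2 : ℝ) • y)) ⬝ᵥ (B *ᵥ (v - (2 : ℝ) • y))) := by
    intro v
    have e1 : (B *ᵥ (v - (2 : ℝ) • y)) ⬝ᵥ (B *ᵥ (v - (2 : ℝ) • y))
        = (v - (2 : ℝ) • y) ⬝ᵥ (A *ᵥ (v - (2 : ℝ) • y)) := by
      rw [hB, ← mulVec_mulVec, dotProduct_mulVec _ Bᵀ, vecMul_transpose]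
    have e2 : A *ᵥ (v - (2 : ℝ) • y) = A *ᵥ v - (2 : ℝ) • x := by
      rw [mulVec_sub, mulVec_smul, hy, posDef_mulVec_inv hA]
    have e3 : y ⬝ᵥ (A *ᵥ v) = v ⬝ᵥ x := by
      rw [dotProduct_mulVec_comm_of_isHermitian hA.isHermitian, hy, posDef_mulVec_inv hA]
    rw [e1, e2, sub_dotProduct, dotProduct_sub, dotProduct_sub, smul_dotProduct, smul_dotProduct,
      dotProduct_smul, dotProduct_smul, e3, dotProduct_comm y x]
    simp only [smul_eq_mul]
    ring
  set f : (Fin d → ℝ) → ℝ≥0∞ := fun u => ENNReal.ofReal (Real.exp (-(1 / 4) * (u ⬝ᵥ u)))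
  have hf : Measurable f := by
    simp only [f]; unfold dotProduct; fun_prop
  have hmeas : Measurable (toLin' B) := by
    exact (LinearMap.continuous_of_finiteDimensional (toLin' B)).measurable
  calc _ = ∫⁻ v : Fin d → ℝ, ENNReal.ofReal (Real.exp (x ⬝ᵥ y)) *
        f (toLin' B (v - (2 : ℝ) • y)) := by
        refine lintegral_congr fun v => ?_
        rw [hsq, Real.exp_add, ENNReal.ofReal_mul (Real.exp_pos _).le]
        rfl
    _ = ENNReal.ofReal (Real.exp (x ⬝ᵥ y)) * ∫⁻ v : Fin d → ℝ, f (toLin' B (v - (2 : ℝ) • y)) := by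
        rw [lintegral_const_mul]
        exact hf.comp (hmeas.comp (measurable_id.sub_const _))
    _ = ENNReal.ofReal (Real.exp (x ⬝ᵥ y)) * ∫⁻ v : Fin d → ℝ, f (toLin' B v) := by
        rw [lintegral_sub_right_eq_self (fun v => f (toLin' B v))]
    _ = ENNReal.ofReal (Real.exp (x ⬝ᵥ y)) * ∫⁻ v, f v ∂(Measure.map (toLin' B) volume) := by
        rw [lintegral_map hf hmeas]
    _ = ENNReal.ofReal (Real.exp (x ⬝ᵥ y)) * (ENNReal.ofReal |B.det⁻¹| * gaussMass d) := by
        rw [Real.map_matrix_volume_pi_eq_smul_volume_pi hdet, lintegral_smul_measure]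
        rfl
    _ = _ := by
        rw [← mul_assoc, ← ENNReal.ofReal_mul (Real.exp_pos _).le, abs_inv, div_eq_mul_inv]
        congr 4
        rw [hB, det_mul, det_transpose, Real.sqrt_mul_self_eq_abs]

end Gaussian

/-! ### Chernoff and self-normalized tail bounds. -/

section Concentration

variable {Ω : Type*} {mΩ : MeasurableSpace Ω}

/-- Chernoff's bound for a sum of conditionally sub-exponential increments. -/
theorem measure_le_sum_le_exp_neg {μ : Measure Ω} [IsProbabilityMeasure μ] {N : ℕ}
    {𝒢 : ℕ → MeasurableSpace Ω} (hle : ∀ t, 𝒢 t ≤ mΩ) (hmono : Monotone 𝒢) {y : ℕ → Ω → ℝ}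
    (hy : ∀ t < N, Measurable[𝒢 (t + 1)] (y t))
    (hstep : ∀ t < N, ∀ f : Ω → ℝ≥0∞, Measurable[𝒢 t] f →
      ∫⁻ ω, f ω * ENNReal.ofReal (Real.exp (y t ω)) ∂μ ≤ ∫⁻ ω, f ω ∂μ) (L : ℝ) :
    μ {ω | L ≤ ∑ t ∈ Finset.range N, y t ω} ≤ ENNReal.ofReal (Real.exp (-L)) := by
  have hsum : ∀ n ≤ N, Measurable[𝒢 n] fun ω => ∑ t ∈ Finset.range n, y t ω := by
    intro n hn
    refine @Finset.measurable_sum _ _ _ _ _ _ (𝒢 n) _ _ fun t ht => ?_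
    have ht' : t < n := Finset.mem_range.1 ht
    exact (hy t (ht'.trans_le hn)).mono (hmono ht') le_rfl
  have hexp : ∀ n ≤ N, Measurable[𝒢 n] fun ω =>
      ENNReal.ofReal (Real.exp (∑ t ∈ Finset.range n, y t ω)) := fun n hn =>
    (Real.measurable_exp.comp (hsum n hn)).ennreal_ofReal
  have hint : ∀ n ≤ N, ∫⁻ ω, ENNReal.ofReal (Real.exp (∑ t ∈ Finset.range n, y t ω)) ∂μ ≤ 1 := by
    intro n
    induction n with
    | zero => intro _; simp
    | succ n ih =>
      intro hn
      refine le_trans ?_ (ih (Nat.le_of_succ_le hn))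
      refine le_trans (le_of_eq ?_) (hstep n hn _ (hexp n (Nat.le_of_succ_le hn)))
      refine lintegral_congr fun ω => ?_
      rw [Finset.sum_range_succ, Real.exp_add, ENNReal.ofReal_mul (Real.exp_pos _).le]
  have hm := (hexp N le_rfl).mono (hle N) le_rfl
  have h1 := meas_ge_le_lintegral_div (μ := μ) hm.aemeasurable
    (ε := ENNReal.ofReal (Real.exp L)) (by simp [Real.exp_pos]) ENNReal.ofReal_ne_top
  have h2 : {ω | L ≤ ∑ t ∈ Finset.range N, y t ω} = {ω | ENNReal.ofReal (Real.exp L) ≤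
      ENNReal.ofReal (Real.exp (∑ t ∈ Finset.range N, y t ω))} := by
    ext ω
    simp [ENNReal.ofReal_le_ofReal_iff (Real.exp_pos _).le]
  rw [h2]
  refine h1.trans ?_
  rw [Real.exp_neg, ENNReal.ofReal_inv_of_pos (Real.exp_pos _), ← one_div]
  gcongr
  exact hint N le_rfl

/-- The exponential weight of the mixture at `v`. -/
def expWeight {d : ℕ} (x : Fin d → ℝ) (A : Matrix (Fin d) (Fin d) ℝ) (v : Fin d → ℝ) : ℝ≥0∞ :=
  ENNReal.ofReal (Real.exp (v ⬝ᵥ x - 1 / 4 * (v ⬝ᵥ (A *ᵥ v))))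

theorem expWeight_add {d : ℕ} (x y : Fin d → ℝ) (A B : Matrix (Fin d) (Fin d) ℝ)
    (v : Fin d → ℝ) : expWeight (x + y) (A + B) v = expWeight x A v * expWeight y B v := by
  rw [expWeight, expWeight, expWeight, ← ENNReal.ofReal_mul (Real.exp_pos _).le, ← Real.exp_add]
  congr 2
  simp only [add_mulVec, dotProduct_add]
  ring

theorem measurable_expWeight {d : ℕ} {x : Ω → Fin d → ℝ}
    {A : Ω → Matrix (Fin d) (Fin d) ℝ} (hx : Measurable x)
    (hA : ∀ i j, Measurable fun ω => A ω i j) :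
    Measurable fun p : Ω × (Fin d → ℝ) => expWeight (x p.1) (A p.1) p.2 := by
  have hx' : ∀ i, Measurable fun p : Ω × (Fin d → ℝ) => x p.1 i := fun i =>
    (measurable_pi_apply i).comp (hx.comp measurable_fst)
  have hA' : ∀ i j, Measurable fun p : Ω × (Fin d → ℝ) => A p.1 i j := fun i j =>
    (hA i j).comp measurable_fst
  have hv : ∀ i, Measurable fun p : Ω × (Fin d → ℝ) => p.2 i := fun i =>
    (measurable_pi_apply i).comp measurable_snd
  have h1 : Measurable fun p : Ω × (Fin d → ℝ) => p.2 ⬝ᵥ x p.1 := by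
    simp only [dotProduct]
    exact Finset.measurable_fun_sum _ fun i _ => (hv i).mul (hx' i)
  have h2 : Measurable fun p : Ω × (Fin d → ℝ) => p.2 ⬝ᵥ (A p.1 *ᵥ p.2) := by
    simp only [dotProduct, mulVec]
    exact Finset.measurable_fun_sum _ fun i _ => (hv i).mul
      (Finset.measurable_fun_sum _ fun j _ => (hA' i j).mul (hv j))
  exact (Real.measurable_exp.comp (h1.sub (h2.const_mul _))).ennreal_ofReal

theorem measurable_expWeight_apply {d : ℕ} {x : Ω → Fin d → ℝ}
    {A : Ω → Matrix (Fin d) (Fin d) ℝ} (hx : Measurable x)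
    (hA : ∀ i j, Measurable fun ω => A ω i j) (v : Fin d → ℝ) :
    Measurable fun ω => expWeight (x ω) (A ω) v := by
  have h := measurable_expWeight hx hA
  have h2 : Measurable fun ω : Ω => (ω, v) := measurable_prodMk_right
  have h3 := h.comp h2
  simpa only [Function.comp_def] using h3

theorem measurable_lintegral_expWeight {d : ℕ} {x : Ω → Fin d → ℝ}
    {A : Ω → Matrix (Fin d) (Fin d) ℝ} (hx : Measurable x)
    (hA : ∀ i j, Measurable fun ω => A ω i j) :
    Measurable fun ω => ∫⁻ v, expWeight (x ω) (A ω) v :=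
  (measurable_expWeight hx hA).lintegral_prod_right'

/-- The supermartingale step passes from each fixed `v` to the mixture by Tonelli; the weight
accumulated so far, restricted to `G`, serves as the `m`-measurable test function. -/
theorem setLIntegral_lintegral_expWeight_add_le {m mΩ : MeasurableSpace Ω} {μ : Measure Ω}
    [SFinite μ] {d : ℕ}
    (hm : m ≤ mΩ) {x ξ : Ω → Fin d → ℝ} {A Q : Ω → Matrix (Fin d) (Fin d) ℝ}
    (hx : Measurable[m] x) (hA : ∀ i j, Measurable[m] fun ω => A ω i j)
    (hξ : Measurable ξ) (hQ : ∀ i j, Measurable fun ω => Q ω i j)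
    (hstep : ∀ v : Fin d → ℝ, ∀ f : Ω → ℝ≥0∞, Measurable[m] f →
      ∫⁻ ω, f ω * expWeight (ξ ω) (Q ω) v ∂μ ≤ ∫⁻ ω, f ω ∂μ)
    {G : Set Ω} (hG : MeasurableSet[m] G) :
    ∫⁻ ω in G, (∫⁻ v, expWeight (x ω + ξ ω) (A ω + Q ω) v) ∂μ ≤
      ∫⁻ ω in G, (∫⁻ v, expWeight (x ω) (A ω) v) ∂μ := by
  have hx' : Measurable x := hx.mono hm le_rfl
  have hA' : ∀ i j, Measurable fun ω => A ω i j := fun i j => (hA i j).mono hm le_rfl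
  have hj := measurable_expWeight hx' hA'
  have hj' := measurable_expWeight (hx'.add hξ) (A := fun ω => A ω + Q ω)
    fun i j => (hA' i j).add (hQ i j)
  rw [lintegral_lintegral_swap (μ := μ.restrict G) (ν := volume)
      (f := fun ω v => expWeight (x ω) (A ω) v) hj.aemeasurable,
    lintegral_lintegral_swap (μ := μ.restrict G) (ν := volume)
      (f := fun ω v => expWeight (x ω + ξ ω) (A ω + Q ω) v) hj'.aemeasurable]
  refine lintegral_mono fun v => ?_
  have hG' := hm _ hG
  have h1 := hstep v (G.indicator fun ω => expWeight (x ω) (A ω) v)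
    ((@measurable_expWeight_apply _ m _ _ _ hx hA v).indicator hG)
  rw [lintegral_indicator hG'] at h1
  refine le_trans (le_of_eq ?_) h1
  rw [← lintegral_indicator hG']
  refine lintegral_congr fun ω => ?_
  by_cases hω : ω ∈ G
  · rw [Set.indicator_of_mem hω, Set.indicator_of_mem hω, expWeight_add]
  · rw [Set.indicator_of_notMem hω, Set.indicator_of_notMem hω, zero_mul]

theorem div_le_of_half_log_add_log_le {D b q δ : ℝ} (hD : 0 < D) (hb : 0 < b) (hδ : 0 < δ)
    (h : 1 / 2 * Real.log (D / b) + Real.log (1 / δ) ≤ q) :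
    1 / Real.sqrt b / δ ≤ Real.exp q / Real.sqrt D := by
  have h2 := Real.exp_le_exp.2 h
  have h3 : Real.exp (1 / 2 * Real.log (D / b) + Real.log (1 / δ)) =
      Real.sqrt D / Real.sqrt b / δ := by
    rw [Real.exp_add, Real.exp_log (by positivity), ← Real.sqrt_div hD.le,
      Real.sqrt_eq_rpow, Real.rpow_def_of_pos (by positivity)]
    ring_nf
  rw [h3] at h2
  rw [le_div_iff₀ (Real.sqrt_pos.2 hD)]
  calc 1 / Real.sqrt b / δ * Real.sqrt D = Real.sqrt D / Real.sqrt b / δ := by ring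
    _ ≤ _ := h2

/-- A self-normalized tail bound for vector-valued martingales, by the method of mixtures. -/
theorem measure_exists_selfNormalized_le {μ : Measure Ω} [IsProbabilityMeasure μ] {N d : ℕ}
    {𝒢 : ℕ → MeasurableSpace Ω} (hle : ∀ t, 𝒢 t ≤ mΩ) (hmono : Monotone 𝒢)
    {ξ : ℕ → Ω → Fin d → ℝ} {Q : ℕ → Ω → Matrix (Fin d) (Fin d) ℝ}
    (hξ : ∀ t < N, Measurable[𝒢 (t + 1)] (ξ t))
    (hQ : ∀ t < N, ∀ i j, Measurable[𝒢 (t + 1)] fun ω => Q t ω i j)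
    (hQpos : ∀ t ω, (Q t ω).PosSemidef)
    (hstep : ∀ t < N, ∀ v : Fin d → ℝ, ∀ f : Ω → ℝ≥0∞, Measurable[𝒢 t] f →
      ∫⁻ ω, f ω * expWeight (ξ t ω) (Q t ω) v ∂μ ≤ ∫⁻ ω, f ω ∂μ)
    {lam : ℝ} (hlam : 0 < lam) {δ : ℝ} (hδ : 0 < δ) {x : ℕ → Ω → Fin d → ℝ}
    {A : ℕ → Ω → Matrix (Fin d) (Fin d) ℝ}
    (hxdef : ∀ t ω, x t ω = ∑ i ∈ Finset.range t, ξ i ω)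
    (hAdef : ∀ t ω, A t ω = lam • (1 : Matrix (Fin d) (Fin d) ℝ) + ∑ i ∈ Finset.range t, Q i ω) :
    μ {ω | ∃ t ≤ N, 1 / 2 * Real.log ((A t ω).det / lam ^ d) + Real.log (1 / δ) ≤
        x t ω ⬝ᵥ ((A t ω)⁻¹ *ᵥ x t ω)} ≤ ENNReal.ofReal δ := by
  have hApos : ∀ t ω, (A t ω).PosDef := fun t ω => by
    rw [hAdef]
    exact (PosDef.one.smul hlam).add_posSemidef (posSemidef_sum _ fun i _ => hQpos i ω)
  have hxm : ∀ t ≤ N, Measurable[𝒢 t] (x t) := by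
    intro t ht
    have : x t = fun ω => ∑ i ∈ Finset.range t, ξ i ω := funext (hxdef t)
    rw [this]
    refine @Finset.measurable_sum _ _ _ _ _ _ (𝒢 t) _ _ fun i hi => ?_
    have hi' : i < t := Finset.mem_range.1 hi
    exact (hξ i (hi'.trans_le ht)).mono (hmono hi') le_rfl
  have hAm : ∀ t ≤ N, ∀ i j, Measurable[𝒢 t] fun ω => A t ω i j := by
    intro t ht i j
    simp only [hAdef, Matrix.add_apply, Matrix.sum_apply]
    refine Measurable.const_add ?_ _
    refine @Finset.measurable_sum _ _ _ _ _ _ (𝒢 t) _ _ fun l hl => ?_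
    have hl' : l < t := Finset.mem_range.1 hl
    exact (hQ l (hl'.trans_le ht) i j).mono (hmono hl') le_rfl
  have hWstep : ∀ t < N, ∀ G, MeasurableSet[𝒢 t] G →
      ∫⁻ ω in G, (∫⁻ v, expWeight (x (t + 1) ω) (A (t + 1) ω) v) ∂μ ≤
        ∫⁻ ω in G, (∫⁻ v, expWeight (x t ω) (A t ω) v) ∂μ := by
    intro t ht G hG
    have e1 : ∀ ω, x (t + 1) ω = x t ω + ξ t ω := fun ω => by
      rw [hxdef, hxdef, Finset.sum_range_succ]
    have e2 : ∀ ω, A (t + 1) ω = A t ω + Q t ω := fun ω => by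
      rw [hAdef, hAdef, Finset.sum_range_succ, add_assoc]
    simp_rw [e1, e2]
    exact setLIntegral_lintegral_expWeight_add_le (hle t) (hxm t ht.le) (hAm t ht.le)
      ((hξ t ht).mono (hle _) le_rfl) (fun i j => (hQ t ht i j).mono (hle _) le_rfl)
      (hstep t ht) hG
  have hWeq : ∀ t ω, ∫⁻ v, expWeight (x t ω) (A t ω) v =
      ENNReal.ofReal (Real.exp (x t ω ⬝ᵥ ((A t ω)⁻¹ *ᵥ x t ω)) /
      Real.sqrt (A t ω).det) * gaussMass d := fun t ω =>
    lintegral_exp_dotProduct_sub_quadratic (hApos t ω) (x t ω)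
  have hW0 : ∀ ω, ∫⁻ v, expWeight (x 0 ω) (A 0 ω) v =
      ENNReal.ofReal (1 / Real.sqrt (lam ^ d)) * gaussMass d := by
    intro ω
    rw [hWeq]
    simp [hxdef, hAdef]
  have hbpos : 0 < Real.sqrt (lam ^ d) := Real.sqrt_pos.2 (pow_pos hlam d)
  have hville := measure_exists_le_le_of_setLIntegral_le (μ := μ) hle hmono
    (W := fun t ω => ∫⁻ v, expWeight (x t ω) (A t ω) v)
    (fun t ht => @measurable_lintegral_expWeight _ (𝒢 t) _ _ _ (hxm t ht) (hAm t ht)) hWstep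
    (ENNReal.ofReal (1 / Real.sqrt (lam ^ d) / δ) * gaussMass d)
  simp_rw [hW0, hWeq] at hville
  rw [lintegral_const, measure_univ, mul_one] at hville
  refine (measure_mono (t := {ω | ∃ t ≤ N,
    ENNReal.ofReal (1 / Real.sqrt (lam ^ d) / δ) * gaussMass d ≤
      ENNReal.ofReal (Real.exp (x t ω ⬝ᵥ ((A t ω)⁻¹ *ᵥ x t ω)) /
      Real.sqrt (A t ω).det) * gaussMass d}) ?_).trans ?_
  · rintro ω ⟨t, ht, h⟩
    exact ⟨t, ht, mul_le_mul_left (ENNReal.ofReal_le_ofReal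
      (div_le_of_half_log_add_log_le (hApos t ω).det_pos (pow_pos hlam d) hδ h)) _⟩
  · generalize {ω | ∃ t ≤ N, ENNReal.ofReal (1 / Real.sqrt (lam ^ d) / δ) * gaussMass d ≤
      ENNReal.ofReal (Real.exp (x t ω ⬝ᵥ ((A t ω)⁻¹ *ᵥ x t ω)) /
      Real.sqrt (A t ω).det) * gaussMass d} = E at hville ⊢
    generalize Real.sqrt (lam ^ d) = b at hville hbpos
    -- The initial mass of the mixture is positive and finite, so it can be cancelled from Ville's
    -- inequality.
    have hne : ENNReal.ofReal (1 / b) * gaussMass d ≠ 0 :=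
      mul_ne_zero (by simpa using hbpos) gaussMass_ne_zero
    have hnt : ENNReal.ofReal (1 / b) * gaussMass d ≠ ∞ :=
      ENNReal.mul_ne_top ENNReal.ofReal_ne_top gaussMass_ne_top
    have h5 : ENNReal.ofReal (1 / b) * gaussMass d * ((ENNReal.ofReal δ)⁻¹ * μ E) ≤
        ENNReal.ofReal (1 / b) * gaussMass d * 1 := by
      rw [mul_one]
      refine le_trans (le_of_eq ?_) hville
      rw [div_eq_mul_inv (1 / b), ENNReal.ofReal_mul (by positivity),
        ENNReal.ofReal_inv_of_pos hδ]
      ring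
    have h6 := (ENNReal.mul_le_mul_iff_right hne hnt).1 h5
    rwa [mul_comm, ← div_eq_mul_inv, ENNReal.div_le_iff (by simpa using hδ)
      ENNReal.ofReal_ne_top, one_mul] at h6

end Concentration

/-! ### One-variable calculus and the softmax variance. -/

theorem hasDerivAt_nonpos_of_forall_le {f : ℝ → ℝ} {f' : ℝ} (h : HasDerivAt f f' 0)
    (hle : ∀ t ∈ Set.Icc (0 : ℝ) 1, f t ≤ f 0) : f' ≤ 0 := by
  have h1 := h.hasDerivWithinAt (s := Set.Ioi 0)
  rw [hasDerivWithinAt_iff_tendsto_slope' (by simp)] at h1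
  refine le_of_tendsto h1 ?_
  filter_upwards [Ioo_mem_nhdsGT (zero_lt_one (α := ℝ))] with t ht
  rw [slope_def_field, sub_zero]
  exact div_nonpos_of_nonpos_of_nonneg (by linarith [hle t (Set.Ioo_subset_Icc_self ht)]) ht.1.le

section Softmax

variable {ι : Type*} (R : Finset ι) (a b : ι → ℝ)

theorem hasDerivAt_sum_exp (t : ℝ) (c : ι → ℝ) :
    HasDerivAt (fun t => ∑ i ∈ R, c i * Real.exp (a i + t * b i))
      (∑ i ∈ R, c i * b i * Real.exp (a i + t * b i)) t := by
  refine HasDerivAt.fun_sum fun i _ => ?_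
  have h1 : HasDerivAt (fun t => a i + t * b i) (b i) t := by
    simpa using ((hasDerivAt_id t).mul_const (b i)).const_add (a i)
  convert! (h1.exp.const_mul (c i)) using 1
  ring

theorem hasDerivAt_log_sum_exp (hR : R.Nonempty) (t : ℝ) :
    HasDerivAt (fun t => Real.log (∑ i ∈ R, Real.exp (a i + t * b i)))
      (∑ i ∈ R, Real.exp (a i + t * b i) / (∑ j ∈ R, Real.exp (a j + t * b j)) * b i) t := by
  have hpos : 0 < ∑ j ∈ R, Real.exp (a j + t * b j) :=
    Finset.sum_pos (fun _ _ => Real.exp_pos _) hR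
  have h := hasDerivAt_sum_exp R a b t (fun _ => 1)
  simp only [one_mul] at h
  convert! h.log hpos.ne' using 1
  rw [Finset.sum_div]
  exact Finset.sum_congr rfl fun i _ => by ring

theorem hasDerivAt_softmax_mean (hR : R.Nonempty) (t : ℝ) :
    HasDerivAt
      (fun t => ∑ i ∈ R, Real.exp (a i + t * b i) / (∑ j ∈ R, Real.exp (a j + t * b j)) * b i)
      (∑ i ∈ R, Real.exp (a i + t * b i) / (∑ j ∈ R, Real.exp (a j + t * b j)) * b i ^ 2 -
        (∑ i ∈ R, Real.exp (a i + t * b i) / (∑ j ∈ R, Real.exp (a j + t * b j)) * b i) ^ 2)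
      t := by
  have hpos : 0 < ∑ j ∈ R, Real.exp (a j + t * b j) :=
    Finset.sum_pos (fun _ _ => Real.exp_pos _) hR
  have h1 := hasDerivAt_sum_exp R a b t (fun _ => 1)
  have h2 := hasDerivAt_sum_exp R a b t b
  simp only [one_mul] at h1
  have e : ∀ t (c : ι → ℝ),
      ∑ i ∈ R, Real.exp (a i + t * b i) / (∑ j ∈ R, Real.exp (a j + t * b j)) * c i =
      (∑ i ∈ R, c i * Real.exp (a i + t * b i)) / (∑ j ∈ R, Real.exp (a j + t * b j)) := by
    intro t c
    rw [Finset.sum_div]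
    exact Finset.sum_congr rfl fun i _ => by ring
  simp_rw [e]
  have e2 : ∑ i ∈ R, b i ^ 2 * Real.exp (a i + t * b i) =
      ∑ i ∈ R, b i * b i * Real.exp (a i + t * b i) :=
    Finset.sum_congr rfl fun i _ => by rw [sq]
  rw [e2]
  convert! h2.div h1 hpos.ne' using 1
  generalize ∑ i ∈ R, b i * b i * Real.exp (a i + t * b i) = X
  generalize ∑ i ∈ R, b i * Real.exp (a i + t * b i) = Y
  generalize ∑ i ∈ R, Real.exp (a i + t * b i) = Z at hpos
  have := hpos.ne'
  field_simp

/-- The index `o` with `b o = 0` does not contribute to either moment, so Cauchy–Schwarz on the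
others bounds the squared mean by `(1 - w o)` times the second moment. What remains of the variance
is `∑ w o * w i * b i ^ 2`, and each product is at least `κ`. -/
theorem mul_sum_sq_le_variance {w : ι → ℝ} {κ : ℝ} (hw : ∀ i ∈ R, 0 ≤ w i)
    (hsum : ∑ i ∈ R, w i = 1) (hκ : ∀ i ∈ R, ∀ j ∈ R, κ ≤ w i * w j)
    (hb : ∃ i ∈ R, b i = 0) :
    κ * ∑ i ∈ R, b i ^ 2 ≤ ∑ i ∈ R, w i * b i ^ 2 - (∑ i ∈ R, w i * b i) ^ 2 := by
  classical
  obtain ⟨o, ho, hbo⟩ := hb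
  have h1 : ∑ i ∈ R, w i * b i = ∑ i ∈ R.erase o, w i * b i := by
    rw [← Finset.add_sum_erase R _ ho, hbo]; simp
  have h2 : ∑ i ∈ R, w i * b i ^ 2 = ∑ i ∈ R.erase o, w i * b i ^ 2 := by
    rw [← Finset.add_sum_erase R _ ho, hbo]; simp
  have h3 : ∑ i ∈ R.erase o, w i = 1 - w o := by
    rw [← hsum, ← Finset.add_sum_erase R _ ho]; ring
  have hw' : ∀ i ∈ R.erase o, 0 ≤ w i := fun i hi => hw i (Finset.mem_of_mem_erase hi)
  have h4 : (∑ i ∈ R.erase o, w i * b i) ^ 2 ≤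
      (∑ i ∈ R.erase o, w i) * ∑ i ∈ R.erase o, w i * b i ^ 2 :=
    Finset.sum_sq_le_sum_mul_sum_of_sq_le_mul _ hw'
      (fun i hi => mul_nonneg (hw' i hi) (sq_nonneg _)) fun i _ => le_of_eq (by ring)
  have h5 : κ * ∑ i ∈ R, b i ^ 2 ≤ w o * ∑ i ∈ R, w i * b i ^ 2 := by
    rw [Finset.mul_sum, Finset.mul_sum]
    refine Finset.sum_le_sum fun i hi => ?_
    rw [← mul_assoc]
    exact mul_le_mul_of_nonneg_right (hκ o ho i hi) (sq_nonneg _)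
  rw [h1]
  rw [h3, ← h2] at h4
  linarith

end Softmax

/-! ### The multinomial logistic model and its likelihood. -/

section Model

variable {S A : Type*} {d : ℕ} (M : MDP S A) (φ : S → A → S → Vec d)

theorem reach_nonempty (s : S) (a : A) : (M.reach s a).Nonempty := by
  obtain ⟨s', hs'⟩ := (M.P s a).support_nonempty
  exact ⟨s', (M.mem_reach s a s').2 ((PMF.mem_support_iff _ _).1 hs')⟩

theorem sum_exp_pos (θ : Vec d) (s : S) (a : A) :
    0 < ∑ s'' ∈ M.reach s a, Real.exp (inner ℝ (φ s a s'') θ) :=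
  Finset.sum_pos (fun _ _ => Real.exp_pos _) (reach_nonempty M s a)

theorem mnlProb_pos (θ : Vec d) (s : S) (a : A) (s' : S) : 0 < mnlProb M φ θ s a s' :=
  div_pos (Real.exp_pos _) (sum_exp_pos M φ θ s a)

theorem sum_mnlProb (θ : Vec d) (s : S) (a : A) :
    ∑ s' ∈ M.reach s a, mnlProb M φ θ s a s' = 1 := by
  simp only [mnlProb]
  rw [← Finset.sum_div, div_self (sum_exp_pos M φ θ s a).ne']

theorem mnlMean_nonneg (θ : Vec d) {V : S → ℝ} (hV : ∀ s, 0 ≤ V s) (s : S) (a : A) :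
    0 ≤ mnlMean M φ θ V s a :=
  Finset.sum_nonneg fun s' _ => mul_nonneg (mnlProb_pos M φ θ s a s').le (hV s')

theorem mnlMean_le (θ : Vec d) {V : S → ℝ} {b : ℝ} (hV : ∀ s, V s ≤ b) (s : S) (a : A) :
    mnlMean M φ θ V s a ≤ b := by
  calc mnlMean M φ θ V s a ≤ ∑ s' ∈ M.reach s a, mnlProb M φ θ s a s' * b :=
        Finset.sum_le_sum fun s' _ =>
          mul_le_mul_of_nonneg_left (hV s') (mnlProb_pos M φ θ s a s').le
    _ = b := by rw [← Finset.sum_mul, sum_mnlProb, one_mul]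

/-- Numerator and normalizer each change by a factor at most `exp c`, so `p₂ ≥ exp (-2c) p₁ ≥ (1 -
2c) p₁`. Averaging the nonnegative `V` loses at most `2c` times its mean, whether or not `c` is
small. -/
theorem mnlMean_sub_le {θ₁ θ₂ : Vec d} {V : S → ℝ} {b c : ℝ} (hV0 : ∀ s, 0 ≤ V s)
    (hV : ∀ s, V s ≤ b) {s : S} {a : A} (hc : 0 ≤ c)
    (h : ∀ s' ∈ M.reach s a, |inner ℝ (φ s a s') (θ₁ - θ₂)| ≤ c) :
    mnlMean M φ θ₁ V s a ≤ mnlMean M φ θ₂ V s a + 2 * c * b := by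
  have hd : ∀ s' ∈ M.reach s a, |inner ℝ (φ s a s') θ₁ - inner ℝ (φ s a s') θ₂| ≤ c := by
    intro s' hs'
    rw [← inner_sub_right]
    exact h s' hs'
  have hZ : ∑ s'' ∈ M.reach s a, Real.exp (inner ℝ (φ s a s'') θ₂) ≤
      Real.exp c * ∑ s'' ∈ M.reach s a, Real.exp (inner ℝ (φ s a s'') θ₁) := by
    rw [Finset.mul_sum]
    refine Finset.sum_le_sum fun s' hs' => ?_
    rw [← Real.exp_add]
    exact Real.exp_le_exp.2 (by linarith [(abs_le.1 (hd s' hs')).1])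
  have hp : ∀ s' ∈ M.reach s a,
      (1 - 2 * c) * mnlProb M φ θ₁ s a s' ≤ mnlProb M φ θ₂ s a s' := by
    intro s' hs'
    have h1 : Real.exp (-(2 * c)) * mnlProb M φ θ₁ s a s' ≤ mnlProb M φ θ₂ s a s' := by
      simp only [mnlProb]
      rw [← mul_div_assoc, div_le_div_iff₀ (sum_exp_pos M φ θ₁ s a) (sum_exp_pos M φ θ₂ s a)]
      have h2 : Real.exp (-(2 * c)) * Real.exp (inner ℝ (φ s a s') θ₁) ≤
          Real.exp (-c) * Real.exp (inner ℝ (φ s a s') θ₂) := by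
        rw [← Real.exp_add, ← Real.exp_add]
        exact Real.exp_le_exp.2 (by linarith [(abs_le.1 (hd s' hs')).2])
      calc _ ≤ Real.exp (-c) * Real.exp (inner ℝ (φ s a s') θ₂) * (Real.exp c *
            ∑ s'' ∈ M.reach s a, Real.exp (inner ℝ (φ s a s'') θ₁)) :=
            mul_le_mul h2 hZ (sum_exp_pos M φ θ₂ s a).le (by positivity)
        _ = (Real.exp (-c) * Real.exp c) * (Real.exp (inner ℝ (φ s a s') θ₂) *
            ∑ s'' ∈ M.reach s a, Real.exp (inner ℝ (φ s a s'') θ₁)) := by ring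
        _ = _ := by rw [← Real.exp_add, neg_add_cancel, Real.exp_zero, one_mul]
    refine le_trans (mul_le_mul_of_nonneg_right ?_ (mnlProb_pos M φ θ₁ s a s').le) h1
    linarith [Real.add_one_le_exp (-(2 * c))]
  have h1 : mnlMean M φ θ₁ V s a ≤ mnlMean M φ θ₂ V s a + 2 * c * mnlMean M φ θ₁ V s a := by
    simp only [mnlMean]
    rw [Finset.mul_sum, ← Finset.sum_add_distrib]
    refine Finset.sum_le_sum fun s' hs' => ?_
    nlinarith [hp s' hs', hV0 s']
  have := mnlMean_le M φ θ₁ hV s a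
  nlinarith

/-- The mean of the score direction `⟪φ, D⟫` under the model with parameter `θ`. -/
def featMean (θ D : Vec d) (s : S) (a : A) : ℝ :=
  ∑ s' ∈ M.reach s a, mnlProb M φ θ s a s' * inner ℝ (φ s a s') D

theorem mnlProb_segment (θ D : Vec d) (t : ℝ) (s : S) (a : A) (s' : S) :
    mnlProb M φ (θ + t • D) s a s' =
      Real.exp (inner ℝ (φ s a s') θ + t * inner ℝ (φ s a s') D) /
        ∑ s'' ∈ M.reach s a, Real.exp (inner ℝ (φ s a s'') θ + t * inner ℝ (φ s a s'') D) := by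
  simp only [mnlProb, inner_add_right, inner_smul_right]

open Classical in
theorem hasDerivAt_sum_log_mnlProb (θ D : Vec d) (t : ℝ) (s : S) (a : A) {y : S}
    (hy : y ∈ M.reach s a) :
    HasDerivAt (fun t => ∑ s' ∈ M.reach s a,
        (if y = s' then 1 else 0) * Real.log (mnlProb M φ (θ + t • D) s a s'))
      (inner ℝ (φ s a y) D - featMean M φ (θ + t • D) D s a) t := by
  have e : ∀ t, ∑ s' ∈ M.reach s a,
      (if y = s' then 1 else 0) * Real.log (mnlProb M φ (θ + t • D) s a s') =
      (inner ℝ (φ s a y) θ + t * inner ℝ (φ s a y) D) - Real.log (∑ s'' ∈ M.reach s a,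
        Real.exp (inner ℝ (φ s a s'') θ + t * inner ℝ (φ s a s'') D)) := by
    intro t
    rw [Finset.sum_eq_single y]
    · have hpos := Finset.sum_pos (fun s'' _ => Real.exp_pos
        (inner ℝ (φ s a s'') θ + t * inner ℝ (φ s a s'') D)) (reach_nonempty M s a)
      rw [if_pos rfl, one_mul, mnlProb_segment, Real.log_div (Real.exp_pos _).ne' hpos.ne',
        Real.log_exp]
    · intro s' _ hne
      rw [if_neg hne.symm, zero_mul]
    · exact fun h => absurd hy h
  simp_rw [e]
  have h1 : HasDerivAt (fun t => inner ℝ (φ s a y) θ + t * inner ℝ (φ s a y) D)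
      (inner ℝ (φ s a y) D) t := by
    simpa using ((hasDerivAt_id t).mul_const (inner ℝ (φ s a y) D)).const_add
      (inner ℝ (φ s a y) θ)
  have h2 := hasDerivAt_log_sum_exp (M.reach s a) (fun s' => inner ℝ (φ s a s') θ)
    (fun s' => inner ℝ (φ s a s') D) (reach_nonempty M s a) t
  convert! h1.sub h2 using 2
  simp only [featMean, mnlProb_segment]

/-- Strong monotonicity of the score along a segment on which the products of the model
probabilities are bounded below. -/
theorem featMean_add_le {θ D : Vec d} {κ : ℝ} {s : S} {a : A}
    (h0 : ∃ s' ∈ M.reach s a, φ s a s' = 0)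
    (hκ : ∀ t ∈ Set.Icc (0 : ℝ) 1, ∀ s' ∈ M.reach s a, ∀ s'' ∈ M.reach s a,
      κ ≤ mnlProb M φ (θ + t • D) s a s' * mnlProb M φ (θ + t • D) s a s'') :
    featMean M φ θ D s a + κ * ∑ s' ∈ M.reach s a, (inner ℝ (φ s a s') D) ^ 2 ≤
      featMean M φ (θ + D) D s a := by
  -- The derivative is the variance of `⟪φ, D⟫` under the model; its lower bound is integrated by
  -- the mean value theorem.
  have hder : ∀ t : ℝ, HasDerivAt (fun t => featMean M φ (θ + t • D) D s a)
      (∑ s' ∈ M.reach s a, mnlProb M φ (θ + t • D) s a s' * inner ℝ (φ s a s') D ^ 2 -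
        (∑ s' ∈ M.reach s a, mnlProb M φ (θ + t • D) s a s' * inner ℝ (φ s a s') D) ^ 2) t := by
    intro t
    have := hasDerivAt_softmax_mean (M.reach s a) (fun s' => inner ℝ (φ s a s') θ)
      (fun s' => inner ℝ (φ s a s') D) (reach_nonempty M s a) t
    simp only [featMean, mnlProb_segment]
    exact this
  have hb : ∀ t ∈ Set.Icc (0 : ℝ) 1, κ * ∑ s' ∈ M.reach s a, (inner ℝ (φ s a s') D) ^ 2 ≤
      ∑ s' ∈ M.reach s a, mnlProb M φ (θ + t • D) s a s' * inner ℝ (φ s a s') D ^ 2 -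
        (∑ s' ∈ M.reach s a, mnlProb M φ (θ + t • D) s a s' * inner ℝ (φ s a s') D) ^ 2 := by
    intro t ht
    refine mul_sum_sq_le_variance _ _ (fun s' _ => (mnlProb_pos M φ _ s a s').le)
      (sum_mnlProb M φ _ s a) (hκ t ht) ?_
    obtain ⟨s', hs', h⟩ := h0
    exact ⟨s', hs', by rw [h, inner_zero_left]⟩
  obtain ⟨t, ht, heq⟩ := exists_hasDerivAt_eq_slope (fun t => featMean M φ (θ + t • D) D s a) _
    zero_lt_one (fun t _ => (hder t).continuousAt.continuousWithinAt) fun t _ => hder t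
  have := hb t (Set.Ioo_subset_Icc_self ht)
  rw [heq] at this
  simp only [one_smul, zero_smul, add_zero, sub_zero, div_one] at this
  linarith

/-- The basic inequality for the ridge-penalized maximum likelihood estimate. -/
theorem IsRidgeMLE.basic_inequality {Θ : Set (Vec d)} (hΘ : Convex ℝ Θ) {H : ℕ} {lam : ℝ}
    {x : ℕ → ℕ → S} {u : ℕ → ℕ → A} {k : ℕ} {θ' θ : Vec d} {κ : ℝ}
    (hmle : IsRidgeMLE M φ Θ H lam x u k θ') (hθ : θ ∈ Θ)
    (h0 : ∀ s a, ∃ s' ∈ M.reach s a, φ s a s' = 0)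
    (hκ : ∀ s a, ∀ s' ∈ M.reach s a, ∀ s'' ∈ M.reach s a, ∀ θ ∈ Θ,
      κ ≤ mnlProb M φ θ s a s' * mnlProb M φ θ s a s'')
    (hx : ∀ i < k, ∀ h < H, x i (h + 1) ∈ M.reach (x i h) (u i h)) :
    κ * (∑ i ∈ Finset.range k, ∑ h ∈ Finset.range H, ∑ s' ∈ M.reach (x i h) (u i h),
        inner ℝ (φ (x i h) (u i h) s') (θ - θ') ^ 2) + lam * ‖θ - θ'‖ ^ 2 ≤
      lam * inner ℝ θ (θ - θ') - ∑ i ∈ Finset.range k, ∑ h ∈ Finset.range H,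
        (inner ℝ (φ (x i h) (u i h) (x i (h + 1))) (θ - θ') -
          featMean M φ θ (θ - θ') (x i h) (u i h)) := by
  set D := θ - θ' with hD
  have hθD : θ' + D = θ := by rw [hD]; abel
  have hseg : ∀ t ∈ Set.Icc (0 : ℝ) 1, θ' + t • D ∈ Θ := by
    intro t ht
    exact hΘ.add_smul_sub_mem hmle.1 hθ ht
  have hder : HasDerivAt (fun t : ℝ => logLik M φ H x u k (θ' + t • D)
        - lam / 2 * ‖θ' + t • D‖ ^ 2)
      (∑ i ∈ Finset.range k, ∑ h ∈ Finset.range H,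
        (inner ℝ (φ (x i h) (u i h) (x i (h + 1))) D -
          featMean M φ (θ' + (0 : ℝ) • D) D (x i h) (u i h))
        - lam / 2 * (2 * inner ℝ (θ' + (0 : ℝ) • D) D)) 0 := by
    refine HasDerivAt.sub ?_ (HasDerivAt.const_mul _ ?_)
    · refine HasDerivAt.fun_sum fun i hi => HasDerivAt.fun_sum fun h hh => ?_
      exact hasDerivAt_sum_log_mnlProb M φ θ' D 0 _ _
        (hx i (Finset.mem_range.1 hi) h (Finset.mem_range.1 hh))
    · have h1 : HasDerivAt (fun t : ℝ => θ' + t • D) D 0 := by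
        simpa using ((hasDerivAt_id (0 : ℝ)).smul_const D).const_add θ'
      exact h1.norm_sq
  have hle : (∑ i ∈ Finset.range k, ∑ h ∈ Finset.range H,
        (inner ℝ (φ (x i h) (u i h) (x i (h + 1))) D -
          featMean M φ (θ' + (0 : ℝ) • D) D (x i h) (u i h))
        - lam / 2 * (2 * inner ℝ (θ' + (0 : ℝ) • D) D)) ≤ 0 := by
    refine hasDerivAt_nonpos_of_forall_le hder fun t ht => ?_
    simp only [zero_smul, add_zero]
    exact hmle.2 _ (hseg t ht)
  have hmono : ∀ i h, featMean M φ θ' D (x i h) (u i h) + κ * ∑ s' ∈ M.reach (x i h) (u i h),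
      (inner ℝ (φ (x i h) (u i h) s') D) ^ 2 ≤ featMean M φ θ D (x i h) (u i h) := by
    intro i h
    have := featMean_add_le M φ (θ := θ') (D := D) (κ := κ) (h0 (x i h) (u i h))
      fun t ht s' hs' s'' hs'' => hκ _ _ s' hs' s'' hs'' _ (hseg t ht)
    rwa [hθD] at this
  have hsum := Finset.sum_le_sum fun i (_ : i ∈ Finset.range k) =>
    Finset.sum_le_sum fun h (_ : h ∈ Finset.range H) => hmono i h
  simp only [Finset.sum_add_distrib, ← Finset.mul_sum] at hsum
  simp only [zero_smul, add_zero, Finset.sum_sub_distrib] at hle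
  simp only [Finset.sum_sub_distrib]
  have hin : inner ℝ θ D = inner ℝ θ' D + ‖D‖ ^ 2 := by
    rw [← real_inner_self_eq_norm_sq, ← inner_add_left, hθD]
  rw [hin]
  nlinarith

end Model

/-! ### Weighted norms, the Gram matrix, feature widths and the estimation error. -/

section Gram

variable {d : ℕ}

theorem inner_eq_dotProduct (x y : Vec d) : inner ℝ x y = x.ofLp ⬝ᵥ y.ofLp := by
  rw [EuclideanSpace.inner_eq_star_dotProduct, dotProduct_comm]
  simp

theorem weightedNorm_nonneg (B : Matrix (Fin d) (Fin d) ℝ) (x : Vec d) : 0 ≤ weightedNorm B x :=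
  Real.sqrt_nonneg _

theorem weightedNorm_sq {B : Matrix (Fin d) (Fin d) ℝ} (hB : B.PosSemidef) (x : Vec d) :
    weightedNorm B x ^ 2 = x.ofLp ⬝ᵥ (B *ᵥ x.ofLp) :=
  Real.sq_sqrt (posSemidef_dotProduct_nonneg hB _)

theorem weightedNorm_neg (B : Matrix (Fin d) (Fin d) ℝ) (x : Vec d) :
    weightedNorm B (-x) = weightedNorm B x := by
  simp [weightedNorm, mulVec_neg]

theorem abs_inner_le_weightedNorm {B : Matrix (Fin d) (Fin d) ℝ} (hB : B.PosDef) (x y : Vec d) :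
    |inner ℝ x y| ≤ weightedNorm B⁻¹ x * weightedNorm B y := by
  have h := sq_dotProduct_le_inv_mul hB x.ofLp y.ofLp
  rw [← weightedNorm_sq hB.inv.posSemidef, ← weightedNorm_sq hB.posSemidef, ← mul_pow,
    ← inner_eq_dotProduct] at h
  exact abs_le_of_sq_le_sq h (mul_nonneg (weightedNorm_nonneg _ _) (weightedNorm_nonneg _ _))

theorem weightedNorm_sub_le {B : Matrix (Fin d) (Fin d) ℝ} (hB : B.PosDef) (x y z : Vec d) :
    weightedNorm B (x - z) ≤ weightedNorm B (x - y) + weightedNorm B (z - y) := by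
  have hp := hB.posSemidef
  set u := x - y
  set v := z - y
  have e : x - z = u - v := by simp only [u, v]; abel
  rw [e]
  refine abs_le_of_sq_le_sq' ?_ (add_nonneg (weightedNorm_nonneg _ _) (weightedNorm_nonneg _ _)) |>.2
  have h1 : (v.ofLp ⬝ᵥ (B *ᵥ u.ofLp)) ^ 2 ≤ (weightedNorm B u * weightedNorm B v) ^ 2 := by
    have h2 := sq_dotProduct_le_inv_mul hB (B *ᵥ u.ofLp) v.ofLp
    have e2 : B⁻¹ *ᵥ (B *ᵥ u.ofLp) = u.ofLp := by
      rw [mulVec_mulVec, nonsing_inv_mul _ ((isUnit_iff_isUnit_det _).1 hB.isUnit), one_mulVec]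
    rw [e2, dotProduct_comm _ v.ofLp, dotProduct_comm _ u.ofLp] at h2
    rwa [mul_pow, weightedNorm_sq hp, weightedNorm_sq hp]
  have h3 := abs_le_of_sq_le_sq h1 (mul_nonneg (weightedNorm_nonneg _ _) (weightedNorm_nonneg _ _))
  have h4 : weightedNorm B (u - v) ^ 2 = weightedNorm B u ^ 2 + weightedNorm B v ^ 2 -
      2 * (v.ofLp ⬝ᵥ (B *ᵥ u.ofLp)) := by
    rw [weightedNorm_sq hp, weightedNorm_sq hp, weightedNorm_sq hp, WithLp.ofLp_sub, mulVec_sub,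
      sub_dotProduct, dotProduct_sub, dotProduct_sub,
      dotProduct_mulVec_comm_of_isHermitian hB.isHermitian u.ofLp v.ofLp]
    ring
  rw [h4]
  nlinarith [(abs_le.1 h3).1]

variable {S A : Type*} (M : MDP S A) (φ : S → A → S → Vec d)

/-- The second-moment matrix of the features of `(s, a)`. -/
def featMatrix (s : S) (a : A) : Matrix (Fin d) (Fin d) ℝ :=
  ∑ s' ∈ M.reach s a, vecMulVec (φ s a s').ofLp (φ s a s').ofLp

theorem featMatrix_posSemidef (s : S) (a : A) : (featMatrix M φ s a).PosSemidef :=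
  posSemidef_sum _ fun s' _ => by
    simpa using posSemidef_vecMulVec_self_star (φ s a s').ofLp

theorem dotProduct_featMatrix_mulVec (s : S) (a : A) (v : Fin d → ℝ) :
    v ⬝ᵥ (featMatrix M φ s a *ᵥ v) = ∑ s' ∈ M.reach s a, (v ⬝ᵥ (φ s a s').ofLp) ^ 2 := by
  rw [featMatrix, sum_mulVec, dotProduct_sum]
  refine Finset.sum_congr rfl fun s' _ => ?_
  rw [vecMulVec_mulVec, dotProduct_comm v, sq]
  simp [dotProduct_comm]

theorem gram_eq (H : ℕ) (lam : ℝ) (x : ℕ → ℕ → S) (u : ℕ → ℕ → A) (k : ℕ) :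
    gram M φ H lam x u k = lam • (1 : Matrix (Fin d) (Fin d) ℝ) +
      ∑ k' ∈ Finset.range k, ∑ h ∈ Finset.range H, featMatrix M φ (x k' h) (u k' h) := rfl

theorem sum_featMatrix_posSemidef (H : ℕ) (x : ℕ → ℕ → S) (u : ℕ → ℕ → A) (k : ℕ) :
    (∑ k' ∈ Finset.range k, ∑ h ∈ Finset.range H,
      featMatrix M φ (x k' h) (u k' h)).PosSemidef :=
  posSemidef_sum _ fun _ _ => posSemidef_sum _ fun _ _ => featMatrix_posSemidef M φ _ _

theorem gram_posDef (H : ℕ) {lam : ℝ} (hlam : 0 < lam) (x : ℕ → ℕ → S) (u : ℕ → ℕ → A) (k : ℕ) :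
    (gram M φ H lam x u k).PosDef := by
  rw [gram_eq]
  exact (PosDef.one.smul hlam).add_posSemidef (sum_featMatrix_posSemidef M φ H x u k)

theorem dotProduct_gram_mulVec (H : ℕ) (lam : ℝ) (x : ℕ → ℕ → S) (u : ℕ → ℕ → A) (k : ℕ)
    (D : Vec d) :
    D.ofLp ⬝ᵥ (gram M φ H lam x u k *ᵥ D.ofLp) = lam * ‖D‖ ^ 2 +
      ∑ k' ∈ Finset.range k, ∑ h ∈ Finset.range H, ∑ s' ∈ M.reach (x k' h) (u k' h),
        inner ℝ (φ (x k' h) (u k' h) s') D ^ 2 := by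
  rw [gram_eq, add_mulVec, dotProduct_add, smul_mulVec, one_mulVec, dotProduct_smul,
    ← inner_eq_dotProduct, real_inner_self_eq_norm_sq, smul_eq_mul, sum_mulVec, dotProduct_sum]
  congr 1
  refine Finset.sum_congr rfl fun k' _ => ?_
  rw [sum_mulVec, dotProduct_sum]
  refine Finset.sum_congr rfl fun h _ => ?_
  rw [dotProduct_featMatrix_mulVec]
  exact Finset.sum_congr rfl fun s' _ => by rw [inner_eq_dotProduct, dotProduct_comm]

theorem weightedNorm_gram_inv_le (H : ℕ) {lam : ℝ} (hlam : 0 < lam) (x : ℕ → ℕ → S)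
    (u : ℕ → ℕ → A) (k : ℕ) (y : Vec d) :
    weightedNorm (gram M φ H lam x u k)⁻¹ y ≤ ‖y‖ / Real.sqrt lam := by
  have h := dotProduct_inv_mulVec_le (sum_featMatrix_posSemidef M φ H x u k) hlam
    (gram_posDef M φ H hlam x u k) y.ofLp
  rw [weightedNorm]
  calc _ ≤ Real.sqrt (y.ofLp ⬝ᵥ y.ofLp / lam) := Real.sqrt_le_sqrt h
    _ = _ := by
      rw [← inner_eq_dotProduct, real_inner_self_eq_norm_sq, Real.sqrt_div (sq_nonneg _),
        Real.sqrt_sq (norm_nonneg _)]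

theorem trace_featMatrix_le {U : ℕ} {L : ℝ} {s : S} {a : A} (hU : (M.reach s a).card ≤ U)
    (hL : ∀ s' ∈ M.reach s a, ‖φ s a s'‖ ≤ L) : (featMatrix M φ s a).trace ≤ U * L ^ 2 := by
  rw [featMatrix, trace_sum]
  calc _ ≤ ∑ s' ∈ M.reach s a, L ^ 2 := by
        refine Finset.sum_le_sum fun s' hs' => ?_
        rw [trace_vecMulVec, ← inner_eq_dotProduct, real_inner_self_eq_norm_sq]
        exact pow_le_pow_left₀ (norm_nonneg _) (hL s' hs') 2
    _ = (M.reach s a).card * L ^ 2 := by rw [Finset.sum_const, nsmul_eq_mul]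
    _ ≤ _ := by gcongr

/-- The trace of the Gram matrix is at most `dλ + kHU L²`; AM–GM turns this into a determinant
bound. -/
theorem log_det_gram_le (hd : 0 < d) {H U : ℕ} {lam L : ℝ} (hlam : 0 < lam)
    (hU : ∀ s a, (M.reach s a).card ≤ U) (hL : ∀ s a, ∀ s' ∈ M.reach s a, ‖φ s a s'‖ ≤ L)
    (x : ℕ → ℕ → S) (u : ℕ → ℕ → A) (k : ℕ) :
    Real.log ((gram M φ H lam x u k).det / lam ^ d) ≤
      d * Real.log (1 + k * H * U * max 1 (L ^ 2) / (d * lam)) := by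
  have hpd := gram_posDef M φ H hlam x u k
  have hd' : (0 : ℝ) < d := Nat.cast_pos.2 hd
  have : Nonempty (Fin d) := ⟨⟨0, hd⟩⟩
  set X := k * H * U * max 1 (L ^ 2) / (d * lam) with hX
  have hX0 : 0 ≤ X := by positivity
  have htr : (gram M φ H lam x u k).trace ≤ Fintype.card (Fin d) * (lam * (1 + X)) := by
    rw [gram_eq, trace_add, trace_smul, trace_one, trace_sum, Fintype.card_fin, smul_eq_mul]
    have h1 : ∑ k' ∈ Finset.range k, (∑ h ∈ Finset.range H,
        featMatrix M φ (x k' h) (u k' h)).trace ≤ k * (H * (U * L ^ 2)) := by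
      calc _ ≤ ∑ k' ∈ Finset.range k, (H * (U * L ^ 2) : ℝ) := by
            refine Finset.sum_le_sum fun k' _ => ?_
            rw [trace_sum]
            calc _ ≤ ∑ h ∈ Finset.range H, (U * L ^ 2 : ℝ) := Finset.sum_le_sum fun h _ =>
                  trace_featMatrix_le M φ (hU _ _) (hL _ _)
              _ = _ := by simp
        _ = _ := by simp
    have h2 : (k * (H * (U * L ^ 2)) : ℝ) ≤ d * lam * X := by
      rw [hX, mul_div_cancel₀ _ (by positivity)]
      calc (k * (H * (U * L ^ 2)) : ℝ) = k * H * U * L ^ 2 := by ring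
        _ ≤ _ := by gcongr; exact le_max_right _ _
    nlinarith
  have h := log_det_le_of_trace_le hpd (by positivity) htr
  rw [Fintype.card_fin, Real.log_mul hlam.ne' (by positivity)] at h
  rw [Real.log_div hpd.det_pos.ne' (by positivity), Real.log_pow]
  linarith

/-- The largest dual norm of a feature of `(s, a)`. -/
def featWidth (G : Matrix (Fin d) (Fin d) ℝ) (s : S) (a : A) : ℝ :=
  ⨆ s' : M.reach s a, weightedNorm G⁻¹ (φ s a s')

theorem weightedNorm_le_featWidth (G : Matrix (Fin d) (Fin d) ℝ) {s : S} {a : A} {s' : S}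
    (hs' : s' ∈ M.reach s a) : weightedNorm G⁻¹ (φ s a s') ≤ featWidth M φ G s a :=
  le_ciSup (f := fun s' : M.reach s a => weightedNorm G⁻¹ (φ s a s'))
    (Set.finite_range _).bddAbove ⟨s', hs'⟩

theorem exists_featWidth_eq (G : Matrix (Fin d) (Fin d) ℝ) (s : S) (a : A) :
    ∃ s' ∈ M.reach s a, weightedNorm G⁻¹ (φ s a s') = featWidth M φ G s a := by
  have : Nonempty (M.reach s a) := (reach_nonempty M s a).to_subtype
  obtain ⟨⟨s', hs'⟩, h⟩ := exists_eq_ciSup_of_finite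
    (f := fun s' : M.reach s a => weightedNorm G⁻¹ (φ s a s'))
  exact ⟨s', hs', h⟩

theorem featWidth_nonneg (G : Matrix (Fin d) (Fin d) ℝ) (s : S) (a : A) :
    0 ≤ featWidth M φ G s a := by
  obtain ⟨s', _, h⟩ := exists_featWidth_eq M φ G s a
  exact h ▸ weightedNorm_nonneg _ _

theorem featWidth_gram_le {H : ℕ} {lam L : ℝ} (hlam : 0 < lam) (x : ℕ → ℕ → S) (u : ℕ → ℕ → A)
    (k : ℕ) {s : S} {a : A} (hL : ∀ s' ∈ M.reach s a, ‖φ s a s'‖ ≤ L) :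
    featWidth M φ (gram M φ H lam x u k) s a ≤ L / Real.sqrt lam := by
  obtain ⟨s', hs', h⟩ := exists_featWidth_eq M φ (gram M φ H lam x u k) s a
  rw [← h]
  exact (weightedNorm_gram_inv_le M φ H hlam x u k _).trans (by gcongr; exact hL s' hs')

/-- The trace is the sum of the squared dual norms over all reachable states, which dominates the
maximum. -/
theorem featWidth_sq_le_trace {G : Matrix (Fin d) (Fin d) ℝ} (hG : G.PosDef) (s : S) (a : A) :
    featWidth M φ G s a ^ 2 ≤ (G⁻¹ * featMatrix M φ s a).trace := by
  obtain ⟨s', hs', h⟩ := exists_featWidth_eq M φ G s a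
  rw [← h, featMatrix, Finset.mul_sum, trace_sum]
  simp_rw [trace_inv_mul_vecMulVec, ← weightedNorm_sq hG.inv.posSemidef]
  exact Finset.single_le_sum (f := fun s' => weightedNorm G⁻¹ (φ s a s') ^ 2)
    (fun _ _ => sq_nonneg _) hs'

/-- Follows from `log (1 + z) ≥ log (1 + z/b) ≥ z / (b + z) ≥ z / (2b)`. It is applied with `b = H`,
the largest possible sum of squared widths in one episode, and is the source of the extra factor
`H`. -/
theorem le_two_mul_mul_log_one_add {z b : ℝ} (hb : 1 ≤ b) (hz0 : 0 ≤ z) (hz : z ≤ b) :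
    z ≤ 2 * b * Real.log (1 + z) := by
  have hb0 : 0 < b := by linarith
  have h1 : 1 - (1 + z / b)⁻¹ ≤ Real.log (1 + z / b) :=
    Real.one_sub_inv_le_log_of_pos (by positivity)
  have h2 : Real.log (1 + z / b) ≤ Real.log (1 + z) := by
    refine Real.log_le_log (by positivity) ?_
    have : z / b ≤ z := div_le_self hz0 hb
    linarith
  have h3 : z / (2 * b) ≤ 1 - (1 + z / b)⁻¹ := by
    have e : 1 - (1 + z / b)⁻¹ = z / (b + z) := by field_simp; ring
    rw [e]
    exact div_le_div_of_nonneg_left hz0 (by positivity) (by linarith)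
  have h4 := h3.trans (h1.trans h2)
  rw [div_le_iff₀ (by positivity)] at h4
  linarith

/-- The elliptical potential lemma for Gram matrices that are updated once per episode. -/
theorem sum_featWidth_sq_le {H : ℕ} (hH : 0 < H) {lam L : ℝ} (hL0 : 0 < L) (hlam : L ^ 2 ≤ lam)
    (hL : ∀ s a, ∀ s' ∈ M.reach s a, ‖φ s a s'‖ ≤ L)
    (x : ℕ → ℕ → S) (u : ℕ → ℕ → A) (K : ℕ) :
    ∑ k ∈ Finset.range K, ∑ h ∈ Finset.range H,
        featWidth M φ (gram M φ H lam x u k) (x k h) (u k h) ^ 2 ≤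
      2 * H * Real.log ((gram M φ H lam x u K).det / lam ^ d) := by
  have hlam0 : 0 < lam := lt_of_lt_of_le (by positivity) hlam
  -- Here `λ ≥ L²` is needed: the regularization alone keeps every width below 1.
  have hle1 : ∀ k s a, featWidth M φ (gram M φ H lam x u k) s a ≤ 1 := by
    intro k s a
    refine (featWidth_gram_le M φ hlam0 x u k (hL s a)).trans ?_
    rw [div_le_one (Real.sqrt_pos.2 hlam0)]
    exact Real.le_sqrt_of_sq_le hlam
  induction K with
  | zero => simp [gram, div_self (pow_pos hlam0 d).ne']
  | succ K ih =>
    rw [Finset.sum_range_succ]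
    set G := gram M φ H lam x u K with hG
    have hGp : G.PosDef := gram_posDef M φ H hlam0 x u K
    set P := ∑ h ∈ Finset.range H, featMatrix M φ (x K h) (u K h) with hP
    have hsucc : gram M φ H lam x u (K + 1) = G + P := by
      rw [hG, gram_eq, gram_eq, Finset.sum_range_succ, add_assoc]
    set z := ∑ h ∈ Finset.range H, featWidth M φ G (x K h) (u K h) ^ 2 with hz
    have hz0 : 0 ≤ z := Finset.sum_nonneg fun _ _ => sq_nonneg _
    have hzH : z ≤ H := by
      calc z ≤ ∑ h ∈ Finset.range H, (1 : ℝ) := Finset.sum_le_sum fun h _ =>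
            pow_le_one₀ (featWidth_nonneg M φ _ _ _) (hle1 K _ _)
        _ = H := by simp
    have hztr : z ≤ (G⁻¹ * P).trace := by
      rw [hP, Finset.mul_sum, trace_sum]
      exact Finset.sum_le_sum fun h _ => featWidth_sq_le_trace M φ hGp _ _
    have hdet : G.det * (1 + z) ≤ (G + P).det :=
      le_trans (mul_le_mul_of_nonneg_left (by linarith) hGp.det_pos.le)
        (det_mul_one_add_trace_le_det_add hGp
          (posSemidef_sum _ fun _ _ => featMatrix_posSemidef M φ _ _))
    have h1 := le_two_mul_mul_log_one_add (b := (H : ℝ)) (by exact_mod_cast hH) hz0 hzH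
    have h2 : Real.log (G.det / lam ^ d) + Real.log (1 + z) ≤
        Real.log ((G + P).det / lam ^ d) := by
      rw [← Real.log_mul (by have := hGp.det_pos; positivity) (by positivity)]
      refine Real.log_le_log (by have := hGp.det_pos; positivity) ?_
      rw [div_mul_eq_mul_div]
      gcongr
    rw [hsucc]
    have hH' : (0 : ℝ) ≤ 2 * H := by positivity
    nlinarith [mul_le_mul_of_nonneg_left h2 hH']

/-- The centered feature of the observed next state `y`. -/
def noise (θ : Vec d) (s : S) (a : A) (y : S) : Vec d :=
  φ s a y - ∑ s' ∈ M.reach s a, mnlProb M φ θ s a s' • φ s a s'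

theorem inner_noise (θ : Vec d) (s : S) (a : A) (y : S) (D : Vec d) :
    inner ℝ (noise M φ θ s a y) D = inner ℝ (φ s a y) D - featMean M φ θ D s a := by
  rw [noise, inner_sub_left, sum_inner, featMean]
  simp only [inner_smul_left, RCLike.conj_to_real]

/-- The left side of the basic inequality is at least `κ ‖D‖²` in the Gram norm, because `κ ≤ 1`
also covers the ridge term. The right side is at most `‖D‖` times the stated sum, by duality for the
noise and by `√λ |D| ≤ ‖D‖` for the bias; then one factor `‖D‖` is cancelled. -/
theorem IsRidgeMLE.weightedNorm_le {Θ : Set (Vec d)} (hΘ : Convex ℝ Θ) {H : ℕ} {lam : ℝ}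
    (hlam : 0 < lam)
    {x : ℕ → ℕ → S} {u : ℕ → ℕ → A} {k : ℕ} {θ' θ : Vec d} {κ : ℝ} (hκ1 : κ ≤ 1)
    (hmle : IsRidgeMLE M φ Θ H lam x u k θ') (hθ : θ ∈ Θ) {Lθ : ℝ} (hLθ : ‖θ‖ ≤ Lθ)
    (h0 : ∀ s a, ∃ s' ∈ M.reach s a, φ s a s' = 0)
    (hκ : ∀ s a, ∀ s' ∈ M.reach s a, ∀ s'' ∈ M.reach s a, ∀ θ ∈ Θ,
      κ ≤ mnlProb M φ θ s a s' * mnlProb M φ θ s a s'')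
    (hx : ∀ i < k, ∀ h < H, x i (h + 1) ∈ M.reach (x i h) (u i h)) :
    κ * weightedNorm (gram M φ H lam x u k) (θ' - θ) ≤
      weightedNorm (gram M φ H lam x u k)⁻¹ (∑ i ∈ Finset.range k, ∑ h ∈ Finset.range H,
        noise M φ θ (x i h) (u i h) (x i (h + 1))) + Real.sqrt lam * Lθ := by
  have hb := hmle.basic_inequality M φ hΘ hθ h0 hκ hx
  set G := gram M φ H lam x u k with hG
  have hGp : G.PosDef := gram_posDef M φ H hlam x u k
  set Y := ∑ i ∈ Finset.range k, ∑ h ∈ Finset.range H,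
        noise M φ θ (x i h) (u i h) (x i (h + 1)) with hY
  set D := θ - θ' with hD
  have hYD : inner ℝ Y D = ∑ i ∈ Finset.range k, ∑ h ∈ Finset.range H,
        (inner ℝ (φ (x i h) (u i h) (x i (h + 1))) D - featMean M φ θ D (x i h) (u i h)) := by
    rw [hY, sum_inner]
    refine Finset.sum_congr rfl fun i _ => ?_
    rw [sum_inner]
    exact Finset.sum_congr rfl fun h _ => inner_noise M φ θ _ _ _ _
  rw [← hYD] at hb
  have hquad := dotProduct_gram_mulVec M φ H lam x u k D
  rw [← hG, ← weightedNorm_sq hGp.posSemidef] at hquad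
  have hnorm : weightedNorm G (θ' - θ) = weightedNorm G D := by
    rw [hD, ← weightedNorm_neg G (θ - θ'), neg_sub]
  rw [hnorm]
  set W := weightedNorm G D with hW
  have hW0 : 0 ≤ W := weightedNorm_nonneg _ _
  have h1 := (abs_le.1 (abs_inner_le_weightedNorm hGp Y D)).1
  rw [← hW] at h1
  set V := ∑ k' ∈ Finset.range k, ∑ h ∈ Finset.range H, ∑ s' ∈ M.reach (x k' h) (u k' h),
        inner ℝ (φ (x k' h) (u k' h) s') D ^ 2
  have hV0 : 0 ≤ V := Finset.sum_nonneg fun _ _ => Finset.sum_nonneg fun _ _ =>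
    Finset.sum_nonneg fun _ _ => sq_nonneg _
  have hs := Real.sq_sqrt hlam.le
  have hs0 := Real.sqrt_nonneg lam
  have h2 : Real.sqrt lam * ‖D‖ ≤ W := by
    refine abs_le_of_sq_le_sq' ?_ hW0 |>.2
    rw [mul_pow, hs, hquad]
    linarith
  have h3 : lam * inner ℝ θ D ≤ Real.sqrt lam * Lθ * W := by
    have h4 : inner ℝ θ D ≤ Lθ * ‖D‖ :=
      (real_inner_le_norm θ D).trans (mul_le_mul_of_nonneg_right hLθ (norm_nonneg _))
    have hLθ0 : 0 ≤ Lθ := (norm_nonneg _).trans hLθ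
    calc lam * inner ℝ θ D ≤ lam * (Lθ * ‖D‖) := by gcongr
      _ = Real.sqrt lam ^ 2 * (Lθ * ‖D‖) := by rw [hs]
      _ = Real.sqrt lam * Lθ * (Real.sqrt lam * ‖D‖) := by ring
      _ ≤ _ := by gcongr
  have h5 : κ * W * W ≤ (weightedNorm G⁻¹ Y + Real.sqrt lam * Lθ) * W := by
    have : κ * W ^ 2 ≤ κ * V + lam * ‖D‖ ^ 2 := by
      rw [hquad]
      nlinarith [mul_nonneg hlam.le (sq_nonneg ‖D‖)]
    nlinarith
  rcases hW0.eq_or_lt with h | h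
  · rw [← h, mul_zero]
    have hLθ0 : 0 ≤ Lθ := (norm_nonneg _).trans hLθ
    have := weightedNorm_nonneg G⁻¹ Y
    positivity
  · exact le_of_mul_le_mul_right h5 h

end Gram

/-! ### Sums against bound and mapped discrete laws. -/

section PMFSums

variable {α β : Type*}

theorem tsum_bind_mul (p : PMF α) (f : α → PMF β) (F : β → ℝ≥0∞) :
    ∑' b, (p.bind f) b * F b = ∑' a, p a * ∑' b, f a b * F b := by
  simp_rw [PMF.bind_apply, ← ENNReal.tsum_mul_right, ← ENNReal.tsum_mul_left]
  rw [ENNReal.tsum_comm]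
  simp_rw [mul_assoc]

theorem tsum_map_mul (p : PMF α) (g : α → β) (F : β → ℝ≥0∞) :
    ∑' b, (p.map g) b * F b = ∑' a, p a * F (g a) := by
  rw [PMF.map, tsum_bind_mul]
  refine tsum_congr fun a => ?_
  congr 1
  rw [tsum_eq_single (g a)]
  · simp
  · intro b hb
    simp [hb]

end PMFSums

/-! ### Policy values, the Bellman equation and truncated width values. -/

section Values

variable {S A : Type*} (M : MDP S A)

/-- The expectation of `V` at the next state. -/
def transMean (V : S → ℝ) (s : S) (a : A) : ℝ :=
  ∑ y ∈ M.reach s a, (M.P s a y).toReal * V y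

/-- The expected reward sum over `n` steps, as an extended nonnegative real. -/
def evalue (π : Policy S A) (n h : ℕ) (s : S) : ℝ≥0∞ :=
  ∑' τ : List (S × A), rollout M π n h s τ *
    ENNReal.ofReal (τ.map fun x => M.r x.1 x.2).sum

theorem sum_reward_nonneg (τ : List (S × A)) : 0 ≤ (τ.map fun x => M.r x.1 x.2).sum :=
  List.sum_nonneg fun y hy => by
    obtain ⟨x, -, rfl⟩ := List.mem_map.1 hy
    exact M.r_nonneg _ _

theorem value_eq_toReal (H : ℕ) (π : Policy S A) (h : ℕ) (s : S) :
    value M H π h s = (evalue M π (H - h) h s).toReal := by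
  rw [evalue, ENNReal.tsum_toReal_eq fun τ =>
    ENNReal.mul_ne_top (PMF.apply_ne_top _ _) ENNReal.ofReal_ne_top]
  refine tsum_congr fun τ => ?_
  rw [ENNReal.toReal_mul, ENNReal.toReal_ofReal (sum_reward_nonneg M τ)]

theorem evalue_zero (π : Policy S A) (h : ℕ) (s : S) : evalue M π 0 h s = 0 := by
  rw [evalue, ENNReal.tsum_eq_zero]
  intro τ
  rw [rollout, PMF.pure_apply]
  split_ifs with h
  · simp [h]
  · simp

theorem evalue_succ (π : Policy S A) (n h : ℕ) (s : S) :
    evalue M π (n + 1) h s = ENNReal.ofReal (M.r s (π h s)) +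
      ∑' s', M.P s (π h s) s' * evalue M π n (h + 1) s' := by
  have h1 : ∀ s', ∑' τ, rollout M π n (h + 1) s' τ *
      ENNReal.ofReal ((((s, π h s) :: τ).map fun x => M.r x.1 x.2).sum) =
      ENNReal.ofReal (M.r s (π h s)) + evalue M π n (h + 1) s' := by
    intro s'
    simp_rw [List.map_cons, List.sum_cons,
      fun τ => ENNReal.ofReal_add (M.r_nonneg s (π h s)) (sum_reward_nonneg M τ), mul_add]
    rw [ENNReal.tsum_add, ENNReal.tsum_mul_right, PMF.tsum_coe, one_mul]
    rfl
  rw [evalue, rollout, tsum_bind_mul]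
  simp_rw [tsum_map_mul, h1, mul_add]
  rw [ENNReal.tsum_add, ENNReal.tsum_mul_right, PMF.tsum_coe, one_mul]

theorem evalue_le (π : Policy S A) (n h : ℕ) (s : S) : evalue M π n h s ≤ n := by
  induction n generalizing h s with
  | zero => rw [evalue_zero]; simp
  | succ n ih =>
    rw [evalue_succ]
    calc _ ≤ 1 + ∑' s', M.P s (π h s) s' * (n : ℝ≥0∞) := by
          gcongr with s'
          · exact ENNReal.ofReal_le_one.2 (M.r_le_one _ _)
          · exact ih _ _
      _ = _ := by
          rw [ENNReal.tsum_mul_right, PMF.tsum_coe, one_mul]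
          push_cast
          rw [add_comm]

theorem evalue_ne_top (π : Policy S A) (n h : ℕ) (s : S) : evalue M π n h s ≠ ∞ :=
  ((evalue_le M π n h s).trans_lt (ENNReal.natCast_lt_top n)).ne

theorem value_nonneg (H : ℕ) (π : Policy S A) (h : ℕ) (s : S) : 0 ≤ value M H π h s := by
  rw [value_eq_toReal]
  exact ENNReal.toReal_nonneg

theorem value_le (H : ℕ) (π : Policy S A) (h : ℕ) (s : S) : value M H π h s ≤ H := by
  rw [value_eq_toReal]
  have h1 := ENNReal.toReal_mono (ENNReal.natCast_ne_top _) (evalue_le M π (H - h) h s)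
  rw [ENNReal.toReal_natCast] at h1
  exact h1.trans (by exact_mod_cast Nat.sub_le H h)

theorem value_eq_zero (H : ℕ) (π : Policy S A) (s : S) : value M H π H s = 0 := by
  rw [value_eq_toReal, Nat.sub_self, evalue_zero, ENNReal.toReal_zero]

/-- The Bellman equation of a policy. -/
theorem value_eq_reward_add {H : ℕ} (π : Policy S A) {h : ℕ} (hh : h < H) (s : S) :
    value M H π h s = M.r s (π h s) + transMean M (value M H π (h + 1)) s (π h s) := by
  have e : H - h = (H - (h + 1)) + 1 := by omega
  have hs : ∑' s', M.P s (π h s) s' * evalue M π (H - (h + 1)) (h + 1) s' =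
      ∑ s' ∈ M.reach s (π h s), M.P s (π h s) s' * evalue M π (H - (h + 1)) (h + 1) s' :=
    tsum_eq_sum fun s' hs' => by
      rw [M.mem_reach, not_not] at hs'
      rw [hs', zero_mul]
  have hne : ∀ s' ∈ M.reach s (π h s),
      M.P s (π h s) s' * evalue M π (H - (h + 1)) (h + 1) s' ≠ ∞ := fun s' _ =>
    ENNReal.mul_ne_top (PMF.apply_ne_top _ _) (evalue_ne_top M π _ _ _)
  rw [value_eq_toReal, e, evalue_succ, hs, ENNReal.toReal_add ENNReal.ofReal_ne_top
    (ENNReal.sum_ne_top.2 hne), ENNReal.toReal_ofReal (M.r_nonneg _ _), ENNReal.toReal_sum hne]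
  simp only [transMean, ENNReal.toReal_mul, ← value_eq_toReal]

theorem sum_P_toReal (s : S) (a : A) : ∑ s' ∈ M.reach s a, (M.P s a s').toReal = 1 := by
  rw [← ENNReal.toReal_sum fun s' _ => PMF.apply_ne_top _ _,
    ← tsum_eq_sum (L := .unconditional S) fun s' hs' => ?_, PMF.tsum_coe, ENNReal.toReal_one]
  rw [M.mem_reach, not_not] at hs'
  exact hs'

theorem transMean_mono {V W : S → ℝ} (h : ∀ s, V s ≤ W s) (s : S) (a : A) :
    transMean M V s a ≤ transMean M W s a :=
  Finset.sum_le_sum fun s' _ => mul_le_mul_of_nonneg_left (h s') ENNReal.toReal_nonneg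

theorem transMean_const (c : ℝ) (s : S) (a : A) : transMean M (fun _ => c) s a = c := by
  rw [transMean, ← Finset.sum_mul, sum_P_toReal, one_mul]

theorem transMean_add (V W : S → ℝ) (s : S) (a : A) :
    transMean M (fun s => V s + W s) s a = transMean M V s a + transMean M W s a := by
  simp only [transMean, mul_add, Finset.sum_add_distrib]

theorem transMean_eq_mnlMean {d : ℕ} {φ : S → A → S → Vec d} {θ : Vec d} (h : IsMNL M φ θ)
    (V : S → ℝ) (s : S) (a : A) : transMean M V s a = mnlMean M φ θ V s a :=
  Finset.sum_congr rfl fun y hy => by rw [h s a y hy]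

/-- The truncated expected sum of the widths `w` under `π`, with `n` steps to go from step `h`. -/
def widthValue (H : ℕ) (w : S → A → ℝ) (π : Policy S A) : ℕ → ℕ → S → ℝ
  | 0, _, _ => 0
  | n + 1, h, s => min (w s (π h s) + transMean M (widthValue H w π n (h + 1)) s (π h s)) H

theorem widthValue_le (H : ℕ) (w : S → A → ℝ) (π : Policy S A) (n h : ℕ) (s : S) :
    widthValue M H w π n h s ≤ H := by
  cases n with
  | zero => simp [widthValue]
  | succ n => exact min_le_right _ _

theorem widthValue_nonneg (H : ℕ) {w : S → A → ℝ} (hw : ∀ s a, 0 ≤ w s a) (π : Policy S A)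
    (n h : ℕ) (s : S) : 0 ≤ widthValue M H w π n h s := by
  induction n generalizing h s with
  | zero => simp [widthValue]
  | succ n ih =>
    rw [widthValue]
    refine le_min (add_nonneg (hw _ _) ?_) (Nat.cast_nonneg H)
    exact Finset.sum_nonneg fun s' _ => mul_nonneg ENNReal.toReal_nonneg (ih _ _)

end Values

/-! ### Optimistic value iteration: optimism and its price. -/

section Optimism

variable {S A : Type*} {d : ℕ} (M : MDP S A) (φ : S → A → S → Vec d)
variable {rule : OptimismRule} {H : ℕ} {θ' : Vec d} {G : Matrix (Fin d) (Fin d) ℝ} {b : ℝ}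

theorem optimisticV_le (n : ℕ) (s : S) : optimisticV M φ rule H θ' G b n s ≤ H := by
  cases n with
  | zero => simp [optimisticV]
  | succ n => exact min_le_right _ _

theorem bddAbove_image_mnlMean {V : S → ℝ} {c : ℝ} (hV : ∀ s, V s ≤ c) (T : Set (Vec d)) (s : S)
    (a : A) : BddAbove ((fun θ => mnlMean M φ θ V s a) '' T) :=
  ⟨c, by rintro _ ⟨θ, -, rfl⟩; exact mnlMean_le M φ θ hV s a⟩

theorem reward_add_mnlMean_le_optBackup (hb : 0 ≤ b) {V : S → ℝ} (hV : ∀ s, V s ≤ H) (s : S) (a : A) :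
    M.r s a + mnlMean M φ θ' V s a ≤ optBackup M φ rule H θ' G b V s a := by
  cases rule with
  | confidenceSet =>
    simp only [optBackup]
    gcongr
    exact le_csSup (bddAbove_image_mnlMean M φ hV _ s a)
      ⟨θ', by simpa [weightedNorm] using hb, rfl⟩
  | closedForm =>
    simp only [optBackup]
    have := featWidth_nonneg M φ G s a
    rw [featWidth] at this
    have : 0 ≤ 2 * H * b * ⨆ s' : M.reach s a, weightedNorm G⁻¹ (φ s a s') := by positivity
    linarith

theorem optBackup_nonneg (hb : 0 ≤ b) {V : S → ℝ} (hV0 : ∀ s, 0 ≤ V s)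
    (hV : ∀ s, V s ≤ H) (s : S) (a : A) : 0 ≤ optBackup M φ rule H θ' G b V s a :=
  (add_nonneg (M.r_nonneg s a) (mnlMean_nonneg M φ θ' hV0 s a)).trans
    (reward_add_mnlMean_le_optBackup M φ hb hV s a)

theorem abs_inner_sub_le (hG : G.PosDef) {θ₁ θ₂ : Vec d} {c : ℝ}
    (h : weightedNorm G (θ₁ - θ₂) ≤ c) {s : S} {a : A} {s' : S} (hs' : s' ∈ M.reach s a) :
    |inner ℝ (φ s a s') (θ₁ - θ₂)| ≤ c * featWidth M φ G s a := by
  rw [mul_comm]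
  exact (abs_inner_le_weightedNorm hG _ _).trans (mul_le_mul (weightedNorm_le_featWidth M φ G hs')
    h (weightedNorm_nonneg _ _) (featWidth_nonneg M φ G s a))

theorem mnlMean_le_add_featWidth (hG : G.PosDef) {θ₁ θ₂ : Vec d} {c : ℝ}
    (h : weightedNorm G (θ₁ - θ₂) ≤ c) {V : S → ℝ} (hV0 : ∀ s, 0 ≤ V s) (hV : ∀ s, V s ≤ H)
    (s : S) (a : A) :
    mnlMean M φ θ₁ V s a ≤ mnlMean M φ θ₂ V s a + 2 * H * c * featWidth M φ G s a := by
  have hc : 0 ≤ c := (weightedNorm_nonneg _ _).trans h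
  have := mnlMean_sub_le M φ hV0 hV (mul_nonneg hc (featWidth_nonneg M φ G s a))
    fun s' hs' => abs_inner_sub_le M φ hG h hs'
  linarith

theorem weightedNorm_sub_comm (B : Matrix (Fin d) (Fin d) ℝ) (x y : Vec d) :
    weightedNorm B (x - y) = weightedNorm B (y - x) := by
  rw [← weightedNorm_neg, neg_sub]

/-- One-step optimism when the true parameter is in the confidence set. -/
theorem reward_add_mnlMean_le_optBackup_of_mem (hG : G.PosDef) {θ : Vec d}
    (h : weightedNorm G (θ' - θ) ≤ b) {V : S → ℝ} (hV0 : ∀ s, 0 ≤ V s) (hV : ∀ s, V s ≤ H)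
    (s : S) (a : A) :
    M.r s a + mnlMean M φ θ V s a ≤ optBackup M φ rule H θ' G b V s a := by
  rw [weightedNorm_sub_comm] at h
  cases rule with
  | confidenceSet =>
    simp only [optBackup]
    gcongr
    exact le_csSup (bddAbove_image_mnlMean M φ hV _ s a) ⟨θ, h, rfl⟩
  | closedForm =>
    have := mnlMean_le_add_featWidth M φ hG h hV0 hV s a
    rw [featWidth] at this
    simp only [optBackup]
    linarith

/-- Without optimism, the backup is off by at most the estimation error. -/
theorem reward_add_mnlMean_le_optBackup_add (hG : G.PosDef) (hb : 0 ≤ b) {θ : Vec d} {c : ℝ}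
    (h : weightedNorm G (θ' - θ) ≤ c) {V : S → ℝ} (hV0 : ∀ s, 0 ≤ V s) (hV : ∀ s, V s ≤ H)
    (s : S) (a : A) :
    M.r s a + mnlMean M φ θ V s a ≤
      optBackup M φ rule H θ' G b V s a + 2 * H * c * featWidth M φ G s a := by
  rw [weightedNorm_sub_comm] at h
  have h1 := mnlMean_le_add_featWidth M φ hG h hV0 hV s a
  have h2 := reward_add_mnlMean_le_optBackup M φ (rule := rule) (θ' := θ') (G := G) hb hV s a
  linarith

/-- The factor 4 has two sources. A parameter in the confidence set is within `b + c ≤ 2c` of `θ`;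
in the closed form, the bonus and the estimation error each contribute `2 H c` times the width. -/
theorem optBackup_le (hG : G.PosDef) (hb : 0 ≤ b) {θ : Vec d} {c : ℝ}
    (h : weightedNorm G (θ' - θ) ≤ c) (hbc : b ≤ c) {V : S → ℝ} (hV0 : ∀ s, 0 ≤ V s)
    (hV : ∀ s, V s ≤ H) (s : S) (a : A) :
    optBackup M φ rule H θ' G b V s a ≤
      M.r s a + mnlMean M φ θ V s a + 4 * H * c * featWidth M φ G s a := by
  have hw := featWidth_nonneg M φ G s a
  cases rule with
  | confidenceSet =>
    simp only [optBackup]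
    rw [add_assoc]
    gcongr
    refine csSup_le ⟨_, ⟨θ', by simpa [weightedNorm] using hb, rfl⟩⟩ ?_
    rintro _ ⟨θ₁, hθ₁, rfl⟩
    have h1 : weightedNorm G (θ₁ - θ) ≤ c + c := by
      refine (weightedNorm_sub_le hG θ₁ θ' θ).trans (add_le_add (hθ₁.trans hbc) ?_)
      rwa [weightedNorm_sub_comm]
    have := mnlMean_le_add_featWidth M φ hG h1 hV0 hV s a
    simp only
    linarith
  | closedForm =>
    have h1 := mnlMean_le_add_featWidth M φ hG h hV0 hV s a
    have h2 : 2 * H * b * featWidth M φ G s a ≤ 2 * H * c * featWidth M φ G s a := by gcongr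
    simp only [featWidth] at h1 h2 ⊢
    simp only [optBackup]
    linarith

/-- The action space may be infinite and an unbounded real supremum is 0 by convention, so a uniform
bound `w` on the widths is needed before the supremum dominates its terms. -/
theorem bddAbove_range_optBackup (hb : 0 ≤ b) {V : S → ℝ} (hV : ∀ s, V s ≤ H) {w : ℝ}
    (hw : ∀ s a, featWidth M φ G s a ≤ w) (s : S) :
    BddAbove (Set.range fun a => optBackup M φ rule H θ' G b V s a) := by
  refine ⟨1 + H + 2 * H * b * w, ?_⟩
  rintro _ ⟨a, rfl⟩
  have hw0 : 0 ≤ w := (featWidth_nonneg M φ G s a).trans (hw s a)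
  have hpos : 0 ≤ 2 * H * b * w := by positivity
  cases rule with
  | confidenceSet =>
    simp only [optBackup]
    have h1 : sSup ((fun θ => mnlMean M φ θ V s a) '' {θ | weightedNorm G (θ - θ') ≤ b}) ≤ H := by
      refine csSup_le ⟨_, ⟨θ', by simpa [weightedNorm] using hb, rfl⟩⟩ ?_
      rintro _ ⟨θ₁, -, rfl⟩
      exact mnlMean_le M φ θ₁ hV s a
    linarith [M.r_le_one s a]
  | closedForm =>
    have h2 : 2 * H * b * featWidth M φ G s a ≤ 2 * H * b * w := by gcongr; exact hw s a
    simp only [featWidth] at h2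
    simp only [optBackup]
    linarith [M.r_le_one s a, mnlMean_le M φ θ' hV s a]

theorem optimisticV_nonneg [Nonempty A] (hb : 0 ≤ b) {w : ℝ}
    (hw : ∀ s a, featWidth M φ G s a ≤ w) (n : ℕ) (s : S) :
    0 ≤ optimisticV M φ rule H θ' G b n s := by
  induction n generalizing s with
  | zero => simp [optimisticV]
  | succ n ih =>
    rw [optimisticV]
    refine le_min ?_ (Nat.cast_nonneg H)
    obtain ⟨a⟩ := ‹Nonempty A›
    exact (optBackup_nonneg M φ hb ih (optimisticV_le M φ n) s a).trans
      (le_ciSup (bddAbove_range_optBackup M φ hb (optimisticV_le M φ n) hw s) a)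

/-- The value of every policy is below the optimistic value, up to the accumulated optimism
gaps `e`. -/
theorem value_le_optimisticV_add [Nonempty A] (hb : 0 ≤ b) {w e : ℝ}
    (hw : ∀ s a, featWidth M φ G s a ≤ w) (he : 0 ≤ e) {θ : Vec d} (hmnl : IsMNL M φ θ)
    (hopt : ∀ V : S → ℝ, (∀ s, 0 ≤ V s) → (∀ s, V s ≤ H) → ∀ s a,
      M.r s a + mnlMean M φ θ V s a ≤ optBackup M φ rule H θ' G b V s a + e)
    (π : Policy S A) (n h : ℕ) (hn : n + h = H) (s : S) :
    value M H π h s ≤ optimisticV M φ rule H θ' G b n s + n * e := by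
  induction n generalizing h s with
  | zero =>
    have : h = H := by omega
    subst this
    simp [value_eq_zero, optimisticV]
  | succ n ih =>
    have hh : h < H := by omega
    have hne : (0 : ℝ) ≤ (n + 1 : ℕ) * e := by positivity
    rw [optimisticV, ← min_add_add_right]
    -- Truncation at `H` does not destroy optimism, because true values never exceed `H`.
    refine le_min ?_ ((value_le M H π h s).trans (by linarith))
    rw [value_eq_reward_add M π hh]
    have h1 : transMean M (value M H π (h + 1)) s (π h s) ≤
        mnlMean M φ θ (optimisticV M φ rule H θ' G b n) s (π h s) + n * e := by
      refine (transMean_mono M (fun s' => ih (h + 1) (by omega) s') s _).trans (le_of_eq ?_)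
      rw [transMean_add, transMean_const, transMean_eq_mnlMean M hmnl]
    have h2 := hopt (optimisticV M φ rule H θ' G b n) (optimisticV_nonneg M φ hb hw n)
      (optimisticV_le M φ n) s (π h s)
    have h3 := le_ciSup (bddAbove_range_optBackup M φ (rule := rule) (θ' := θ') hb
      (optimisticV_le M φ (rule := rule) (H := H) (θ' := θ') (G := G) (b := b) n) hw s) (π h s)
    push_cast
    linarith

/-- The optimistic value exceeds the value of the greedy policy by at most the expected widths. -/
theorem optimisticV_le_value_add [Nonempty A] (hb : 0 ≤ b) {w : ℝ}
    (hw : ∀ s a, featWidth M φ G s a ≤ w) {θ : Vec d} (hmnl : IsMNL M φ θ) {ε : S → A → ℝ}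
    (hε : ∀ V : S → ℝ, (∀ s, 0 ≤ V s) → (∀ s, V s ≤ H) → ∀ s a,
      optBackup M φ rule H θ' G b V s a ≤ M.r s a + mnlMean M φ θ V s a + ε s a)
    {π : Policy S A}
    (hπ : ∀ h < H, ∀ x a, optimisticQ M φ rule H θ' G b h x a ≤
      optimisticQ M φ rule H θ' G b h x (π h x))
    (n h : ℕ) (hn : n + h = H) (s : S) :
    optimisticV M φ rule H θ' G b n s ≤ value M H π h s + widthValue M H ε π n h s := by
  induction n generalizing h s with
  | zero =>
    have : h = H := by omega
    subst this
    simp [value_eq_zero, optimisticV, widthValue]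
  | succ n ih =>
    have hh : h < H := by omega
    have e : H - (h + 1) = n := by omega
    rw [widthValue, ← min_add_add_left]
    refine le_min ?_ ((optimisticV_le M φ _ s).trans (by linarith [value_nonneg M H π h s]))
    have h1 : optimisticV M φ rule H θ' G b (n + 1) s ≤
        optBackup M φ rule H θ' G b (optimisticV M φ rule H θ' G b n) s (π h s) := by
      rw [optimisticV]
      refine (min_le_left _ _).trans (ciSup_le fun a => ?_)
      have := hπ h hh s a
      rwa [optimisticQ, optimisticQ, e] at this
    have h2 := hε (optimisticV M φ rule H θ' G b n) (optimisticV_nonneg M φ hb hw n)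
      (optimisticV_le M φ n) s (π h s)
    have h3 : mnlMean M φ θ (optimisticV M φ rule H θ' G b n) s (π h s) ≤
        transMean M (value M H π (h + 1)) s (π h s) +
          transMean M (widthValue M H ε π n (h + 1)) s (π h s) := by
      rw [← transMean_eq_mnlMean M hmnl, ← transMean_add]
      exact transMean_mono M (fun s' => ih (h + 1) (by omega) s') s _
    rw [value_eq_reward_add M π hh]
    linarith

end Optimism

/-! ### Measurability along a run and the two high-probability events. -/

section Run

theorem sum_range_mul_eq {E : Type*} [AddCommMonoid E] {H : ℕ} (hH : 0 < H) (f : ℕ → ℕ → E)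
    (k : ℕ) : ∑ t ∈ Finset.range (k * H), f (t / H) (t % H) =
      ∑ i ∈ Finset.range k, ∑ h ∈ Finset.range H, f i h := by
  induction k with
  | zero => simp
  | succ k ih =>
    rw [Nat.succ_mul, Finset.sum_range_add, ih, Finset.sum_range_succ]
    congr 1
    refine Finset.sum_congr rfl fun h hh => ?_
    have hh' : h < H := Finset.mem_range.1 hh
    rw [mul_comm k H, Nat.mul_add_div hH, Nat.div_eq_of_lt hh', Nat.mul_add_mod,
      Nat.mod_eq_of_lt hh', add_zero]

theorem div_lt_of_lt_mul' {t K H : ℕ} (ht : t < K * H) : t / H < K := by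
  rw [mul_comm] at ht
  exact Nat.div_lt_of_lt_mul ht

/-- Time `t` stands for step `t % H` of episode `t / H`. At the last step the next state is revealed
at `(k, H)`, which precedes `(k + 1, 0)` in the lexicographic order, so it is known at time `t + 1`.
-/
theorem toLex_step_le {H : ℕ} (hH : 0 < H) (t : ℕ) :
    toLex (t / H, t % H + 1) ≤ (toLex ((t + 1) / H, (t + 1) % H) : ℕ ×ₗ ℕ) := by
  rw [Prod.Lex.toLex_le_toLex]
  have h1 := Nat.div_add_mod t H
  have h2 := Nat.mod_lt t hH
  by_cases h : t % H + 1 < H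
  · right
    have e : t + 1 = H * (t / H) + (t % H + 1) := by omega
    have e1 : (t + 1) / H = t / H := by
      rw [e, Nat.mul_add_div hH, Nat.div_eq_of_lt h, add_zero]
    have e2 : (t + 1) % H = t % H + 1 := by
      rw [e, Nat.mul_add_mod, Nat.mod_eq_of_lt h]
    exact ⟨e1.symm, e2.ge⟩
  · left
    have e : t + 1 = H * (t / H + 1) := by rw [mul_add, mul_one]; omega
    have e1 : (t + 1) / H = t / H + 1 := by rw [e, Nat.mul_div_cancel_left _ hH]
    simp only [e1]
    omega

theorem monotone_toLex_div_mod {H : ℕ} (hH : 0 < H) :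
    Monotone fun t : ℕ => (toLex (t / H, t % H) : ℕ ×ₗ ℕ) := by
  refine monotone_nat_of_le_succ fun t => le_trans ?_ (toLex_step_le hH t)
  rw [Prod.Lex.toLex_le_toLex]
  exact Or.inr ⟨rfl, Nat.le_succ _⟩

theorem measurable_apply_of_countable {Ω S β : Type*} {m : MeasurableSpace Ω} [MeasurableSpace β]
    [Countable S] [MeasurableSpace S] [DiscreteMeasurableSpace S] {f : Ω → S → β}
    (hf : ∀ x, Measurable fun ω => f ω x) {X : Ω → S} (hX : Measurable X) :
    Measurable fun ω => f ω (X ω) := by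
  have h : Measurable fun p : S × Ω => f p.2 p.1 := measurable_from_prod_countable_right hf
  exact h.comp (hX.prodMk measurable_id)

theorem measurable_comp_of_countable {Ω S β : Type*} {m : MeasurableSpace Ω} [MeasurableSpace β]
    [Countable S] [MeasurableSpace S] [DiscreteMeasurableSpace S] (F : S → β) {X : Ω → S}
    (hX : Measurable X) : Measurable fun ω => F (X ω) :=
  (measurable_of_countable F).comp hX

/-- The range of `g` is attained at two indices, and `(y - x)² ≤ 2 (x² + y²)`. Hoeffding's `(y - x)²
/ 8` thus becomes a quarter of the sum of squares, the quadratic form in `expWeight`. -/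
theorem sq_sub_le_two_mul_sum_sq {ι : Type*} {R : Finset ι} (hR : R.Nonempty) (g : ι → ℝ) :
    ∃ x y, (∀ i ∈ R, g i ∈ Set.Icc x y) ∧ (y - x) ^ 2 ≤ 2 * ∑ i ∈ R, g i ^ 2 := by
  classical
  obtain ⟨i, hi, hmin⟩ := R.exists_min_image g hR
  obtain ⟨j, hj, hmax⟩ := R.exists_max_image g hR
  refine ⟨g i, g j, fun l hl => ⟨hmin l hl, hmax l hl⟩, ?_⟩
  by_cases hij : i = j
  · subst hij
    simp only [sub_self]
    have := Finset.sum_nonneg fun l (_ : l ∈ R) => sq_nonneg (g l)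
    linarith
  · have h1 : g i ^ 2 + g j ^ 2 ≤ ∑ l ∈ R, g l ^ 2 := by
      rw [← Finset.sum_pair hij (f := fun l => g l ^ 2)]
      exact Finset.sum_le_sum_of_subset_of_nonneg
        (by intro l hl; simp only [Finset.mem_insert, Finset.mem_singleton] at hl
            rcases hl with rfl | rfl <;> assumption) fun _ _ _ => sq_nonneg _
    nlinarith [sq_nonneg (g i + g j)]

section Model

variable {S A : Type*} {d : ℕ} {M : MDP S A} {φ : S → A → S → Vec d}

theorem dotProduct_noise {θ : Vec d} (hmnl : IsMNL M φ θ) (x : S) (u : A) (y : S)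
    (v : Fin d → ℝ) :
    v ⬝ᵥ (noise M φ θ x u y).ofLp = v ⬝ᵥ (φ x u y).ofLp -
      ∑ s' ∈ M.reach x u, (M.P x u s').toReal * (v ⬝ᵥ (φ x u s').ofLp) := by
  have h1 := inner_noise M φ θ x u y (WithLp.toLp 2 v)
  rw [inner_eq_dotProduct, inner_eq_dotProduct, featMean] at h1
  rw [dotProduct_comm, h1, dotProduct_comm]
  congr 1
  refine Finset.sum_congr rfl fun s' hs' => ?_
  rw [hmnl x u s' hs', inner_eq_dotProduct, dotProduct_comm]

/-- The one-step martingale difference of a next-state function. -/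
def mdiff (M : MDP S A) (V : S → ℝ) (x : S) (u : A) (y : S) : ℝ := transMean M V x u - V y

end Model

section MeasurableWidth

variable {S A Ω : Type*} [MeasurableSpace S]
  [Countable A] [MeasurableSpace A] [DiscreteMeasurableSpace A]
  {mΩ : MeasurableSpace Ω} {d : ℕ} {M : MDP S A} {φ : S → A → S → Vec d} {Θ : Set (Vec d)}
  {rule : OptimismRule} {H K : ℕ} {lam : ℝ} {β : ℕ → ℝ} {μ : Measure Ω}
  {ℱ : Filtration (ℕ ×ₗ ℕ) mΩ} {s : ℕ → ℕ → Ω → S} {a : ℕ → ℕ → Ω → A} {est : ℕ → Ω → Vec d}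
  {pol : ℕ → Ω → Policy S A}

/-- The policy and the widths are fixed at the start of the episode, so this function may be used as
a predictable integrand at all its steps. Countability of the actions permits substituting the
random action. -/
theorem IsRun.measurable_widthValue (hrun : IsRun M φ Θ rule H K lam β μ ℱ s a est pol)
    {k : ℕ} (hk : k < K) {w : Ω → S → A → ℝ}
    (hw : ∀ x u, Measurable[ℱ (toLex (k, 0))] fun ω => w ω x u) (n h : ℕ) (hn : n + h ≤ H)
    (x : S) : Measurable[ℱ (toLex (k, 0))] fun ω => widthValue M H (w ω) (pol k ω) n h x := by
  induction n generalizing h x with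
  | zero => exact measurable_const
  | succ n ih =>
    simp only [widthValue]
    refine Measurable.min ?_ measurable_const
    refine @measurable_apply_of_countable _ _ _ (ℱ (toLex (k, 0))) _ _ _ _
      (fun ω u => w ω x u + transMean M (widthValue M H (w ω) (pol k ω) n (h + 1)) x u)
      (fun u => ?_) _ (hrun.measurable_pol k hk h (by omega) x)
    refine (hw x u).add ?_
    simp only [transMean]
    refine @Finset.measurable_sum _ _ _ _ _ _ (ℱ (toLex (k, 0))) _ _ fun s' _ => ?_
    exact (ih (h + 1) (by omega) s').const_mul _

end MeasurableWidth

variable {S A Ω : Type*} [Countable S] [MeasurableSpace S] [DiscreteMeasurableSpace S]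
  [MeasurableSpace A]
  {mΩ : MeasurableSpace Ω} {d : ℕ} {M : MDP S A} {φ : S → A → S → Vec d} {Θ : Set (Vec d)}
  {rule : OptimismRule} {H K : ℕ} {lam : ℝ} {β : ℕ → ℝ} {μ : Measure Ω}
  {ℱ : Filtration (ℕ ×ₗ ℕ) mΩ} {s : ℕ → ℕ → Ω → S} {a : ℕ → ℕ → Ω → A} {est : ℕ → Ω → Vec d}
  {pol : ℕ → Ω → Policy S A}

theorem IsRun.measurable_action (hrun : IsRun M φ Θ rule H K lam β μ ℱ s a est pol)
    {k h : ℕ} (hk : k < K) (hh : h < H) : Measurable[ℱ (toLex (k, h))] (a k h) := by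
  have e : a k h = fun ω => pol k ω h (s k h ω) := funext fun ω => hrun.action k hk ω h hh
  rw [e]
  refine @measurable_apply_of_countable _ _ _ (ℱ (toLex (k, h))) _ _ _ _
    (fun ω x => pol k ω h x) (fun x => ?_) _ (hrun.measurable_state k hk h hh.le)
  refine (hrun.measurable_pol k hk h hh x).mono (ℱ.mono ?_) le_rfl
  rw [Prod.Lex.toLex_le_toLex]
  exact Or.inr ⟨rfl, Nat.zero_le _⟩

theorem IsRun.measurable_pair (hrun : IsRun M φ Θ rule H K lam β μ ℱ s a est pol)
    {k h : ℕ} (hk : k < K) (hh : h < H) :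
    Measurable[ℱ (toLex (k, h))] fun ω => (s k h ω, a k h ω) :=
  (hrun.measurable_state k hk h hh.le).prodMk (hrun.measurable_action hk hh)

variable [Countable A] [DiscreteMeasurableSpace A]

theorem IsRun.isCondLaw (hrun : IsRun M φ Θ rule H K lam β μ ℱ s a est pol)
    {k h : ℕ} (hk : k < K) (hh : h < H) :
    IsCondLaw μ (ℱ (toLex (k, h))) (s k (h + 1)) fun ω => M.P (s k h ω) (a k h ω) where
  le := ℱ.le _
  measurable := (hrun.measurable_state k hk (h + 1) hh).mono (ℱ.le _) le_rfl
  measurable_law s' :=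
    measurable_comp_of_countable (fun z : S × A => M.P z.1 z.2 s') (hrun.measurable_pair hk hh)
  condExp s' := hrun.transition k hk h hh s'

theorem IsRun.ae_mem_reach [IsFiniteMeasure μ]
    (hrun : IsRun M φ Θ rule H K lam β μ ℱ s a est pol) :
    ∀ᵐ ω ∂μ, ∀ k < K, ∀ h < H, s k (h + 1) ω ∈ M.reach (s k h ω) (a k h ω) := by
  refine ae_all_iff.2 fun k => ?_
  by_cases hk : k < K
  · refine Filter.Eventually.mono (ae_all_iff.2 fun h => ?_) fun ω hω _ => hω
    by_cases hh : h < H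
    · filter_upwards [(hrun.isCondLaw hk hh).ae_mem] with ω hω _
      exact (M.mem_reach _ _ _).2 hω
    · exact Filter.Eventually.of_forall fun ω h' => absurd h' hh
  · exact Filter.Eventually.of_forall fun ω h' => absurd h' hk

/-- The self-normalized bound is applied in flattened time with the full feature matrix of the
visited pair as increment, and read off at the multiples `k * H`, where its matrix is the Gram
matrix of episode `k`. -/
theorem IsRun.measure_noise_le [IsProbabilityMeasure μ]
    (hrun : IsRun M φ Θ rule H K lam β μ ℱ s a est pol) (hH : 0 < H) (hlam : 0 < lam)
    {θ : Vec d} (hmnl : IsMNL M φ θ) {δ : ℝ} (hδ : 0 < δ) :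
    μ {ω | ∃ k ≤ K, 1 / 2 * Real.log ((gram M φ H lam (fun i j => s i j ω)
          (fun i j => a i j ω) k).det / lam ^ d) + Real.log (1 / δ) ≤
        weightedNorm (gram M φ H lam (fun i j => s i j ω) (fun i j => a i j ω) k)⁻¹
          (∑ i ∈ Finset.range k, ∑ h ∈ Finset.range H,
            noise M φ θ (s i h ω) (a i h ω) (s i (h + 1) ω)) ^ 2} ≤ ENNReal.ofReal δ := by
  set ξ : ℕ → Ω → Fin d → ℝ := fun t ω =>
    (noise M φ θ (s (t / H) (t % H) ω) (a (t / H) (t % H) ω) (s (t / H) (t % H + 1) ω)).ofLp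
    with hξ
  set Q : ℕ → Ω → Matrix (Fin d) (Fin d) ℝ := fun t ω =>
    featMatrix M φ (s (t / H) (t % H) ω) (a (t / H) (t % H) ω) with hQ
  have hmod : ∀ t, t % H < H := fun t => Nat.mod_lt t hH
  have hpair : ∀ t < K * H, Measurable[ℱ (toLex ((t + 1) / H, (t + 1) % H))]
      fun ω => (s (t / H) (t % H) ω, a (t / H) (t % H) ω) := fun t ht =>
    (hrun.measurable_pair (div_lt_of_lt_mul' ht) (hmod t)).mono
      (ℱ.mono (monotone_toLex_div_mod hH (Nat.le_succ t))) le_rfl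
  have hnext : ∀ t < K * H, Measurable[ℱ (toLex ((t + 1) / H, (t + 1) % H))]
      (s (t / H) (t % H + 1)) := fun t ht =>
    (hrun.measurable_state _ (div_lt_of_lt_mul' ht) _ (hmod t)).mono
      (ℱ.mono (toLex_step_le hH t)) le_rfl
  have key := measure_exists_selfNormalized_le (μ := μ) (N := K * H)
    (𝒢 := fun t => ℱ (toLex (t / H, t % H))) (fun t => ℱ.le _)
    (fun i j hij => ℱ.mono (monotone_toLex_div_mod hH hij)) (ξ := ξ) (Q := Q)
    (fun t ht => measurable_comp_of_countable (fun z : (S × A) × S =>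
      (noise M φ θ z.1.1 z.1.2 z.2).ofLp) ((hpair t ht).prodMk (hnext t ht)))
    (fun t ht i j => measurable_comp_of_countable (fun z : S × A =>
      featMatrix M φ z.1 z.2 i j) (hpair t ht))
    (fun t ω => featMatrix_posSemidef M φ _ _) ?_ hlam hδ (fun _ _ => rfl) (fun _ _ => rfl)
  · refine (measure_mono ?_).trans key
    rintro ω ⟨k, hk, h⟩
    refine ⟨k * H, Nat.mul_le_mul_right H hk, ?_⟩
    have e1 : ∑ t ∈ Finset.range (k * H), Q t ω = ∑ i ∈ Finset.range k, ∑ h ∈ Finset.range H,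
        featMatrix M φ (s i h ω) (a i h ω) :=
      sum_range_mul_eq hH (fun i h => featMatrix M φ (s i h ω) (a i h ω)) k
    have e2 : ∑ t ∈ Finset.range (k * H), ξ t ω =
        (∑ i ∈ Finset.range k, ∑ h ∈ Finset.range H,
            noise M φ θ (s i h ω) (a i h ω) (s i (h + 1) ω)).ofLp := by
      rw [← sum_range_mul_eq hH (fun i h => noise M φ θ (s i h ω) (a i h ω) (s i (h + 1) ω)),
        WithLp.ofLp_sum]
    simp only [e1, e2]
    rwa [weightedNorm_sq (gram_posDef M φ H hlam _ _ k).inv.posSemidef] at h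
  · intro t ht v f hf
    have hk := div_lt_of_lt_mul' ht
    have hz := hrun.measurable_pair hk (hmod t)
    have hc := measurable_comp_of_countable (fun z : S × A =>
      1 / 4 * (v ⬝ᵥ (featMatrix M φ z.1 z.2 *ᵥ v))) hz
    have hmean := measurable_comp_of_countable (fun z : S × A => ∑ s' ∈ M.reach z.1 z.2,
      (M.P z.1 z.2 s').toReal * (v ⬝ᵥ (φ z.1 z.2 s').ofLp)) hz
    have := (hrun.isCondLaw hk (hmod t)).lintegral_mul_exp_le
      (fun ω => M.reach (s (t / H) (t % H) ω) (a (t / H) (t % H) ω))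
      (fun ω s' h => (M.mem_reach _ _ _).2 h)
      (g := fun ω s' => v ⬝ᵥ (φ (s (t / H) (t % H) ω) (a (t / H) (t % H) ω) s').ofLp)
      (c := fun ω => 1 / 4 * (v ⬝ᵥ (Q t ω *ᵥ v)))
      (fun s' => measurable_comp_of_countable (fun z : S × A => v ⬝ᵥ (φ z.1 z.2 s').ofLp) hz)
      (fun _ => rfl)
      hmean hc ?_ hf
    · refine le_trans (le_of_eq (lintegral_congr fun ω => ?_)) this
      simp only [expWeight, hξ, dotProduct_noise hmnl]
    · intro ω
      obtain ⟨x, y, hxy, hle⟩ := sq_sub_le_two_mul_sum_sq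
        (reach_nonempty M (s (t / H) (t % H) ω) (a (t / H) (t % H) ω))
        fun s' => v ⬝ᵥ (φ (s (t / H) (t % H) ω) (a (t / H) (t % H) ω) s').ofLp
      refine ⟨x, y, hxy, ?_⟩
      simp only [hQ]
      rw [dotProduct_featMatrix_mulVec]
      linarith

/-- The Gram matrix is a function of the finite history of earlier episodes, which takes countably
many values, so any function of it is measurable. -/
theorem IsRun.measurable_featWidth (hrun : IsRun M φ Θ rule H K lam β μ ℱ s a est pol)
    {k : ℕ} (hk : k < K) (x : S) (u : A) :
    Measurable[ℱ (toLex (k, 0))] fun ω => featWidth M φ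
      (gram M φ H lam (fun i j => s i j ω) (fun i j => a i j ω) k) x u := by
  have hhist : Measurable[ℱ (toLex (k, 0))] fun ω => fun p : Fin k × Fin H =>
      (s p.1 p.2 ω, a p.1 p.2 ω) := by
    refine @measurable_pi_lambda _ _ _ (ℱ (toLex (k, 0))) _ _ fun p => ?_
    refine (hrun.measurable_pair (p.1.2.trans hk) p.2.2).mono (ℱ.mono ?_) le_rfl
    rw [Prod.Lex.toLex_le_toLex]
    exact Or.inl p.1.2
  have e : ∀ ω, gram M φ H lam (fun i j => s i j ω) (fun i j => a i j ω) k =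
      lam • (1 : Matrix (Fin d) (Fin d) ℝ) +
        ∑ i : Fin k, ∑ j : Fin H, featMatrix M φ (s i j ω) (a i j ω) := by
    intro ω
    rw [gram_eq, Finset.sum_range]
    simp_rw [Finset.sum_range]
  simp_rw [e]
  have h := measurable_comp_of_countable (fun y : Fin k × Fin H → S × A => featWidth M φ
    (lam • (1 : Matrix (Fin d) (Fin d) ℝ) +
      ∑ i : Fin k, ∑ j : Fin H, featMatrix M φ (y (i, j)).1 (y (i, j)).2) x u) hhist
  exact h

/-- Azuma–Hoeffding at a free scale `η`, for next-state functions that are random but fixed at the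
start of each episode. -/
theorem IsRun.measure_sum_mdiff_le [IsProbabilityMeasure μ]
    (hrun : IsRun M φ Θ rule H K lam β μ ℱ s a est pol) (hH : 0 < H)
    {W : ℕ → ℕ → Ω → S → ℝ} {b : ℝ} (hWm : ∀ k < K, ∀ h < H, ∀ x,
      Measurable[ℱ (toLex (k, 0))] fun ω => W k h ω x)
    (hW0 : ∀ k h ω x, 0 ≤ W k h ω x) (hWb : ∀ k h ω x, W k h ω x ≤ b) {η : ℝ} (hη : 0 < η) (L : ℝ) :
    μ {ω | L + (K * H : ℕ) * ((η * b) ^ 2 / 8) ≤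
      η * ∑ k ∈ Finset.range K, ∑ h ∈ Finset.range H,
        mdiff M (W k h ω) (s k h ω) (a k h ω) (s k (h + 1) ω)} ≤
      ENNReal.ofReal (Real.exp (-L)) := by
  set y : ℕ → Ω → ℝ := fun t ω => η * mdiff M (W (t / H) (t % H) ω) (s (t / H) (t % H) ω)
    (a (t / H) (t % H) ω) (s (t / H) (t % H + 1) ω) - (η * b) ^ 2 / 8 with hy
  have hmod : ∀ t, t % H < H := fun t => Nat.mod_lt t hH
  have hWm' : ∀ t < K * H, ∀ x, Measurable[ℱ (toLex (t / H, t % H))]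
      fun ω => W (t / H) (t % H) ω x := by
    intro t ht x
    refine (hWm _ (div_lt_of_lt_mul' ht) _ (hmod t) x).mono (ℱ.mono ?_) le_rfl
    rw [Prod.Lex.toLex_le_toLex]
    exact Or.inr ⟨rfl, Nat.zero_le _⟩
  have hmean : ∀ t < K * H, Measurable[ℱ (toLex (t / H, t % H))] fun ω =>
      transMean M (W (t / H) (t % H) ω) (s (t / H) (t % H) ω) (a (t / H) (t % H) ω) := by
    intro t ht
    refine @measurable_apply_of_countable _ (S × A) _ (ℱ (toLex (t / H, t % H))) _ _ _ _
      (fun ω z => transMean M (W (t / H) (t % H) ω) z.1 z.2) (fun z => ?_) _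
      (hrun.measurable_pair (div_lt_of_lt_mul' ht) (hmod t))
    simp only [transMean]
    exact @Finset.measurable_sum _ _ _ _ _ _ (ℱ (toLex (t / H, t % H))) _ _ fun s' _ =>
      (hWm' t ht s').const_mul _
  have hnext : ∀ t < K * H, Measurable[ℱ (toLex ((t + 1) / H, (t + 1) % H))]
      (s (t / H) (t % H + 1)) := fun t ht =>
    (hrun.measurable_state _ (div_lt_of_lt_mul' ht) _ (hmod t)).mono
      (ℱ.mono (toLex_step_le hH t)) le_rfl
  have hstep : ∀ t, ℱ (toLex (t / H, t % H)) ≤ ℱ (toLex ((t + 1) / H, (t + 1) % H)) := fun t =>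
    ℱ.mono (monotone_toLex_div_mod hH (Nat.le_succ t))
  have key := measure_le_sum_le_exp_neg (μ := μ) (N := K * H)
    (𝒢 := fun t => ℱ (toLex (t / H, t % H))) (fun t => ℱ.le _)
    (fun i j hij => ℱ.mono (monotone_toLex_div_mod hH hij)) (y := y) ?_ ?_ L
  · refine (measure_mono ?_).trans key
    intro ω hω
    have e : ∑ t ∈ Finset.range (K * H), y t ω = η * (∑ k ∈ Finset.range K,
        ∑ h ∈ Finset.range H, mdiff M (W k h ω) (s k h ω) (a k h ω) (s k (h + 1) ω)) -
        (K * H : ℕ) * ((η * b) ^ 2 / 8) := by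
      rw [← sum_range_mul_eq hH (fun k h => mdiff M (W k h ω) (s k h ω) (a k h ω)
        (s k (h + 1) ω)), Finset.mul_sum]
      simp only [hy]
      rw [Finset.sum_sub_distrib, Finset.sum_const, Finset.card_range, nsmul_eq_mul]
    have hω' : L + (K * H : ℕ) * ((η * b) ^ 2 / 8) ≤
      η * ∑ k ∈ Finset.range K, ∑ h ∈ Finset.range H,
        mdiff M (W k h ω) (s k h ω) (a k h ω) (s k (h + 1) ω) := hω
    change L ≤ ∑ t ∈ Finset.range (K * H), y t ω
    rw [e]
    linarith
  · intro t ht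
    refine Measurable.sub_const (Measurable.const_mul (Measurable.sub
      ((hmean t ht).mono (hstep t) le_rfl) ?_) _) _
    exact @measurable_apply_of_countable _ _ _ (ℱ (toLex ((t + 1) / H, (t + 1) % H))) _ _ _ _
      (fun ω x => W (t / H) (t % H) ω x) (fun x => (hWm' t ht x).mono (hstep t) le_rfl) _
      (hnext t ht)
  · intro t ht f hf
    have hk := div_lt_of_lt_mul' ht
    have := (hrun.isCondLaw hk (hmod t)).lintegral_mul_exp_le
      (fun ω => M.reach (s (t / H) (t % H) ω) (a (t / H) (t % H) ω))
      (fun ω s' h => (M.mem_reach _ _ _).2 h)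
      -- The sign is negative because `mdiff` is the mean minus the observed value.
      (g := fun ω s' => -η * W (t / H) (t % H) ω s')
      (mean := fun ω => -η * transMean M (W (t / H) (t % H) ω) (s (t / H) (t % H) ω)
        (a (t / H) (t % H) ω))
      (c := fun _ => (η * b) ^ 2 / 8)
      (fun s' => (hWm' t ht s').const_mul _)
      (fun ω => by
        simp only [transMean]
        rw [Finset.mul_sum]
        exact Finset.sum_congr rfl fun s' _ => by ring)
      ((hmean t ht).const_mul _) measurable_const ?_ hf
    · refine le_trans (le_of_eq (lintegral_congr fun ω => ?_)) this
      simp only [hy, mdiff]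
      congr 3
      ring
    · intro ω
      refine ⟨-η * b, 0, fun s' _ => ⟨?_, ?_⟩, by ring_nf; rfl⟩
      · nlinarith [hWb (t / H) (t % H) ω s']
      · nlinarith [hW0 (t / H) (t % H) ω s']

end Run

/-! ### Deterministic regret decomposition and summation. -/

section Regret

theorem sum_inv_sqrt_le (K : ℕ) :
    ∑ k ∈ Finset.range K, 1 / Real.sqrt (k + 1) ≤ 2 * Real.sqrt K := by
  induction K with
  | zero => simp
  | succ K ih =>
    rw [Finset.sum_range_succ]
    push_cast
    have h0 : (0 : ℝ) ≤ K := Nat.cast_nonneg K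
    have ha := Real.sq_sqrt h0
    have hb := Real.sq_sqrt (show (0 : ℝ) ≤ K + 1 by positivity)
    have hb0 : 0 < Real.sqrt ((K : ℝ) + 1) := Real.sqrt_pos.2 (by positivity)
    have h1 : 1 / Real.sqrt ((K : ℝ) + 1) ≤ 2 * Real.sqrt (K + 1) - 2 * Real.sqrt K := by
      rw [div_le_iff₀ hb0]
      nlinarith [sq_nonneg (Real.sqrt ((K : ℝ) + 1) - Real.sqrt K)]
    linarith

variable {S A : Type*} {d : ℕ} {M : MDP S A} {φ : S → A → S → Vec d}

/-- Dropping the outer truncation, each conditional mean is the value at the actual next state plus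
a martingale difference. The differences keep the truncated functions, so they stay bounded. -/
theorem widthValue_le_sum (H : ℕ) (w : S → A → ℝ) (π : Policy S A) (x : ℕ → S) (n h : ℕ) :
    widthValue M H w π n h (x h) ≤ ∑ j ∈ Finset.range n, (w (x (h + j)) (π (h + j) (x (h + j))) +
      mdiff M (widthValue M H w π (n - (j + 1)) (h + j + 1)) (x (h + j))
        (π (h + j) (x (h + j))) (x (h + j + 1))) := by
  induction n generalizing h with
  | zero => simp [widthValue]
  | succ n ih =>
    rw [Finset.sum_range_succ', widthValue]
    refine (min_le_left _ _).trans ?_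
    have h1 := ih (h + 1)
    have e : ∀ j, h + 1 + j = h + (j + 1) := fun j => by omega
    have e2 : ∀ j, n + 1 - (j + 1 + 1) = n - (j + 1) := fun j => by omega
    simp only [e] at h1
    simp only [e2, add_zero, Nat.zero_add, Nat.add_sub_cancel, mdiff] at h1 ⊢
    linarith

/-- Either `θ` lies in the confidence set of radius `b` and there is no optimism gap, or the error
bound `c` is multiplied by widths so small that a gap `e` per step suffices. -/
theorem optValue_sub_value_le [Nonempty A] {rule : OptimismRule} {H : ℕ} {θ' θ : Vec d}
    {G : Matrix (Fin d) (Fin d) ℝ} (hG : G.PosDef) {b c e w : ℝ} (hb : 0 ≤ b) (hbc : b ≤ c)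
    (hw : ∀ s a, featWidth M φ G s a ≤ w) (he0 : 0 ≤ e) (hmnl : IsMNL M φ θ)
    (hc : weightedNorm G (θ' - θ) ≤ c)
    (he : weightedNorm G (θ' - θ) ≤ b ∨ ∀ s a, 2 * H * c * featWidth M φ G s a ≤ e)
    {π : Policy S A}
    (hπ : ∀ h < H, ∀ x a, optimisticQ M φ rule H θ' G b h x a ≤
      optimisticQ M φ rule H θ' G b h x (π h x)) (s : S) :
    optValue M H 0 s - value M H π 0 s ≤
      H * e + widthValue M H (fun s a => 4 * H * c * featWidth M φ G s a) π H 0 s := by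
  have hopt : ∀ V : S → ℝ, (∀ s, 0 ≤ V s) → (∀ s, V s ≤ H) → ∀ s a,
      M.r s a + mnlMean M φ θ V s a ≤ optBackup M φ rule H θ' G b V s a + e := by
    intro V hV0 hV s a
    rcases he with h | h
    · have := reward_add_mnlMean_le_optBackup_of_mem M φ (rule := rule) hG h hV0 hV s a
      linarith
    · have := reward_add_mnlMean_le_optBackup_add M φ (rule := rule) hG hb hc hV0 hV s a
      linarith [h s a]
  have h1 : optValue M H 0 s ≤ optimisticV M φ rule H θ' G b H s + H * e := by
    obtain ⟨a⟩ := ‹Nonempty A›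
    have : Nonempty (Policy S A) := ⟨fun _ _ => a⟩
    exact ciSup_le fun π' =>
      value_le_optimisticV_add M φ hb hw he0 hmnl hopt π' H 0 (add_zero H) s
  have h2 := optimisticV_le_value_add M φ hb hw hmnl
    (fun V hV0 hV s a => optBackup_le M φ (rule := rule) hG hb hc hbc hV0 hV s a) hπ H 0
    (add_zero H) s
  linarith

theorem sum_sum_le_sqrt {K H : ℕ} {f : ℕ → ℕ → ℝ} {B : ℝ}
    (h : ∑ k ∈ Finset.range K, ∑ h ∈ Finset.range H, f k h ^ 2 ≤ B) :
    ∑ k ∈ Finset.range K, ∑ h ∈ Finset.range H, f k h ≤ Real.sqrt (K * H * B) := by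
  refine Real.le_sqrt_of_sq_le ?_
  rw [← Finset.sum_product'] at h ⊢
  have h1 := sq_sum_le_card_mul_sum_sq (s := Finset.range K ×ˢ Finset.range H)
    (f := fun p => f p.1 p.2)
  rw [Finset.card_product, Finset.card_range, Finset.card_range] at h1
  push_cast at h1
  exact h1.trans (mul_le_mul_of_nonneg_left h (by positivity))

/-- The estimation error radius that holds with the required probability in all episodes. -/
def errorRadius (d : ℕ) (κ lam Lθ Λ : ℝ) : ℝ :=
  κ⁻¹ * (Real.sqrt (2 * d * Λ) + Real.sqrt lam * Lθ)

theorem errorRadius_le {d : ℕ} (hd : 0 < d) {κ lam Lθ Λ : ℝ} (hκ : 0 < κ) (hLθ : 0 < Lθ)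
    (hΛ : 1 ≤ Λ) :
    errorRadius d κ lam Lθ Λ ≤ κ⁻¹ * ((1 + Real.sqrt lam * Lθ) * Real.sqrt (2 * d * Λ)) := by
  have hd' : (1 : ℝ) ≤ d := by exact_mod_cast hd
  have hq : 1 ≤ Real.sqrt (2 * d * Λ) := Real.one_le_sqrt.2 (by nlinarith)
  have h0 : 0 ≤ Real.sqrt lam * Lθ := by positivity
  rw [errorRadius]
  gcongr
  nlinarith

/-- The three contributions to the regret add up to the claimed rate. -/
theorem regret_terms_le {d H K : ℕ} (hd : 0 < d) (hH : 0 < H) {κ lam Lθ Λ ℓ : ℝ} (hκ : 0 < κ)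
    (hκ1 : κ < 1) (hLθ : 0 < Lθ) (hΛ : 1 ≤ Λ) (hℓΛ : ℓ ≤ Λ) :
    (∑ k ∈ Finset.range K, H * (2 * H * errorRadius d κ lam Lθ Λ *
        (Real.sqrt d / Real.sqrt (k + 1)))) +
      4 * H * errorRadius d κ lam Lθ Λ * Real.sqrt (K * H * (2 * H * (d * ℓ))) +
      H * Real.sqrt ((K * H : ℕ)) * (2 * Λ) ≤
    20 * (1 + Real.sqrt lam * Lθ) * (κ⁻¹ * d * Real.sqrt (H ^ 3 * (K * H : ℕ))) * Λ := by
  have hR := errorRadius_le (lam := lam) hd hκ hLθ hΛ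
  have hR0 : 0 ≤ errorRadius d κ lam Lθ Λ := by unfold errorRadius; positivity
  set R := errorRadius d κ lam Lθ Λ
  set c := 1 + Real.sqrt lam * Lθ with hc
  have hc1 : 1 ≤ c := by
    have : 0 ≤ Real.sqrt lam * Lθ := by positivity
    linarith
  set q := Real.sqrt (2 * d * Λ) with hq
  have hd' : (1 : ℝ) ≤ d := by exact_mod_cast hd
  have hH' : (1 : ℝ) ≤ H := by exact_mod_cast hH
  have hq2 : q * q = 2 * d * Λ := Real.mul_self_sqrt (by positivity)
  have hq0 : 0 ≤ q := Real.sqrt_nonneg _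
  set r := Real.sqrt K
  have hr0 : 0 ≤ r := Real.sqrt_nonneg _
  have hB : Real.sqrt (H ^ 3 * (K * H : ℕ)) = H ^ 2 * r := by
    have : (H : ℝ) ^ 3 * (K * H : ℕ) = (H ^ 2) ^ 2 * K := by push_cast; ring
    rw [this, Real.sqrt_mul (by positivity), Real.sqrt_sq (by positivity)]
  have hκi : 1 ≤ κ⁻¹ := (one_le_inv₀ hκ).2 hκ1.le
  have hRq : R * q ≤ κ⁻¹ * c * (2 * d * Λ) := by
    rw [← hq2]
    calc R * q ≤ κ⁻¹ * (c * q) * q := by gcongr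
      _ = _ := by ring
  have hsd : Real.sqrt d ≤ q := Real.sqrt_le_sqrt (by nlinarith)
  have t1 : (∑ k ∈ Finset.range K, H * (2 * H * R * (Real.sqrt d / Real.sqrt (k + 1)))) ≤
      4 * H ^ 2 * r * (R * q) := by
    calc _ = 2 * H ^ 2 * R * Real.sqrt d * ∑ k ∈ Finset.range K, 1 / Real.sqrt (k + 1) := by
          rw [Finset.mul_sum]
          exact Finset.sum_congr rfl fun k _ => by ring
      _ ≤ 2 * H ^ 2 * R * q * (2 * r) := by
          gcongr
          exact sum_inv_sqrt_le K
      _ = _ := by ring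
  have t2 : 4 * H * R * Real.sqrt (K * H * (2 * H * (d * ℓ))) ≤ 4 * H ^ 2 * r * (R * q) := by
    have h1 : Real.sqrt (K * H * (2 * H * (d * ℓ))) ≤ H * r * q := by
      calc Real.sqrt (K * H * (2 * H * (d * ℓ))) ≤ Real.sqrt (H ^ 2 * K * (2 * d * Λ)) := by
            refine Real.sqrt_le_sqrt ?_
            calc (K * H * (2 * H * (d * ℓ)) : ℝ) = H ^ 2 * K * (2 * d * ℓ) := by ring
              _ ≤ _ := by gcongr
        _ = H * r * q := by
            rw [Real.sqrt_mul (by positivity), Real.sqrt_mul (by positivity),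
              Real.sqrt_sq (by positivity)]
    calc _ ≤ 4 * H * R * (H * r * q) := by gcongr
      _ = _ := by ring
  have t3 : H * Real.sqrt ((K * H : ℕ)) * (2 * Λ) ≤ 2 * H ^ 2 * r * Λ := by
    have h1 : Real.sqrt ((K * H : ℕ)) ≤ r * H := by
      push_cast
      rw [Real.sqrt_mul (by positivity)]
      gcongr
      exact Real.sqrt_le_iff.2 ⟨by positivity, by nlinarith⟩
    calc _ ≤ H * (r * H) * (2 * Λ) := by gcongr
      _ = _ := by ring
  have t4 : 4 * H ^ 2 * r * (R * q) ≤ 4 * H ^ 2 * r * (κ⁻¹ * c * (2 * d * Λ)) := by gcongr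
  have t5 : 2 * H ^ 2 * r * Λ ≤ 2 * H ^ 2 * r * (κ⁻¹ * c * (d * Λ)) := by
    gcongr
    calc Λ = 1 * 1 * (1 * Λ) := by ring
      _ ≤ κ⁻¹ * c * (d * Λ) := by gcongr
  rw [hB]
  have t6 : 0 ≤ (H : ℝ) ^ 2 * r * (κ⁻¹ * c * (d * Λ)) := by positivity
  -- The optimism gaps, the widths and the martingale contribute 8, 8 and 2; the constant 20 is a
  -- rounding of 18.
  calc _ ≤ 4 * H ^ 2 * r * (κ⁻¹ * c * (2 * d * Λ)) + 4 * H ^ 2 * r * (κ⁻¹ * c * (2 * d * Λ)) +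
        2 * H ^ 2 * r * (κ⁻¹ * c * (d * Λ)) := by linarith
    _ = 18 * (H ^ 2 * r * (κ⁻¹ * c * (d * Λ))) := by ring
    _ ≤ 20 * (H ^ 2 * r * (κ⁻¹ * c * (d * Λ))) := by linarith
    _ = _ := by ring

theorem log_four_thirds_le : Real.log (4 / 3) ≤ 1 / 2 * Real.log 2 := by
  have h : Real.log ((4 / 3) ^ 2) ≤ Real.log 2 := Real.log_le_log (by norm_num) (by norm_num)
  rw [Real.log_pow] at h
  push_cast at h
  linarith

theorem log_four_thirds_le_one : Real.log (4 / 3) ≤ 1 := by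
  have := Real.log_le_sub_one_of_pos (show (0 : ℝ) < 4 / 3 by norm_num)
  linarith

/-- The effective sample ratio in the confidence radius. -/
def ratio (d H U : ℕ) (lam Lφ : ℝ) (k : ℕ) : ℝ := k * H * U * max 1 (Lφ ^ 2) / (d * lam)

theorem ratio_nonneg {d H U : ℕ} {lam Lφ : ℝ} (hlam : 0 < lam) (k : ℕ) :
    0 ≤ ratio d H U lam Lφ k := by unfold ratio; positivity

theorem ratio_mono {d H U : ℕ} {lam Lφ : ℝ} (hlam : 0 < lam) {k k' : ℕ} (h : k ≤ k') :
    ratio d H U lam Lφ k ≤ ratio d H U lam Lφ k' := by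
  unfold ratio
  gcongr

theorem log_one_add_ratio_mono {d H U : ℕ} {lam Lφ : ℝ} (hlam : 0 < lam) {k k' : ℕ}
    (h : k ≤ k') :
    Real.log (1 + ratio d H U lam Lφ k) ≤ Real.log (1 + ratio d H U lam Lφ k') :=
  Real.log_le_log (by linarith [ratio_nonneg (d := d) (H := H) (U := U) (Lφ := Lφ) hlam k])
    (by linarith [ratio_mono (d := d) (H := H) (U := U) (Lφ := Lφ) hlam h])

/-- A ratio below 1 forces `(k + 1) Lφ² ≤ d λ`. In these early episodes the regularization alone
makes the widths summable at rate `√(dK)`. -/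
theorem div_sqrt_le_of_ratio_lt_one {d H U k : ℕ} (hd : 0 < d) (hH : 0 < H) (hU : 0 < U)
    {lam Lφ : ℝ} (hlam : 0 < lam) (hLφ : 0 < Lφ) (h : ratio d H U lam Lφ (k + 1) < 1) :
    Lφ / Real.sqrt lam ≤ Real.sqrt d / Real.sqrt (k + 1) := by
  have hd' : (0 : ℝ) < d := Nat.cast_pos.2 hd
  have hH' : (1 : ℝ) ≤ H := by exact_mod_cast hH
  have hU' : (1 : ℝ) ≤ U := by exact_mod_cast hU
  rw [ratio, div_lt_one (by positivity)] at h
  push_cast at h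
  have h1 : (k + 1) * Lφ ^ 2 ≤ d * lam := by
    refine le_trans ?_ h.le
    calc ((k : ℝ) + 1) * Lφ ^ 2 = (k + 1) * 1 * 1 * Lφ ^ 2 := by ring
      _ ≤ (k + 1) * H * U * max 1 (Lφ ^ 2) := by
          gcongr
          exact le_max_right _ _
  rw [← Real.sqrt_div' _ (by positivity)]
  refine Real.le_sqrt_of_sq_le ?_
  rw [div_pow, Real.sq_sqrt hlam.le, div_le_div_iff₀ hlam (by positivity)]
  linarith

end Regret

/-! ### The regret on the good event. -/

section Main

variable {S A Ω : Type*} [Nonempty A] [MeasurableSpace S] [MeasurableSpace A]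
  {mΩ : MeasurableSpace Ω} {d : ℕ} {M : MDP S A} {φ : S → A → S → Vec d} {Θ : Set (Vec d)}
  {rule : OptimismRule} {H K U : ℕ} {lam : ℝ} {μ : Measure Ω}
  {ℱ : Filtration (ℕ ×ₗ ℕ) mΩ} {s : ℕ → ℕ → Ω → S} {a : ℕ → ℕ → Ω → A} {est : ℕ → Ω → Vec d}
  {pol : ℕ → Ω → Policy S A} {θstar : Vec d} {κ δ Lφ Lθ : ℝ}

/-- A ratio of at least 1 gives `log (4/3) ≤ ½ log 2 ≤ ½ d log (1 + ratio)`, so the unused half of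
the logarithm in the radius pays for the smaller failure probability of the noise bound. -/
theorem sqrt_add_le_radius (hd : 0 < d) (hκ : 0 < κ) (hδ : 0 < δ) (hδ1 : δ < 1)
    {k : ℕ} (h1 : 1 ≤ ratio d H U lam Lφ (k + 1)) {N W : ℝ}
    (hN : N ^ 2 ≤ 1 / 2 * (d * Real.log (1 + ratio d H U lam Lφ (k + 1))) +
      (Real.log (1 / δ) + Real.log (4 / 3)))
    (hW : κ * W ≤ N + Real.sqrt lam * Lθ) :
    W ≤ radius d H U κ lam Lφ Lθ δ (k + 1) := by
  have hd' : (1 : ℝ) ≤ d := by exact_mod_cast hd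
  have hlδ : 0 < Real.log (1 / δ) := Real.log_pos ((one_lt_div hδ).2 hδ1)
  have hl2 : Real.log 2 ≤ Real.log (1 + ratio d H U lam Lφ (k + 1)) :=
    Real.log_le_log (by norm_num) (by linarith)
  have hl0 : 0 < Real.log 2 := Real.log_pos (by norm_num)
  have h2 : N ≤ Real.sqrt (d * Real.log (1 + ratio d H U lam Lφ (k + 1)) +
      2 * Real.log (1 / δ)) := by
    refine Real.le_sqrt_of_sq_le (hN.trans ?_)
    nlinarith [log_four_thirds_le]
  rw [radius]
  change W ≤ 1 / κ * Real.sqrt (d * Real.log (1 + ratio d H U lam Lφ (k + 1)) +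
      2 * Real.log (1 / δ)) + 1 / κ * Real.sqrt lam * Lθ
  have e : 1 / κ * Real.sqrt (d * Real.log (1 + ratio d H U lam Lφ (k + 1)) +
      2 * Real.log (1 / δ)) + 1 / κ * Real.sqrt lam * Lθ =
      (Real.sqrt (d * Real.log (1 + ratio d H U lam Lφ (k + 1)) +
      2 * Real.log (1 / δ)) + Real.sqrt lam * Lθ) / κ := by ring
  rw [e, le_div_iff₀ hκ]
  linarith

theorem radius_nonneg (hκ : 0 < κ) (hLθ : 0 < Lθ) (k : ℕ) :
    0 ≤ radius d H U κ lam Lφ Lθ δ k := by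
  unfold radius
  positivity

theorem radius_le_errorRadius (hd : 0 < d) (hlam : 0 < lam) (hκ : 0 < κ) (hδ : 0 < δ)
    (hδ1 : δ < 1) {k : ℕ} (hk : k ≤ K) :
    radius d H U κ lam Lφ Lθ δ k ≤ errorRadius d κ lam Lθ
      (1 + Real.log (1 + ratio d H U lam Lφ K) + Real.log (1 / δ)) := by
  have hd' : (1 : ℝ) ≤ d := by exact_mod_cast hd
  have hlδ : 0 < Real.log (1 / δ) := Real.log_pos ((one_lt_div hδ).2 hδ1)
  have hm := log_one_add_ratio_mono (d := d) (H := H) (U := U) (Lφ := Lφ) hlam hk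
  have h0 : 0 ≤ Real.log (1 + ratio d H U lam Lφ k) :=
    Real.log_nonneg (by linarith [ratio_nonneg (d := d) (H := H) (U := U) (Lφ := Lφ) hlam k])
  rw [radius, errorRadius]
  change 1 / κ * Real.sqrt (d * Real.log (1 + ratio d H U lam Lφ k) +
      2 * Real.log (1 / δ)) + 1 / κ * Real.sqrt lam * Lθ ≤ _
  rw [one_div, mul_assoc κ⁻¹ (Real.sqrt lam), ← mul_add]
  gcongr
  nlinarith

theorem le_errorRadius (hd : 0 < d) (hlam : 0 < lam) (hκ : 0 < κ) (hδ : 0 < δ)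
    (hδ1 : δ < 1) {k : ℕ} (hk : k ≤ K) {N W : ℝ}
    (hN : N ^ 2 ≤ 1 / 2 * (d * Real.log (1 + ratio d H U lam Lφ k)) +
      (Real.log (1 / δ) + Real.log (4 / 3)))
    (hW : κ * W ≤ N + Real.sqrt lam * Lθ) :
    W ≤ errorRadius d κ lam Lθ
      (1 + Real.log (1 + ratio d H U lam Lφ K) + Real.log (1 / δ)) := by
  have hd' : (1 : ℝ) ≤ d := by exact_mod_cast hd
  have hlδ : 0 < Real.log (1 / δ) := Real.log_pos ((one_lt_div hδ).2 hδ1)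
  have hm := log_one_add_ratio_mono (d := d) (H := H) (U := U) (Lφ := Lφ) hlam hk
  have h0 : 0 ≤ Real.log (1 + ratio d H U lam Lφ k) :=
    Real.log_nonneg (by linarith [ratio_nonneg (d := d) (H := H) (U := U) (Lφ := Lφ) hlam k])
  rw [errorRadius, inv_mul_eq_div, le_div_iff₀ hκ]
  have h2 : N ≤ Real.sqrt (2 * d *
      (1 + Real.log (1 + ratio d H U lam Lφ K) + Real.log (1 / δ))) := by
    refine Real.le_sqrt_of_sq_le (hN.trans ?_)
    nlinarith [log_four_thirds_le_one]
  linarith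

/-- The regret bound on the event that the noise and the martingale are controlled. -/
theorem IsRun.regret_le
    (hrun : IsRun M φ Θ rule H K lam (radius d H U κ lam Lφ Lθ δ) μ ℱ s a est pol)
    (hd : 0 < d) (hH : 0 < H) (hU : 0 < U)
    (hcard : ∀ x u, (M.reach x u).card ≤ U) (hmnl : IsMNL M φ θstar)
    (h0 : ∀ x u, ∃ s' ∈ M.reach x u, φ x u s' = 0) (hLφ : 0 < Lφ) (hLθ : 0 < Lθ)
    (hφ : ∀ x u, ∀ s' ∈ M.reach x u, ‖φ x u s'‖ ≤ Lφ) (hθ : ‖θstar‖ ≤ Lθ)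
    (hΘ : Convex ℝ Θ) (hθΘ : θstar ∈ Θ) (hκ : 0 < κ) (hκ1 : κ < 1)
    (hprob : ∀ x u, ∀ s' ∈ M.reach x u, ∀ s'' ∈ M.reach x u, ∀ θ ∈ Θ,
      κ ≤ mnlProb M φ θ x u s' * mnlProb M φ θ x u s'')
    (hδ : 0 < δ) (hδ1 : δ < 1) (hlam : Lφ ^ 2 ≤ lam) {ω : Ω}
    (hreach : ∀ k < K, ∀ h < H, s k (h + 1) ω ∈ M.reach (s k h ω) (a k h ω))
    (hnoise : ∀ k ≤ K, weightedNorm (gram M φ H lam (fun i j => s i j ω)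
        (fun i j => a i j ω) k)⁻¹ (∑ i ∈ Finset.range k, ∑ h ∈ Finset.range H,
          noise M φ θstar (s i h ω) (a i h ω) (s i (h + 1) ω)) ^ 2 <
      1 / 2 * Real.log ((gram M φ H lam (fun i j => s i j ω)
          (fun i j => a i j ω) k).det / lam ^ d) + Real.log (1 / (3 / 4 * δ)))
    (hmart : ∑ k ∈ Finset.range K, ∑ h ∈ Finset.range H,
        mdiff M (widthValue M H (fun x u => 4 * H * errorRadius d κ lam Lθ
            (1 + Real.log (1 + ratio d H U lam Lφ K) + Real.log (1 / δ)) * featWidth M φ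
            (gram M φ H lam (fun i j => s i j ω) (fun i j => a i j ω) k) x u)
            (pol k ω) (H - (h + 1)) (h + 1))
          (s k h ω) (a k h ω) (s k (h + 1) ω) ≤
      H * Real.sqrt ((K * H : ℕ)) *
        (2 * (1 + Real.log (1 + ratio d H U lam Lφ K) + Real.log (1 / δ)))) :
    regret M H K (fun k => pol k ω) (fun k => s k 0 ω) ≤
      20 * (1 + Real.sqrt lam * Lθ) * (κ⁻¹ * d * Real.sqrt (H ^ 3 * (K * H : ℕ))) *
        (1 + Real.log (1 + ratio d H U lam Lφ K) + Real.log (1 / δ)) := by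
  have hlam0 : 0 < lam := lt_of_lt_of_le (by positivity) hlam
  have hlδ : 0 < Real.log (1 / δ) := Real.log_pos ((one_lt_div hδ).2 hδ1)
  have hℓ0 : 0 ≤ Real.log (1 + ratio d H U lam Lφ K) :=
    Real.log_nonneg (by linarith [ratio_nonneg (d := d) (H := H) (U := U) (Lφ := Lφ) hlam0 K])
  have hlog : Real.log (1 / (3 / 4 * δ)) = Real.log (1 / δ) + Real.log (4 / 3) := by
    rw [← Real.log_mul (by positivity) (by positivity)]
    congr 1
    field_simp
  set Λ := 1 + Real.log (1 + ratio d H U lam Lφ K) + Real.log (1 / δ) with hΛ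
  set R := errorRadius d κ lam Lθ Λ with hR
  set G := fun k => gram M φ H lam (fun i j => s i j ω) (fun i j => a i j ω) k with hGdef
  have hG : ∀ k, (G k).PosDef := fun k => gram_posDef M φ H hlam0 _ _ k
  have hR0 : 0 ≤ R := by rw [hR]; unfold errorRadius; positivity
  have hwid : ∀ k x u, featWidth M φ (G k) x u ≤ Lφ / Real.sqrt lam := fun k x u =>
    featWidth_gram_le M φ hlam0 _ _ k (hφ x u)
  have hdet : ∀ k, Real.log ((G k).det / lam ^ d) ≤
      d * Real.log (1 + ratio d H U lam Lφ k) := fun k =>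
    log_det_gram_le M φ hd hlam0 hcard hφ _ _ k
  have hepisode : ∀ k ∈ Finset.range K,
      optValue M H 0 (s k 0 ω) - value M H (pol k ω) 0 (s k 0 ω) ≤
        H * (2 * H * R * (Real.sqrt d / Real.sqrt (k + 1))) +
          ∑ h ∈ Finset.range H, (4 * H * R * featWidth M φ (G k) (s k h ω) (a k h ω) +
            mdiff M (widthValue M H (fun x u => 4 * H * R * featWidth M φ (G k) x u)
              (pol k ω) (H - (h + 1)) (h + 1)) (s k h ω) (a k h ω) (s k (h + 1) ω)) := by
    intro k hk
    have hk' : k < K := Finset.mem_range.1 hk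
    have hmle := (hrun.est_mle k hk' ω).weightedNorm_le M φ hΘ hlam0 hκ1.le hθΘ hθ h0 hprob
      fun i hi h hh => hreach i (hi.trans hk') h hh
    have hN : weightedNorm (G k)⁻¹ (∑ i ∈ Finset.range k, ∑ h ∈ Finset.range H,
          noise M φ θstar (s i h ω) (a i h ω) (s i (h + 1) ω)) ^ 2 ≤
        1 / 2 * (d * Real.log (1 + ratio d H U lam Lφ (k + 1))) +
          (Real.log (1 / δ) + Real.log (4 / 3)) := by
      refine (hnoise k hk'.le).le.trans ?_
      rw [hlog]
      -- The estimate uses `k` past episodes but the radius has index `k + 1`, since episodes are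
      -- numbered from 0 here.
      have h1 : (d : ℝ) * Real.log (1 + ratio d H U lam Lφ k) ≤
          d * Real.log (1 + ratio d H U lam Lφ (k + 1)) :=
        mul_le_mul_of_nonneg_left (log_one_add_ratio_mono hlam0 (Nat.le_succ k))
          (Nat.cast_nonneg d)
      have h2 := hdet k
      simp only [hGdef] at h2
      linarith
    have hconf : weightedNorm (G k) (est k ω - θstar) ≤ R :=
      le_errorRadius hd hlam0 hκ hδ hδ1 hk' hN hmle
    have hs0 : 0 ≤ Real.sqrt d / Real.sqrt (k + 1) := by positivity
    have hreg := optValue_sub_value_le (rule := rule) (e := 2 * H * R *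
      (Real.sqrt d / Real.sqrt (k + 1))) (hG k) (radius_nonneg hκ hLθ (k + 1))
      (radius_le_errorRadius hd hlam0 hκ hδ hδ1 hk') (hwid k) (by positivity) hmnl hconf
      (by
        -- Late episodes are optimistic; in early ones the small widths bound the gap instead.
        by_cases h1 : 1 ≤ ratio d H U lam Lφ (k + 1)
        · exact Or.inl (sqrt_add_le_radius hd hκ hδ hδ1 h1 hN hmle)
        · refine Or.inr fun x u => ?_
          have := (hwid k x u).trans
            (div_sqrt_le_of_ratio_lt_one hd hH hU hlam0 hLφ (not_le.1 h1))
          gcongr)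
      (hrun.greedy k hk' ω) (s k 0 ω)
    refine hreg.trans (add_le_add le_rfl ?_)
    have hw := widthValue_le_sum (M := M) H (fun x u => 4 * H * R * featWidth M φ (G k) x u)
      (pol k ω) (fun h => s k h ω) H 0
    refine hw.trans (le_of_eq (Finset.sum_congr rfl fun h hh => ?_))
    rw [zero_add, ← hrun.action k hk' ω h (Finset.mem_range.1 hh)]
  have hpot : ∑ k ∈ Finset.range K, ∑ h ∈ Finset.range H,
      featWidth M φ (G k) (s k h ω) (a k h ω) ^ 2 ≤
      2 * H * (d * Real.log (1 + ratio d H U lam Lφ K)) :=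
    (sum_featWidth_sq_le M φ hH hLφ hlam hφ _ _ K).trans
      (mul_le_mul_of_nonneg_left (hdet K) (by positivity))
  have hsumw := sum_sum_le_sqrt hpot
  calc regret M H K (fun k => pol k ω) (fun k => s k 0 ω)
      ≤ ∑ k ∈ Finset.range K, (H * (2 * H * R * (Real.sqrt d / Real.sqrt (k + 1))) +
          ∑ h ∈ Finset.range H, (4 * H * R * featWidth M φ (G k) (s k h ω) (a k h ω) +
            mdiff M (widthValue M H (fun x u => 4 * H * R * featWidth M φ (G k) x u)
              (pol k ω) (H - (h + 1)) (h + 1)) (s k h ω) (a k h ω) (s k (h + 1) ω))) :=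
        Finset.sum_le_sum hepisode
    _ = ∑ k ∈ Finset.range K, H * (2 * H * R * (Real.sqrt d / Real.sqrt (k + 1))) +
        4 * H * R * (∑ k ∈ Finset.range K, ∑ h ∈ Finset.range H,
          featWidth M φ (G k) (s k h ω) (a k h ω)) +
        ∑ k ∈ Finset.range K, ∑ h ∈ Finset.range H,
            mdiff M (widthValue M H (fun x u => 4 * H * R * featWidth M φ (G k) x u)
              (pol k ω) (H - (h + 1)) (h + 1)) (s k h ω) (a k h ω) (s k (h + 1) ω) := by
        simp only [Finset.sum_add_distrib, Finset.mul_sum]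
        ring
    _ ≤ ∑ k ∈ Finset.range K, H * (2 * H * R * (Real.sqrt d / Real.sqrt (k + 1))) +
        4 * H * R * Real.sqrt (K * H * (2 * H * (d * Real.log (1 + ratio d H U lam Lφ K)))) +
        H * Real.sqrt ((K * H : ℕ)) * (2 * Λ) := by
        refine add_le_add (add_le_add le_rfl ?_) hmart
        exact mul_le_mul_of_nonneg_left hsumw (by positivity)
    _ ≤ _ := regret_terms_le hd hH hκ hκ1 hLθ (by rw [hΛ]; linarith) (by rw [hΛ]; linarith)

end Main


/-- The scale `η = 1 / (H √(KH))` makes the total Hoeffding correction equal to `1/8`, and `log 4 +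
1/8 < 2`. -/
theorem azuma_threshold_le {H K : ℕ} (hH : 0 < H) (hK : 0 < K) {m δ ℓ : ℝ} (hδ : 0 < δ)
    (hδ1 : δ < 1) (hℓ : 0 ≤ ℓ)
    (h : (1 / (H * Real.sqrt ((K * H : ℕ)))) * m < Real.log (4 / δ) +
      (K * H : ℕ) * ((1 / (H * Real.sqrt ((K * H : ℕ))) * H) ^ 2 / 8)) :
    m ≤ H * Real.sqrt ((K * H : ℕ)) * (2 * (1 + ℓ + Real.log (1 / δ))) := by
  have hN : (0 : ℝ) < (K * H : ℕ) := Nat.cast_pos.2 (Nat.mul_pos hK hH)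
  have hH' : (0 : ℝ) < H := Nat.cast_pos.2 hH
  generalize ((K * H : ℕ) : ℝ) = N at hN h ⊢
  have hs := Real.sqrt_pos.2 hN
  have hs2 := Real.sq_sqrt hN.le
  have e : N * ((1 / (H * Real.sqrt N) * H) ^ 2 / 8) = 1 / 8 := by
    have : 1 / (H * Real.sqrt N) * H = 1 / Real.sqrt N := by field_simp
    rw [this, div_pow, hs2]
    field_simp
  rw [e, one_div_mul_eq_div, div_lt_iff₀ (by positivity)] at h
  have hlδ : 0 < Real.log (1 / δ) := Real.log_pos ((one_lt_div hδ).2 hδ1)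
  have h4 : Real.log (4 / δ) + 1 / 8 ≤ 2 * (1 + ℓ + Real.log (1 / δ)) := by
    have e4 : (4 : ℝ) / δ = 2 * 2 * (1 / δ) := by ring
    rw [e4, Real.log_mul (by norm_num) (by positivity), Real.log_mul (by norm_num) (by norm_num)]
    linarith [Real.log_two_lt_d9]
  calc m ≤ (Real.log (4 / δ) + 1 / 8) * (H * Real.sqrt N) := h.le
    _ ≤ (2 * (1 + ℓ + Real.log (1 / δ))) * (H * Real.sqrt N) := by gcongr
    _ = _ := by ring

end MNLRL

end

/-! ### The theorem: union bound over the bad events. -/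

theorem theorem1 :
    ∃ C : ℝ, 0 < C ∧
      ∀ (S A Ω : Type*) [Countable S] [MeasurableSpace S] [DiscreteMeasurableSpace S]
        [Countable A] [Nonempty A] [MeasurableSpace A] [DiscreteMeasurableSpace A]
        [mΩ : MeasurableSpace Ω] (μ : MeasureTheory.Measure Ω)
        [MeasureTheory.IsProbabilityMeasure μ]
        (d H K U : ℕ) (_ : 0 < d) (_ : 0 < H) (_ : 0 < K)
        (M : MNLRL.MDP S A)
        (_ : IsGreatest (Set.range fun x : S × A => (M.reach x.1 x.2).card) U)
        (φ : S → A → S → MNLRL.Vec d) (θstar : MNLRL.Vec d)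
        -- the transition model
        (_ : MNLRL.IsMNL M φ θstar)
        -- in each set of reachable states some state has feature zero
        (_ : ∀ s a, ∃ s' ∈ M.reach s a, φ s a s' = 0)
        -- bounded features and parameter
        (Lφ Lθ : ℝ) (_ : 0 < Lφ) (_ : 0 < Lθ)
        (_ : ∀ s a, ∀ s' ∈ M.reach s a, ‖φ s a s'‖ ≤ Lφ) (_ : ‖θstar‖ ≤ Lθ)
        -- the parameter set, and the lower bound on products of probabilities
        (Θ : Set (MNLRL.Vec d)) (_ : Convex ℝ Θ) (_ : (0 : MNLRL.Vec d) ∈ Θ) (_ : θstar ∈ Θ)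
        (κ : ℝ) (_ : 0 < κ) (_ : κ < 1)
        (_ : ∀ s a, ∀ s' ∈ M.reach s a, ∀ s'' ∈ M.reach s a, ∀ θ ∈ Θ,
          κ ≤ MNLRL.mnlProb M φ θ s a s' * MNLRL.mnlProb M φ θ s a s'')
        (δ lam : ℝ) (_ : 0 < δ) (_ : δ < 1) (_ : Lφ ^ 2 ≤ lam)
        -- the algorithm
        (rule : MNLRL.OptimismRule) (ℱ : MeasureTheory.Filtration (ℕ ×ₗ ℕ) mΩ)
        (s : ℕ → ℕ → Ω → S) (a : ℕ → ℕ → Ω → A) (est : ℕ → Ω → MNLRL.Vec d)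
        (pol : ℕ → Ω → MNLRL.Policy S A)
        (_ : MNLRL.IsRun M φ Θ rule H K lam (MNLRL.radius d H U κ lam Lφ Lθ δ) μ ℱ s a est pol),
        ENNReal.ofReal (1 - δ) ≤
          μ {ω | MNLRL.regret M H K (fun k => pol k ω) (fun k => s k 0 ω) ≤
            C * (1 + Real.sqrt lam * Lθ) * (κ⁻¹ * d * Real.sqrt (H ^ 3 * (K * H : ℕ))) *
              (1 + Real.log (1 + K * H * U * max 1 (Lφ ^ 2) / (d * lam))
                + Real.log (1 / δ))} := by
  refine ⟨20, by norm_num, ?_⟩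
  intro S A Ω _ _ _ _ _ _ _ mΩ μ _ d H K U hd hH hK M hU φ θstar hmnl h0 Lφ Lθ hLφ hLθ hφ hθ Θ
    hΘ _ hθΘ κ hκ hκ1 hprob δ lam hδ hδ1 hlam rule ℱ s a est pol hrun
  have hlam0 : 0 < lam := lt_of_lt_of_le (by positivity) hlam
  have hcard : ∀ x u, (M.reach x u).card ≤ U := fun x u => hU.2 ⟨(x, u), rfl⟩
  have hU0 : 0 < U := by
    obtain ⟨⟨x, u⟩, -⟩ := hU.1
    exact lt_of_lt_of_le (Finset.card_pos.2 (MNLRL.reach_nonempty M x u)) (hcard x u)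
  have hℓ0 : 0 ≤ Real.log (1 + MNLRL.ratio d H U lam Lφ K) :=
    Real.log_nonneg (by linarith [MNLRL.ratio_nonneg (d := d) (H := H) (U := U) (Lφ := Lφ) hlam0 K])
  have hlδ : 0 < Real.log (1 / δ) := Real.log_pos ((one_lt_div hδ).2 hδ1)
  set R := MNLRL.errorRadius d κ lam Lθ
    (1 + Real.log (1 + MNLRL.ratio d H U lam Lφ K) + Real.log (1 / δ)) with hR
  have hR0 : 0 ≤ R := by
    rw [hR]; unfold MNLRL.errorRadius; positivity
  set G : ℕ → Ω → Matrix (Fin d) (Fin d) ℝ := fun k ω =>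
    MNLRL.gram M φ H lam (fun i j => s i j ω) (fun i j => a i j ω) k with hG
  set W : ℕ → ℕ → Ω → S → ℝ := fun k h ω => MNLRL.widthValue M H
    (fun x u => 4 * H * R * MNLRL.featWidth M φ (G k ω) x u) (pol k ω) (H - (h + 1)) (h + 1)
    with hW
  -- The failure probability is split as `3δ/4` for the noise and `δ/4` for the martingale. The
  -- larger share keeps the loss at `log (4/3)`, small enough for the radius.
  have hnoise := hrun.measure_noise_le hH hlam0 hmnl (δ := 3 / 4 * δ) (by positivity)
  have hmart := hrun.measure_sum_mdiff_le hH (W := W) (b := H)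
    (fun k hk h hh x => hrun.measurable_widthValue hk
      (w := fun ω x u => 4 * H * R * MNLRL.featWidth M φ (G k ω) x u)
      (fun x u => (hrun.measurable_featWidth hk x u).const_mul _) _ _ (by omega) x)
    (fun k h ω x => MNLRL.widthValue_nonneg M H (fun x u => by
      have := MNLRL.featWidth_nonneg M φ (G k ω) x u
      positivity) _ _ _ _)
    (fun k h ω x => MNLRL.widthValue_le M H _ _ _ _ _)
    (η := 1 / (H * Real.sqrt ((K * H : ℕ)))) (by positivity) (Real.log (4 / δ))
  have hexp : Real.exp (-Real.log (4 / δ)) = δ / 4 := by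
    rw [Real.exp_neg, Real.exp_log (by positivity), inv_div]
  rw [hexp] at hmart
  have hreach := ae_iff.1 hrun.ae_mem_reach
  set E₁ := {ω | ∃ k ≤ K, 1 / 2 * Real.log ((MNLRL.gram M φ H lam (fun i j => s i j ω)
          (fun i j => a i j ω) k).det / lam ^ d) + Real.log (1 / (3 / 4 * δ)) ≤
        MNLRL.weightedNorm (MNLRL.gram M φ H lam (fun i j => s i j ω) (fun i j => a i j ω) k)⁻¹
          (∑ i ∈ Finset.range k, ∑ h ∈ Finset.range H,
            MNLRL.noise M φ θstar (s i h ω) (a i h ω) (s i (h + 1) ω)) ^ 2} with hE₁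
  set E₂ := {ω | Real.log (4 / δ) +
      (K * H : ℕ) * ((1 / (H * Real.sqrt ((K * H : ℕ))) * H) ^ 2 / 8) ≤
      1 / (H * Real.sqrt ((K * H : ℕ))) * ∑ k ∈ Finset.range K, ∑ h ∈ Finset.range H,
        MNLRL.mdiff M (W k h ω) (s k h ω) (a k h ω) (s k (h + 1) ω)} with hE₂
  set E₃ := {ω | ¬ ∀ k < K, ∀ h < H, s k (h + 1) ω ∈ M.reach (s k h ω) (a k h ω)} with hE₃
  set E := {ω | MNLRL.regret M H K (fun k => pol k ω) (fun k => s k 0 ω) ≤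
            20 * (1 + Real.sqrt lam * Lθ) * (κ⁻¹ * d * Real.sqrt (H ^ 3 * (K * H : ℕ))) *
              (1 + Real.log (1 + K * H * U * max 1 (Lφ ^ 2) / (d * lam))
                + Real.log (1 / δ))} with hE
  -- Covering the whole space, instead of taking complements, requires only subadditivity, so
  -- measurability of the regret event is not needed.
  have hcover : (Set.univ : Set Ω) ⊆ E ∪ (E₁ ∪ (E₂ ∪ E₃)) := by
    intro ω _
    by_cases h1 : ω ∈ E₁
    · exact Or.inr (Or.inl h1)
    by_cases h2 : ω ∈ E₂
    · exact Or.inr (Or.inr (Or.inl h2))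
    by_cases h3 : ω ∈ E₃
    · exact Or.inr (Or.inr (Or.inr h3))
    left
    have h1' : ∀ k ≤ K, _ := fun k hk => not_le.1 fun h => h1 ⟨k, hk, h⟩
    exact hrun.regret_le hd hH hU0 hcard hmnl h0 hLφ hLθ hφ hθ hΘ hθΘ hκ hκ1 hprob hδ hδ1 hlam
      (not_not.1 h3) h1' (MNLRL.azuma_threshold_le hH hK hδ hδ1 hℓ0 (not_le.1 h2))
  have hbound : (1 : ENNReal) ≤ μ E + ENNReal.ofReal δ := by
    calc (1 : ENNReal) = μ Set.univ := measure_univ.symm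
      _ ≤ μ (E ∪ (E₁ ∪ (E₂ ∪ E₃))) := measure_mono hcover
      _ ≤ μ E + (μ E₁ + (μ E₂ + μ E₃)) :=
          (measure_union_le _ _).trans (add_le_add le_rfl ((measure_union_le _ _).trans
            (add_le_add le_rfl (measure_union_le _ _))))
      _ ≤ μ E + (ENNReal.ofReal (3 / 4 * δ) + (ENNReal.ofReal (δ / 4) + 0)) := by
          gcongr
          exact hreach.le
      _ = μ E + ENNReal.ofReal δ := by
          rw [add_zero, ← ENNReal.ofReal_add (by positivity) (by positivity)]
          congr 2
          ring
  rw [ENNReal.ofReal_sub _ hδ.le, ENNReal.ofReal_one]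
  exact tsub_le_iff_right.2 hbound
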